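/- Let $(M,\mathcal M)$ be a measurable space, let $m,n,N$ be positive integers with $2\le m<n/2$ and $N<\binom nm$, and let $X_1,\dots,X_n$ be i.i.d. $M$-valued random variables. Let $I_{n,m}$ be the set of tuples $\mathbf i=(i_1,\dots,i_m)$ with $1\le i_1<\dots<i_m\le n$, put $p=N/\binom nm$, and let $(Z_{\mathbf i})_{\mathbf i\in I_{n,m}}$ be i.i.d. Bernoulli random variables with success probability $p$, independent of $(X_i)_{i\le n}$. Let $h:M^m\to\mathbb R$ be a (measurable) symmetric function with $\mathbb E[h]=0$, $\sigma_h^2:=\operatorname{var}[h(X_1,\dots,X_m)]\in(0,\infty)$ and $\mathbb E[|h|^3]<\infty$, where $\mathbb E[t]$ stands for $\mathbb E[t(X_1,\dots,X_r)]$ for a function $t$ of $r$ arguments. The incomplete U-statistic with Bernoulli sampling is $$U'_{n,N}=\frac1{\hat N}\sum_{\mathbf i\in I_{n,m}}Z_{\mathbf i}\,h(X_{i_1},\dots,X_{i_m}),\qquad \hat N=\sum_{\mathbf i\in I_{n,m}}Z_{\mathbf i},$$ with $U'_{n,N}=0$ if $\hat N=0$. For $1\le r\le m$ put $h_r(x_1,\dots,x_r)=\mathbb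 E[h(x_1,\dots,x_r,X_{r+1},\dots,X_m)]$ and let $d=\min\{r:\operatorname{var}[h_r(X_1,\dots,X_r)]>0\}$ be the rank of $h$. Define $$K_{n,m,d}=\binom nm^{-1}\sum_{r=d}^m\binom{m-1}{r-1}\binom{n-m}{m-r},$$ $$\mathfrak B_1=\frac{\mathbb E[|h|^3](1-2p+2p^2)}{\sqrt{N(1-p)}\,\sigma_h^3}+\exp\Big(\frac{-n\sigma_h^6}{24m(\mathbb E[|h|^3])^2}\Big),$$ $$\Psi_1(x)=\mathbb E[h^2(x,X_2,\dots,X_m)],\qquad \tilde\Psi_r(x_1,\dots,x_r)=\mathbb E[h^2(x_1,\dots,x_r,X_{r+1},\dots,X_m)]-\sigma_h^2,$$ the Hoeffding projection kernels of $h^2$ by $\pi_1(h^2)=\tilde\Psi_1$ and, for $2\le r\le m$, $$\pi_r(h^2)(x_1,\dots,x_r)=\tilde\Psi_r(x_1,\dots,x_r)-\sum_{s=1}^{r-1}\ \sum_{1\le j_1<\dots<j_s\le r}\pi_s(h^2)(x_{j_1},\dots,x_{j_s}),$$ and the degenerate remainder in the Hoeffding decomposition of $U_{h^2}=\binom nm^{-1}\sum_{\mathbf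 i\in I_{n,m}}h^2(X_{i_1},\dots,X_{i_m})$ (rescaled by $\sigma_h^2$), $$\mathcal R=\sum_{r=2}^m\binom mr\binom nr^{-1}\sum_{1\le j_1<\dots<j_r\le n}\frac{\pi_r(h^2)(X_{j_1},\dots,X_{j_r})}{\sigma_h^2}.$$ Let $\Phi$ be the standard normal distribution function and $\|Y\|_{q}=(\mathbb E|Y|^{q})^{1/q}$. Then there is an absolute constant $C>0$ (not depending on any of the objects above) such that $$\sup_{z\in\mathbb R}\Big|P\Big(\frac{\sqrt N\,U'_{n,N}}{\sigma_h}\le z\Big)-\Phi(z)\Big|\le C\Big\{\mathfrak B_1+\frac{\sqrt{N K_{n,m,d}}}{\sqrt{1-p}}+\frac{m^{3/2}\,\mathbb E[\Psi_1^{3/2}]}{\sqrt n\,\sigma_h^3}+\|\mathcal R\|_{3/2}\Big\}.$$ If, in addition, $\mathbb E[h^4]<\infty$, then $$\sup_{z\in\mathbb R}\Big|P\Big(\frac{\sqrt N\,U'_{n,N}}{\sigma_h}\le z\Big)-\Phi(z)\Big|\le C\Big\{\mathfrak B_1+\frac{\sqrt{N K_{n,m,d}}}{\sqrt{1-p}}+\frac{\sqrt{m\,\mathbb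 E[(h^2-\sigma_h^2)^2]}}{\sqrt n\,\sigma_h^2}\Big\}.$$ -/

import Mathlib

open MeasureTheory ProbabilityTheory

noncomputable section

namespace IncompleteU

/-- `I_{n,m}`: the strictly increasing `m`-tuples `1 ≤ i₁ < ⋯ < i_m ≤ n`. -/
abbrev Idx (n m : ℕ) : Type := Fin m ↪o Fin n

instance instFintypeIdx (n m : ℕ) : Fintype (Idx n m) := Fintype.ofFinite _

/-- The law of `r` independent observations with common law `ν`. -/
abbrev prodLaw {M : Type*} [MeasurableSpace M] (ν : Measure M) (r : ℕ) : Measure (Fin r → M) :=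
  Measure.pi (fun _ => ν)

/-- `E[t] = E[t(X₁, …, X_r)]` for a function `t` of `r` arguments. -/
def mean {M : Type*} [MeasurableSpace M] (ν : Measure M) {r : ℕ} (t : (Fin r → M) → ℝ) : ℝ :=
  ∫ x, t x ∂(prodLaw ν r)

/-- The function `(x₁, …, x_r) ↦ E[t(x₁, …, x_r, X_{r+1}, …, X_m)]`. -/
def condMean {M : Type*} [MeasurableSpace M] (ν : Measure M) {m : ℕ} (t : (Fin m → M) → ℝ)
    (r : ℕ) (x : Fin r → M) : ℝ :=
  mean ν (fun y : Fin m → M =>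
    t (fun i => if hi : (i : ℕ) < r then x ⟨i, hi⟩ else y i))

/-- `σ_h² = var[h(X₁, …, X_m)]`. -/
def sigmaSq {M : Type*} [MeasurableSpace M] (ν : Measure M) {m : ℕ} (h : (Fin m → M) → ℝ) : ℝ :=
  variance h (prodLaw ν m)

/-- `σ_h`. -/
def sigma {M : Type*} [MeasurableSpace M] (ν : Measure M) {m : ℕ} (h : (Fin m → M) → ℝ) : ℝ :=
  Real.sqrt (sigmaSq ν h)

/-- The rank `d = min {r ∈ {1, …, m} : var[h_r(X₁, …, X_r)] > 0}` of the kernel `h`. -/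
def rank {M : Type*} [MeasurableSpace M] (ν : Measure M) {m : ℕ} (h : (Fin m → M) → ℝ) : ℕ :=
  sInf {r : ℕ | 1 ≤ r ∧ r ≤ m ∧ 0 < variance (condMean ν h r) (prodLaw ν r)}

/-- `Ψ₁(x) = E[h²(x, X₂, …, X_m)]`. -/
def Psi1 {M : Type*} [MeasurableSpace M] (ν : Measure M) {m : ℕ} (h : (Fin m → M) → ℝ)
    (x : M) : ℝ :=
  condMean ν (fun y => h y ^ 2) 1 (fun _ => x)

/-- `Ψ̃_r(x₁, …, x_r) = E[h²(x₁, …, x_r, X_{r+1}, …, X_m)] - σ_h²`. -/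
def PsiTilde {M : Type*} [MeasurableSpace M] (ν : Measure M) {m : ℕ} (h : (Fin m → M) → ℝ)
    (r : ℕ) (x : Fin r → M) : ℝ :=
  condMean ν (fun y => h y ^ 2) r x - sigmaSq ν h

/-- The Hoeffding projection kernels `π_r(h²)`: `π₁(h²) = Ψ̃₁` and
`π_r(h²)(x) = Ψ̃_r(x) - ∑_{s=1}^{r-1} ∑_{j₁ < ⋯ < j_s ≤ r} π_s(h²)(x_{j₁}, …, x_{j_s})`. -/
def hoeffdingKernel {M : Type*} [MeasurableSpace M] (ν : Measure M) {m : ℕ}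
    (h : (Fin m → M) → ℝ) (r : ℕ) (x : Fin r → M) : ℝ :=
  PsiTilde ν h r x -
    ∑ s : Fin r, if 1 ≤ (s : ℕ) then
      ∑ j : Idx r s, hoeffdingKernel ν h (s : ℕ) (fun k => x (j k)) else 0
termination_by r
decreasing_by exact s.isLt

/-- The degenerate remainder `𝓡` in the Hoeffding decomposition of `U_{h²}`, as a function of
the sample. -/
def remainder {M : Type*} [MeasurableSpace M] (ν : Measure M) {m : ℕ} (h : (Fin m → M) → ℝ)
    {n : ℕ} (x : Fin n → M) : ℝ :=
  ∑ r ∈ Finset.Icc 2 m, (m.choose r : ℝ) * ((n.choose r : ℝ))⁻¹ *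
    ∑ j : Idx n r, hoeffdingKernel ν h r (fun k => x (j k)) / sigmaSq ν h

/-- `‖Y‖_q = (E|Y|^q)^{1/q}`. -/
def normLq {Ω : Type*} [MeasurableSpace Ω] (P : Measure Ω) (q : ℝ) (Y : Ω → ℝ) : ℝ :=
  (∫ ω, |Y ω| ^ q ∂P) ^ (1 / q)

/-- The sampling probability `p = N / binom(n, m)`. -/
def sampProb (n m N : ℕ) : ℝ := (N : ℝ) / (n.choose m : ℝ)

/-- `N̂ = ∑_i Z_i`. -/
def Nhat {Ω : Type*} {n m : ℕ} (Z : Idx n m → Ω → ℝ) (ω : Ω) : ℝ := ∑ i, Z i ω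

/-- The incomplete U-statistic `U'_{n,N} = N̂⁻¹ ∑_i Z_i h(X_{i₁}, …, X_{i_m})`
(equal to `0` when `N̂ = 0`). -/
def incompleteU {M Ω : Type*} {n m : ℕ} (h : (Fin m → M) → ℝ) (X : Fin n → Ω → M)
    (Z : Idx n m → Ω → ℝ) (ω : Ω) : ℝ :=
  (∑ i, Z i ω * h (fun k => X (i k) ω)) / Nhat Z ω

/-- `K_{n,m,d} = binom(n,m)⁻¹ ∑_{r=d}^m binom(m-1,r-1) binom(n-m,m-r)`. -/
def Kconst (n m d : ℕ) : ℝ :=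
  ((n.choose m : ℝ))⁻¹ *
    ∑ r ∈ Finset.Icc d m, ((m - 1).choose (r - 1) : ℝ) * ((n - m).choose (m - r) : ℝ)

/-- The bounding term `𝔅₁`. -/
def B1 {M : Type*} [MeasurableSpace M] (ν : Measure M) {m : ℕ} (h : (Fin m → M) → ℝ)
    (n N : ℕ) : ℝ :=
  mean ν (fun x => |h x| ^ 3) * (1 - 2 * sampProb n m N + 2 * sampProb n m N ^ 2) /
      (Real.sqrt ((N : ℝ) * (1 - sampProb n m N)) * sigma ν h ^ 3) +
    Real.exp (-((n : ℝ) * sigma ν h ^ 6) / (24 * (m : ℝ) * mean ν (fun x => |h x| ^ 3) ^ 2))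

/-- `sup_z |P(Y ≤ z) - Φ(z)|`, with `Φ` the standard normal distribution function. -/
def kolmogorovDist {Ω : Type*} [MeasurableSpace Ω] (P : Measure Ω) (Y : Ω → ℝ) : ℝ :=
  ⨆ z : ℝ, |P.real {ω | Y ω ≤ z} - cdf (gaussianReal 0 1) z|

end IncompleteU

end

/-! Condition on the data. With `g i` the value of h / σ on the tuple i, the event {√N U' / σ ≤ z}
coincides, unless every Z vanishes, with {∑ Z_i (√N g_i - z) ≤ 0}. Given the data this is an event
about a weighted sum of independent Bernoulli variables. Stein's method gives a Berry-Esseen bound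
for such sums (`Bern.berryEsseen`). It approximates the conditional probability by Φ((z - √N A₁) /
√v), where A₁ is the average of the g_i and v is 1 - p times the average of (g_i - z/√N)².

The average of g_i² is written 1 + L + R with L centred. A second order expansion of v ↦ Φ(z / √v)
at v = 1 shows that L acts to first order only through -L z φ(z) / 2, which disappears when the data
are integrated out. What remains is quadratic in L, and for small L it is at most |L|^{3/2}. This is
the content of `Bern.abs_prob_sub_Phi_le`, and `IncompleteU.abs_cdf_sub_Phi_le` integrates it. The
argument needs z² ≤ √N. Beyond that range monotonicity and Chebyshev's inequality cost only 1/√N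
(`IncompleteU.kolmogorovDist_le`).

Moment bounds finish the proof. E|A₁| is at most the square root of the variance of the complete
U-statistic. Covariances of summands depend only on the number r of shared indices, form a convex
sequence in r vanishing at r = 0, and hence are at most (r/m) σ² (`IidPi.overlap_le`); they vanish
below the rank. Counting pairs of tuples then yields `Kconst`. For the first bound L is the linear
Hoeffding term of U_{h²} / σ², a sum of i.i.d. centred variables treated by the von Bahr-Esseen
inequality of order 3/2, and R is the degenerate remainder. For the second bound L = 0 and R is the
whole fluctuation of U_{h²} / σ², whose variance is bounded by the same covariance argument with
`Kconst n m 1` = m/n. -/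

noncomputable section

set_option linter.unusedSectionVars false

/-! ### The normal distribution function and Stein's equation -/

namespace Gauss

/-- The standard normal distribution function. -/
def Phi (x : ℝ) : ℝ := cdf (gaussianReal 0 1) x

/-- The standard normal density. -/
def pdf (x : ℝ) : ℝ := gaussianPDFReal 0 1 x

lemma pdf_eq (x : ℝ) : pdf x = (Real.sqrt (2 * Real.pi))⁻¹ * Real.exp (-(x ^ 2) / 2) := by
  simp [pdf, gaussianPDFReal]

lemma pdf_pos (x : ℝ) : 0 < pdf x := gaussianPDFReal_pos 0 1 x one_ne_zero

lemma pdf_neg (x : ℝ) : pdf (-x) = pdf x := by simp [pdf_eq]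

lemma hasDerivAt_pdf (x : ℝ) : HasDerivAt pdf (-(x * pdf x)) x := by
  have h : HasDerivAt (fun x : ℝ => (Real.sqrt (2 * Real.pi))⁻¹ * Real.exp (-(x ^ 2) / 2))
      ((Real.sqrt (2 * Real.pi))⁻¹ * (Real.exp (-(x ^ 2) / 2) * (-(2 * x) / 2))) x := by
    refine HasDerivAt.const_mul _ (HasDerivAt.exp ?_)
    have := (((hasDerivAt_id x).pow 2).neg).div_const 2
    simpa using this
  have h2 : pdf = fun x : ℝ => (Real.sqrt (2 * Real.pi))⁻¹ * Real.exp (-(x ^ 2) / 2) :=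
    funext pdf_eq
  rw [h2]
  convert h using 1
  ring

lemma continuous_pdf : Continuous pdf :=
  continuous_iff_continuousAt.2 fun x => (hasDerivAt_pdf x).continuousAt

lemma integrable_pdf : Integrable pdf := integrable_gaussianPDFReal 0 1

lemma Phi_eq_real (x : ℝ) : Phi x = (gaussianReal 0 1).real (Set.Iic x) := cdf_eq_real _ x

lemma Phi_eq_integral (x : ℝ) : Phi x = ∫ t in Set.Iic x, pdf t := by
  rw [Phi_eq_real, Measure.real, gaussianReal_apply_eq_integral 0 one_ne_zero,
    ENNReal.toReal_ofReal]
  · rfl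
  · exact integral_nonneg fun t => gaussianPDFReal_nonneg 0 1 t

lemma hasDerivAt_Phi (x : ℝ) : HasDerivAt Phi (pdf x) x := by
  have h : Phi = fun y => Phi 0 + ∫ t in (0 : ℝ)..y, pdf t := by
    ext y
    rw [Phi_eq_integral, Phi_eq_integral,
      ← intervalIntegral.integral_Iic_sub_Iic integrable_pdf.integrableOn
        integrable_pdf.integrableOn]
    ring
  rw [h]
  exact (intervalIntegral.integral_hasDerivAt_right (integrable_pdf.intervalIntegrable)
    (continuous_pdf.stronglyMeasurableAtFilter _ _) continuous_pdf.continuousAt).const_add _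

lemma Phi_nonneg (x : ℝ) : 0 ≤ Phi x := cdf_nonneg _ x

lemma Phi_le_one (x : ℝ) : Phi x ≤ 1 := cdf_le_one _ x

lemma Phi_mono : Monotone Phi := monotone_cdf _

lemma Phi_neg (x : ℝ) : Phi (-x) = 1 - Phi x := by
  rw [Phi_eq_real, Phi_eq_real]
  have h1 : (gaussianReal 0 1).map (fun y => -y) = gaussianReal 0 1 := by
    simp [gaussianReal_map_neg]
  have : NullSingletonClass (gaussianReal 0 1) :=
    nullSingletonClass_gaussianReal one_ne_zero
  have h2 : (gaussianReal 0 1).real (Set.Iic (-x)) = (gaussianReal 0 1).real (Set.Ioi x) := by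
    conv_lhs => rw [← h1]
    rw [map_measureReal_apply measurable_neg measurableSet_Iic]
    have : (fun y : ℝ => -y) ⁻¹' Set.Iic (-x) = Set.Ici x := by ext; simp
    rw [this]
    exact measureReal_congr (Ioi_ae_eq_Ici.symm)
  rw [h2, ← Set.compl_Iic, measureReal_compl measurableSet_Iic]
  simp

/-- Chebyshev's inequality. This crude tail suffices: it is used at x = N^{1/4}, where it equals the
target order 1/√N. -/
lemma Phi_neg_le {x : ℝ} (hx : 0 < x) : Phi (-x) ≤ 1 / x ^ 2 := by
  have hmem : MemLp (id : ℝ → ℝ) 2 (gaussianReal 0 1) := memLp_id_gaussianReal 2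
  have h := meas_ge_le_variance_div_sq hmem hx
  rw [variance_id_gaussianReal] at h
  simp only [id, integral_id_gaussianReal] at h
  rw [Phi_eq_real, Measure.real]
  refine ENNReal.toReal_le_of_le_ofReal (by positivity) (le_trans (measure_mono ?_) (h.trans_eq ?_))
  · intro y hy
    simp only [Set.mem_Iic] at hy
    simp only [sub_zero, Set.mem_ofPred_eq]
    rw [abs_of_neg (by linarith)]
    linarith
  · simp

/-- The derivative of the right-hand side is `Phi w`, so it is increasing. By Chebyshev's inequality
its lower limit at -∞ is not negative. -/
lemma mills (w : ℝ) : 0 ≤ pdf w + w * Phi w := by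
  by_contra hneg
  push Not at hneg
  set c := -(pdf w + w * Phi w) with hc
  have hc0 : 0 < c := by linarith
  have hder : ∀ y, HasDerivAt (fun y => pdf y + y * Phi y) (Phi y) y := by
    intro y
    have := (hasDerivAt_pdf y).add ((hasDerivAt_id y).mul (hasDerivAt_Phi y))
    exact this.congr_deriv (by simp only [id]; ring)
  have hmono : Monotone (fun y => pdf y + y * Phi y) :=
    monotone_of_hasDerivAt_nonneg hder Phi_nonneg
  -- Far enough to the left that -y ≤ w and y Φ(-y) ≤ 1/y ≤ c/2, which contradicts the value -c at
  -- w.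
  set y := max (-w) (2 / c)
  have hy : 0 < y := lt_of_lt_of_le (by positivity) (le_max_right _ _)
  have h1 := hmono (show -y ≤ w by linarith [le_max_left (-w) (2 / c)])
  simp only at h1
  have h2 := Phi_neg_le hy
  have h3 : y * Phi (-y) ≤ 1 / y := by
    calc y * Phi (-y) ≤ y * (1 / y ^ 2) := by gcongr
      _ = 1 / y := by field_simp
  have h4 : 1 / y ≤ c / 2 := by
    rw [div_le_div_iff₀ hy two_pos]
    have : 2 / c ≤ y := le_max_right _ _
    rw [div_le_iff₀ hc0] at this
    linarith
  have := pdf_pos (-y)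
  linarith

lemma abs_mul_Phi_le {w : ℝ} (hw : w ≤ 0) : |w| * Phi w ≤ pdf w := by
  rw [abs_of_nonpos hw]; linarith [mills w]

lemma abs_mul_one_sub_Phi_le {w : ℝ} (hw : 0 ≤ w) : |w| * (1 - Phi w) ≤ pdf w := by
  have := abs_mul_Phi_le (w := -w) (by linarith)
  rwa [abs_neg, Phi_neg, pdf_neg] at this

lemma pdf_le_one (x : ℝ) : pdf x ≤ 1 := by
  rw [pdf_eq]
  have h1 : 1 ≤ Real.sqrt (2 * Real.pi) := by
    rw [Real.one_le_sqrt]; linarith [Real.pi_gt_three]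
  have h2 : Real.exp (-(x ^ 2) / 2) ≤ 1 := Real.exp_le_one_iff.2 (by nlinarith [sq_nonneg x])
  have h3 : (Real.sqrt (2 * Real.pi))⁻¹ ≤ 1 := inv_le_one_of_one_le₀ h1
  calc _ ≤ (1 : ℝ) * 1 := by gcongr
    _ = 1 := one_mul 1

/-- One term of the exponential series: t^k / k! ≤ e^t at t = x²/2. -/
lemma pow_mul_pdf_le (k : ℕ) (x : ℝ) : |x| ^ (2 * k) * pdf x ≤ 2 ^ k * k.factorial := by
  have h0 : (x ^ 2 / 2) ^ k / k.factorial ≤ Real.exp (x ^ 2 / 2) :=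
    Real.pow_div_factorial_le_exp _ (by positivity) k
  have h1 : 1 ≤ Real.sqrt (2 * Real.pi) := by
    rw [Real.one_le_sqrt]; linarith [Real.pi_gt_three]
  have h3 : (Real.sqrt (2 * Real.pi))⁻¹ ≤ 1 := inv_le_one_of_one_le₀ h1
  rw [pdf_eq, neg_div, Real.exp_neg, pow_mul, sq_abs]
  have hk : (0 : ℝ) < k.factorial := by exact_mod_cast Nat.factorial_pos k
  have he := Real.exp_pos (x ^ 2 / 2)
  rw [div_pow, div_div, div_le_iff₀ (by positivity)] at h0
  calc (x ^ 2) ^ k * ((Real.sqrt (2 * Real.pi))⁻¹ * (Real.exp (x ^ 2 / 2))⁻¹)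
      ≤ (x ^ 2) ^ k * (1 * (Real.exp (x ^ 2 / 2))⁻¹) := by gcongr
    _ ≤ (Real.exp (x ^ 2 / 2) * (2 ^ k * k.factorial)) * (1 * (Real.exp (x ^ 2 / 2))⁻¹) := by
        gcongr
    _ = 2 ^ k * k.factorial := by field_simp

lemma abs_Phi_sub_le (x y : ℝ) : |Phi x - Phi y| ≤ |x - y| := by
  have := Convex.norm_image_sub_le_of_norm_hasDerivWithin_le (f := Phi) (f' := pdf) (C := 1)
    (s := Set.univ) (x := y) (y := x) (fun t _ => (hasDerivAt_Phi t).hasDerivWithinAt)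
    (fun t _ => by rw [Real.norm_eq_abs, abs_of_pos (pdf_pos t)]; exact pdf_le_one t)
    convex_univ (Set.mem_univ _) (Set.mem_univ _)
  simpa using this

/-- The left branch of the solution of Stein's equation. -/
def steinL (z w : ℝ) : ℝ := Phi w * (1 - Phi z) / pdf w

/-- The right branch of the solution of Stein's equation. -/
def steinR (z w : ℝ) : ℝ := Phi z * (1 - Phi w) / pdf w

/-- The bounded solution of Stein's equation `f' w - w f w = 1{w ≤ z} - Φ z`. -/
def stein (z w : ℝ) : ℝ := if w ≤ z then steinL z w else steinR z w

lemma hasDerivAt_steinL (z w : ℝ) : HasDerivAt (steinL z) (1 - Phi z + w * steinL z w) w := by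
  have h := ((hasDerivAt_Phi w).mul_const (1 - Phi z)).div (hasDerivAt_pdf w) (pdf_pos w).ne'
  refine h.congr_deriv ?_
  have := (pdf_pos w).ne'
  simp only [steinL]
  field_simp
  ring

lemma hasDerivAt_steinR (z w : ℝ) : HasDerivAt (steinR z) (-Phi z + w * steinR z w) w := by
  have h := (((hasDerivAt_Phi w).const_sub 1).const_mul (Phi z)).div (hasDerivAt_pdf w)
    (pdf_pos w).ne'
  refine h.congr_deriv ?_
  have := (pdf_pos w).ne'
  simp only [steinR]
  field_simp
  ring

lemma stein_of_ge {z w : ℝ} (h : z ≤ w) : stein z w = steinR z w := by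
  rcases h.eq_or_lt with rfl | h
  · simp [stein, steinL, steinR]
  · simp [stein, not_le.2 h]

lemma stein_of_le {z w : ℝ} (h : w ≤ z) : stein z w = steinL z w := by simp [stein, h]

lemma stein_nonneg (z w : ℝ) : 0 ≤ stein z w := by
  have h1 := Phi_nonneg z
  have h2 := Phi_nonneg w
  have h3 := Phi_le_one z
  have h4 := Phi_le_one w
  have h5 := pdf_pos w
  unfold stein steinL steinR
  split_ifs
  · exact div_nonneg (mul_nonneg h2 (by linarith)) h5.le
  · exact div_nonneg (mul_nonneg h1 (by linarith)) h5.le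

lemma stein_le (z w : ℝ) : stein z w * pdf w ≤ Phi w ∧ stein z w * pdf w ≤ 1 - Phi w := by
  have h1 := Phi_nonneg z
  have h2 := Phi_nonneg w
  have h3 := Phi_le_one z
  have h4 := Phi_le_one w
  have h5 := (pdf_pos w).ne'
  rcases le_total w z with h | h
  · have := Phi_mono h
    rw [stein_of_le h, steinL, div_mul_cancel₀ _ h5]
    constructor <;> nlinarith
  · have := Phi_mono h
    rw [stein_of_ge h, steinR, div_mul_cancel₀ _ h5]
    constructor <;> nlinarith

/-- The Mills ratio bound, applied to the left tail for w ≤ 0 and to the right tail for w ≥ 0. -/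
lemma abs_mul_stein_le (z w : ℝ) : |w| * stein z w ≤ 1 := by
  have h5 := pdf_pos w
  obtain ⟨h1, h2⟩ := stein_le z w
  have : |w| * stein z w * pdf w ≤ 1 * pdf w := by
    rw [one_mul, mul_assoc]
    rcases le_total w 0 with h | h
    · exact (mul_le_mul_of_nonneg_left h1 (abs_nonneg w)).trans (abs_mul_Phi_le h)
    · exact (mul_le_mul_of_nonneg_left h2 (abs_nonneg w)).trans (abs_mul_one_sub_Phi_le h)
  exact le_of_mul_le_mul_right this h5

lemma stein_le_six (z w : ℝ) : stein z w ≤ 6 := by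
  rcases le_total 1 |w| with h | h
  · have := abs_mul_stein_le z w
    have := stein_nonneg z w
    nlinarith
  · have h5 := pdf_pos w
    have h1 := (stein_le z w).1.trans (Phi_le_one w)
    -- For |w| ≥ 1 the bound on |w| f(w) is enough; on [-1, 1] the density is bounded below.
    have h2 : (1 : ℝ) / 6 ≤ pdf w := by
      rw [pdf_eq]
      have hpi : Real.sqrt (2 * Real.pi) ≤ 8 / 3 := by
        rw [Real.sqrt_le_left (by norm_num)]
        nlinarith [Real.pi_lt_d2]
      have hw : w ^ 2 ≤ 1 := by rw [← sq_abs]; nlinarith [abs_nonneg w]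
      have he : (1 : ℝ) / 2 ≤ Real.exp (-(w ^ 2) / 2) := by
        have := Real.add_one_le_exp (-(w ^ 2) / 2)
        linarith
      have hs : (3 : ℝ) / 8 ≤ (Real.sqrt (2 * Real.pi))⁻¹ := by
        rw [le_inv_comm₀ (by norm_num) (by positivity)]
        linarith
      nlinarith
    have := stein_nonneg z w
    nlinarith

lemma abs_stein_le (z w : ℝ) : |stein z w| ≤ 6 := by
  rw [abs_of_nonneg (stein_nonneg z w)]; exact stein_le_six z w

lemma abs_deriv_steinL_le {z w : ℝ} (h : w ≤ z) : |1 - Phi z + w * steinL z w| ≤ 2 := by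
  have h1 := Phi_nonneg z
  have h3 := Phi_le_one z
  have h2 := abs_mul_stein_le z w
  have h4 := stein_nonneg z w
  rw [← abs_of_nonneg h4, ← abs_mul, stein_of_le h] at h2
  have := abs_le.1 h2
  rw [abs_le]; constructor <;> linarith

lemma abs_deriv_steinR_le {z w : ℝ} (h : z ≤ w) : |-Phi z + w * steinR z w| ≤ 2 := by
  have h1 := Phi_nonneg z
  have h3 := Phi_le_one z
  have h2 := abs_mul_stein_le z w
  have h4 := stein_nonneg z w
  rw [← abs_of_nonneg h4, ← abs_mul, stein_of_ge h] at h2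
  have := abs_le.1 h2
  rw [abs_le]; constructor <;> linarith

/-- The solution has a kink at z, so the mean value inequality is applied to the smooth branches on
the two half-lines and glued at z, where they agree. -/
lemma stein_lipschitz (z x y : ℝ) : |stein z x - stein z y| ≤ 2 * |x - y| := by
  have hL : ∀ x ≤ z, ∀ y ≤ z, |stein z x - stein z y| ≤ 2 * |x - y| := by
    intro x hx y hy
    rw [stein_of_le hx, stein_of_le hy]
    exact Convex.norm_image_sub_le_of_norm_hasDerivWithin_le (s := Set.Iic z)
      (fun t _ => (hasDerivAt_steinL z t).hasDerivWithinAt)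
      (fun t ht => abs_deriv_steinL_le ht) (convex_Iic z) hy hx
  have hR : ∀ x ≥ z, ∀ y ≥ z, |stein z x - stein z y| ≤ 2 * |x - y| := by
    intro x hx y hy
    rw [stein_of_ge hx, stein_of_ge hy]
    exact Convex.norm_image_sub_le_of_norm_hasDerivWithin_le (s := Set.Ici z)
      (fun t _ => (hasDerivAt_steinR z t).hasDerivWithinAt)
      (fun t ht => abs_deriv_steinR_le ht) (convex_Ici z) hy hx
  have key : ∀ x ≤ z, ∀ y ≥ z, |stein z x - stein z y| ≤ 2 * |x - y| := by
    intro x hx y hy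
    have h1 := hL x hx z le_rfl
    have h2 := hR z le_rfl y hy
    have h3 := abs_sub_le (stein z x) (stein z z) (stein z y)
    have h4 : |x - z| + |z - y| = |x - y| := by
      rw [abs_of_nonpos (by linarith), abs_of_nonpos (by linarith), abs_of_nonpos (by linarith)]
      ring
    linarith
  rcases le_total x z with hx | hx <;> rcases le_total y z with hy | hy
  · exact hL x hx y hy
  · exact key x hx y hy
  · rw [abs_sub_comm, abs_sub_comm x y]; exact key y hy x hx
  · exact hR x hx y hy

lemma abs_mul_stein_sub_le (z x y : ℝ) :
    |x * stein z x - y * stein z y| ≤ |x - y| * (6 + 2 * |y|) := by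
  have h1 := abs_stein_le z x
  have h2 := stein_lipschitz z x y
  calc |x * stein z x - y * stein z y|
      = |(x - y) * stein z x + y * (stein z x - stein z y)| := by ring_nf
    _ ≤ |x - y| * |stein z x| + |y| * |stein z x - stein z y| := by
        rw [← abs_mul, ← abs_mul]; exact abs_add_le _ _
    _ ≤ |x - y| * 6 + |y| * (2 * |x - y|) := by gcongr
    _ = |x - y| * (6 + 2 * |y|) := by ring

/-- Stein's equation for difference quotients instead of derivatives. -/
lemma stein_quotient (z : ℝ) {u v w : ℝ} (huv : u < v) (hw : w ∈ Set.Icc u v) :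
    |(stein z v - stein z u) / (v - u) -
        (w * stein z w + (if w ≤ z then 1 else 0) - Phi z)| ≤
      (v - u) * (6 + 2 * |w|) + if |w - z| ≤ v - u then 4 else 0 := by
  have hpos : 0 ≤ (v - u) * (6 + 2 * |w|) := by
    have := abs_nonneg w
    exact mul_nonneg (by linarith) (by linarith)
  have hdist : ∀ ξ ∈ Set.Ioo u v, |ξ - w| ≤ v - u := by
    intro ξ hξ
    rw [abs_le]; constructor <;> linarith [hξ.1, hξ.2, hw.1, hw.2]
  have hgood : ∀ ξ ∈ Set.Ioo u v, |ξ * stein z ξ - w * stein z w| ≤ (v - u) * (6 + 2 * |w|) := by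
    intro ξ hξ
    refine (abs_mul_stein_sub_le z ξ w).trans ?_
    have := abs_nonneg w
    exact mul_le_mul_of_nonneg_right (hdist ξ hξ) (by linarith)
  have hnn : (0 : ℝ) ≤ if |w - z| ≤ v - u then 4 else 0 := by split_ifs <;> norm_num
  -- If z is not in [u, v), a single smooth branch is involved and the mean value theorem applies.
  rcases le_or_gt v z with hv | hv
  · obtain ⟨ξ, hξ, he⟩ := exists_hasDerivAt_eq_slope (steinL z) _ huv
      (fun t _ => (hasDerivAt_steinL z t).continuousAt.continuousWithinAt)
      (fun t _ => hasDerivAt_steinL z t)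
    rw [stein_of_le hv, stein_of_le (huv.le.trans hv), ← he, if_pos (hw.2.trans hv),
      ← stein_of_le (hξ.2.le.trans hv)]
    calc _ = |ξ * stein z ξ - w * stein z w| := by congr 1; ring
      _ ≤ _ := by linarith [hgood ξ hξ]
  rcases lt_or_ge z u with hu | hu
  · obtain ⟨ξ, hξ, he⟩ := exists_hasDerivAt_eq_slope (steinR z) _ huv
      (fun t _ => (hasDerivAt_steinR z t).continuousAt.continuousWithinAt)
      (fun t _ => hasDerivAt_steinR z t)
    rw [stein_of_ge hv.le, stein_of_ge hu.le, ← he, if_neg (not_le.2 (hu.trans_le hw.1)),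
      ← stein_of_ge (hu.le.trans hξ.1.le)]
    calc _ = |ξ * stein z ξ - w * stein z w| := by congr 1; ring
      _ ≤ _ := by linarith [hgood ξ hξ]
  -- The interval contains the kink, so w is within v - u of z. The crude bounds 2, 1 and 1 on the
  -- three terms add up to 4.
  · have hwz : |w - z| ≤ v - u := by rw [abs_le]; constructor <;> linarith [hw.1, hw.2]
    rw [if_pos hwz]
    have h1 : |(stein z v - stein z u) / (v - u)| ≤ 2 := by
      rw [abs_div, abs_of_pos (show 0 < v - u by linarith), div_le_iff₀ (by linarith)]
      have := stein_lipschitz z v u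
      rwa [abs_of_pos (show 0 < v - u by linarith)] at this
    have h2 : |w * stein z w| ≤ 1 := by
      rw [abs_mul, abs_of_nonneg (stein_nonneg z w)]; exact abs_mul_stein_le z w
    have h3 : |(if w ≤ z then (1 : ℝ) else 0) - Phi z| ≤ 1 := by
      have := Phi_nonneg z
      have := Phi_le_one z
      split_ifs <;> rw [abs_le] <;> constructor <;> linarith
    have h4 := abs_le.1 h1
    have h5 := abs_le.1 h2
    have h6 := abs_le.1 h3
    rw [abs_le]; constructor <;> linarith

end Gauss

/-! ### Berry-Esseen bound for weighted Bernoulli sums -/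

namespace Bern

/-- The Bernoulli law on `Bool` with success probability `p`. -/
def law (p : ℝ) : Measure Bool :=
  ENNReal.ofReal p • Measure.dirac true + ENNReal.ofReal (1 - p) • Measure.dirac false

lemma isProbabilityMeasure_law {p : ℝ} (hp : 0 ≤ p) (hp1 : p ≤ 1) :
    IsProbabilityMeasure (law p) := by
  constructor
  simp only [law, Measure.coe_add, Measure.coe_smul, Pi.add_apply, Pi.smul_apply, measure_univ,
    smul_eq_mul, mul_one]
  rw [← ENNReal.ofReal_add hp (by linarith)]
  simp

lemma integral_law {p : ℝ} (hp : 0 ≤ p) (hp1 : p ≤ 1) (f : Bool → ℝ) :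
    ∫ t, f t ∂(law p) = p * f true + (1 - p) * f false := by
  have := isProbabilityMeasure_law hp hp1
  rw [law, integral_add_measure (Integrable.of_finite.smul_measure ENNReal.ofReal_ne_top)
      (Integrable.of_finite.smul_measure ENNReal.ofReal_ne_top),
    integral_smul_measure, integral_smul_measure, integral_dirac, integral_dirac,
    ENNReal.toReal_ofReal hp, ENNReal.toReal_ofReal (by linarith)]
  simp

/-- Resampling one coordinate preserves a product of probability measures. -/
lemma measurePreserving_update {I : Type*} [Fintype I] [DecidableEq I] {α : Type*}
    [MeasurableSpace α] (μ : Measure α) [IsProbabilityMeasure μ] (i : I) :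
    MeasurePreserving (fun q : (I → α) × α => Function.update q.1 i q.2)
      ((Measure.pi fun _ => μ).prod μ) (Measure.pi fun _ => μ) := by
  have hm : Measurable (fun q : (I → α) × α => Function.update q.1 i q.2) := by
    refine measurable_pi_lambda _ fun j => ?_
    by_cases h : j = i
    · subst h; simpa using measurable_snd
    · simpa [h, Function.comp_def] using
        (measurable_pi_apply (X := fun _ : I => α) j).comp measurable_fst
  refine ⟨hm, (Measure.pi_eq fun s hs => ?_).symm⟩
  rw [Measure.map_apply hm (MeasurableSet.univ_pi hs)]
  have : (fun q : (I → α) × α => Function.update q.1 i q.2) ⁻¹' Set.univ.pi s =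
      (Set.univ.pi (Function.update s i Set.univ)) ×ˢ (s i) := by
    ext q
    simp only [Set.mem_preimage, Set.mem_pi, Set.mem_univ, true_implies, Set.mem_prod]
    constructor
    · intro h
      refine ⟨fun j => ?_, by simpa using h i⟩
      by_cases hj : j = i
      · subst hj; simp
      · simpa [hj] using h j
    · rintro ⟨h1, h2⟩ j
      by_cases hj : j = i
      · subst hj; simpa using h2
      · simpa [hj] using h1 j
  rw [this, Measure.prod_prod, Measure.pi_pi, ← Finset.mul_prod_erase _ _ (Finset.mem_univ i),
    ← Finset.mul_prod_erase _ (fun j => μ (s j)) (Finset.mem_univ i)]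
  simp only [Function.update_self, measure_univ, one_mul]
  rw [mul_comm]
  congr 1
  refine Finset.prod_congr rfl fun j hj => ?_
  rw [Function.update_of_ne (Finset.ne_of_mem_erase hj)]

/-- The law of independent Bernoulli trials. -/
abbrev trials (I : Type*) [Fintype I] (p : ℝ) : Measure (I → Bool) := Measure.pi fun _ => law p

/-- The indicator of success. -/
def ind (b : Bool) : ℝ := if b then 1 else 0

variable {I : Type*} [Fintype I]

lemma isProbabilityMeasure_trials {p : ℝ} (hp : 0 ≤ p) (hp1 : p ≤ 1) :
    IsProbabilityMeasure (trials I p) := by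
  have := isProbabilityMeasure_law hp hp1
  infer_instance

lemma integral_update [DecidableEq I] {p : ℝ} (hp : 0 ≤ p) (hp1 : p ≤ 1) (i : I)
    (F : (I → Bool) → ℝ) :
    ∫ b, F b ∂(trials I p) =
      ∫ b, (p * F (Function.update b i true) + (1 - p) * F (Function.update b i false))
        ∂(trials I p) := by
  have := isProbabilityMeasure_law hp hp1
  have h := measurePreserving_update (I := I) (law p) i
  have e : trials I p = _ := h.map_eq.symm
  conv_lhs => rw [e]
  rw [integral_map h.measurable.aemeasurable (Measurable.of_discrete).aestronglyMeasurable,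
    integral_prod _ (Integrable.of_finite)]
  refine integral_congr_ae (Filter.Eventually.of_forall fun b => ?_)
  exact integral_law hp hp1 _

/-- Discrete integration by parts: averaging over coordinate i alone gives p (1 - p) F(1) - (1 - p)
p F(0). -/
lemma integral_ind_sub_mul [DecidableEq I] {p : ℝ} (hp : 0 ≤ p) (hp1 : p ≤ 1) (i : I)
    (F : (I → Bool) → ℝ) :
    ∫ b, (ind (b i) - p) * F b ∂(trials I p) = p * (1 - p) *
      ∫ b, (F (Function.update b i true) - F (Function.update b i false)) ∂(trials I p) := by
  rw [integral_update hp hp1 i, ← integral_const_mul]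
  refine integral_congr_ae (Filter.Eventually.of_forall fun b => ?_)
  simp [ind]
  ring

/-- The centred weighted sum of the trials. -/
def wsum (p : ℝ) (a : I → ℝ) (b : I → Bool) : ℝ := ∑ i, (ind (b i) - p) * a i

lemma wsum_update [DecidableEq I] (p : ℝ) (a : I → ℝ) (b : I → Bool) (i : I) (t : Bool) :
    wsum p a (Function.update b i t) = wsum p a b + (ind t - ind (b i)) * a i := by
  unfold wsum
  rw [← Finset.add_sum_erase _ _ (Finset.mem_univ i), ← Finset.add_sum_erase _ (fun j => (ind (b j) - p) * a j) (Finset.mem_univ i)]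
  have : ∑ j ∈ Finset.univ.erase i, (ind (Function.update b i t j) - p) * a j =
      ∑ j ∈ Finset.univ.erase i, (ind (b j) - p) * a j :=
    Finset.sum_congr rfl fun j hj => by rw [Function.update_of_ne (Finset.ne_of_mem_erase hj)]
  rw [this, Function.update_self]
  ring

/-- Stein's identity for W = `wsum p a b`: integration by parts in each coordinate, then summation.
The same formula gives the variance, the concentration inequality and the Berry-Esseen bound. -/
lemma integral_wsum_mul [DecidableEq I] {p : ℝ} (hp : 0 ≤ p) (hp1 : p ≤ 1) (a : I → ℝ)
    (f : ℝ → ℝ) :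
    ∫ b, wsum p a b * f (wsum p a b) ∂(trials I p) =
      ∑ i, p * (1 - p) * ∫ b, a i * (f (wsum p a (Function.update b i true)) -
        f (wsum p a (Function.update b i false))) ∂(trials I p) := by
  have := isProbabilityMeasure_trials (I := I) hp hp1
  have h : ∀ b, wsum p a b * f (wsum p a b) =
      ∑ i, (ind (b i) - p) * (a i * f (wsum p a b)) := by
    intro b
    conv_lhs => rw [wsum, Finset.sum_mul]
    exact Finset.sum_congr rfl fun i _ => by simp only [wsum]; ring
  simp_rw [h]
  rw [integral_finsetSum _ fun i _ => Integrable.of_finite]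
  refine Finset.sum_congr rfl fun i _ => ?_
  rw [integral_ind_sub_mul hp hp1 i]
  simp_rw [mul_sub]

lemma integral_wsum_sq {p : ℝ} (hp : 0 ≤ p) (hp1 : p ≤ 1) (a : I → ℝ) :
    ∫ b, wsum p a b ^ 2 ∂(trials I p) = p * (1 - p) * ∑ i, a i ^ 2 := by
  classical
  have := isProbabilityMeasure_trials (I := I) hp hp1
  have h := integral_wsum_mul hp hp1 a id
  simp only [id] at h
  simp_rw [sq, Finset.mul_sum]
  rw [h]
  refine Finset.sum_congr rfl fun i _ => ?_
  have : ∀ b, wsum p a (Function.update b i true) - wsum p a (Function.update b i false) = a i := by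
    intro b
    simp only [wsum_update, show ind true = 1 from rfl, show ind false = 0 from rfl]
    ring
  simp_rw [this]
  simp

lemma integral_abs_wsum_le {p : ℝ} (hp : 0 ≤ p) (hp1 : p ≤ 1) (a : I → ℝ)
    (hv : p * (1 - p) * ∑ i, a i ^ 2 = 1) : ∫ b, |wsum p a b| ∂(trials I p) ≤ 1 := by
  have := isProbabilityMeasure_trials (I := I) hp hp1
  have h : ∫ b, |wsum p a b| ∂(trials I p) ≤ ∫ b, (1 / 2 + wsum p a b ^ 2 / 2) ∂(trials I p) := by
    refine integral_mono Integrable.of_finite Integrable.of_finite fun b => ?_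
    show |wsum p a b| ≤ 1 / 2 + wsum p a b ^ 2 / 2
    nlinarith [sq_nonneg (|wsum p a b| - 1), sq_abs (wsum p a b)]
  rw [integral_add Integrable.of_finite Integrable.of_finite, integral_div _ (fun b => wsum p a b ^ 2),
    integral_wsum_sq hp hp1, hv] at h
  norm_num at h
  exact h

/-- Truncation to `[-r, r]`. -/
def clip (r x : ℝ) : ℝ := max (-r) (min r x)

lemma clip_mono (r : ℝ) : Monotone (clip r) := fun _ _ h =>
  max_le_max le_rfl (min_le_min le_rfl h)

lemma abs_clip_le {r : ℝ} (hr : 0 ≤ r) (x : ℝ) : |clip r x| ≤ r :=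
  abs_le.2 ⟨le_max_left _ _, max_le (by linarith) (min_le_left _ _)⟩

lemma clip_of_abs_le {r x : ℝ} (h : |x| ≤ r) : clip r x = x := by
  rw [clip, min_eq_right (abs_le.1 h).2, max_eq_right (abs_le.1 h).1]

/-- Stein's identity is tested on f(w) = w - z truncated at height r + δ. Since E|W| ≤ 1, E[W f(W)]
≤ r + δ. On the event, f has unit slope over jumps of size at most δ, so E[W f(W)] is also at least
(1 - β/δ) times its probability. -/
lemma concentration {p : ℝ} (hp : 0 ≤ p) (hp1 : p ≤ 1) (a : I → ℝ)
    (hv : p * (1 - p) * ∑ i, a i ^ 2 = 1) (z : ℝ) {r : ℝ} (hr : 0 ≤ r) :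
    (trials I p).real {b | |wsum p a b - z| ≤ r} ≤
      2 * r + 4 * (p * (1 - p) * ∑ i, |a i| ^ 3) := by
  classical
  have := isProbabilityMeasure_trials (I := I) hp hp1
  have hpp : 0 ≤ p * (1 - p) := mul_nonneg hp (by linarith)
  set β := p * (1 - p) * ∑ i, |a i| ^ 3 with hβ
  have hβ0 : 0 < β := by
    refine lt_of_le_of_ne (mul_nonneg hpp (Finset.sum_nonneg fun i _ => by positivity)) ?_
    intro h0
    rcases mul_eq_zero.1 h0.symm with h | h
    · rw [h] at hv; simp at hv
    · rw [Finset.sum_eq_zero_iff_of_nonneg fun i _ => by positivity] at h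
      have : ∑ i, a i ^ 2 = 0 := Finset.sum_eq_zero fun i hi => by
        have := h i hi
        simp only [pow_eq_zero_iff, ne_eq, OfNat.ofNat_ne_zero, not_false_eq_true, abs_eq_zero] at this
        simp [this]
      rw [this] at hv; simp at hv
  -- This choice makes 1 - β/δ equal to 1/2.
  set δ := 2 * β with hδ
  have hδ0 : 0 < δ := by positivity
  set f : ℝ → ℝ := fun w => clip (r + δ) (w - z)
  set S : Set (I → Bool) := {b | |wsum p a b - z| ≤ r}
  have hup : ∫ b, wsum p a b * f (wsum p a b) ∂(trials I p) ≤ r + δ := by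
    have h1 : ∫ b, wsum p a b * f (wsum p a b) ∂(trials I p) ≤
        ∫ b, (r + δ) * |wsum p a b| ∂(trials I p) := by
      refine integral_mono Integrable.of_finite Integrable.of_finite fun b => ?_
      show wsum p a b * f (wsum p a b) ≤ (r + δ) * |wsum p a b|
      refine (le_abs_self _).trans ?_
      rw [abs_mul, mul_comm]
      exact mul_le_mul_of_nonneg_right (abs_clip_le (by linarith) _) (abs_nonneg _)
    rw [integral_const_mul] at h1
    have := integral_abs_wsum_le hp hp1 a hv
    nlinarith
  -- The factor 1 - |a i|/δ is a minorant of the indicator of |a i| ≤ δ. Larger weights contribute a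
  -- nonpositive left side, while monotonicity of f keeps the right side nonnegative.
  have hpt : ∀ i b, a i ^ 2 * (1 - |a i| / δ) * S.indicator 1 b ≤
      a i * (f (wsum p a (Function.update b i true)) -
        f (wsum p a (Function.update b i false))) := by
    intro i b
    have hdiff : wsum p a (Function.update b i true) =
        wsum p a (Function.update b i false) + a i := by
      simp only [wsum_update, show ind true = 1 from rfl, show ind false = 0 from rfl]; ring
    have hnn : 0 ≤ a i * (f (wsum p a (Function.update b i true)) -
        f (wsum p a (Function.update b i false))) := by
      rcases le_total 0 (a i) with h | h
      · exact mul_nonneg h (sub_nonneg.2 (clip_mono _ (by rw [hdiff]; linarith)))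
      · exact mul_nonneg_of_nonpos_of_nonpos h
          (sub_nonpos.2 (clip_mono _ (by rw [hdiff]; linarith)))
    by_cases hb : b ∈ S
    · rw [Set.indicator_of_mem hb, Pi.one_apply, mul_one]
      rcases le_or_gt (|a i|) δ with h | h
      · have hcl : ∀ t, f (wsum p a (Function.update b i t)) =
            wsum p a (Function.update b i t) - z := by
          intro t
          refine clip_of_abs_le ?_
          rw [wsum_update]
          have h1 : |(ind t - ind (b i)) * a i| ≤ δ := by
            refine le_trans ?_ h
            rw [abs_mul]
            refine mul_le_of_le_one_left (abs_nonneg _) ?_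
            cases t <;> cases b i <;> simp [ind]
          have h2 : |wsum p a b - z| ≤ r := hb
          calc _ = |(wsum p a b - z) + (ind t - ind (b i)) * a i| := by ring_nf
            _ ≤ _ := (abs_add_le _ _).trans (add_le_add h2 h1)
        rw [hcl, hcl, hdiff]
        have : 0 ≤ |a i| / δ := by positivity
        nlinarith [sq_nonneg (a i)]
      · refine le_trans ?_ hnn
        refine mul_nonpos_of_nonneg_of_nonpos (sq_nonneg _) ?_
        rw [sub_nonpos, one_le_div hδ0]; exact h.le
    · rw [Set.indicator_of_notMem hb, mul_zero]; exact hnn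
  have hS : ∫ b, S.indicator 1 b ∂(trials I p) = (trials I p).real S :=
    integral_indicator_one (Set.toFinite S).measurableSet
  have hlow : (1 - β / δ) * (trials I p).real S ≤
      ∫ b, wsum p a b * f (wsum p a b) ∂(trials I p) := by
    rw [integral_wsum_mul hp hp1]
    calc (1 - β / δ) * (trials I p).real S
        = ∑ i, p * (1 - p) * (a i ^ 2 * (1 - |a i| / δ) * (trials I p).real S) := by
          have : ∀ i, p * (1 - p) * (a i ^ 2 * (1 - |a i| / δ) * (trials I p).real S) =
              p * (1 - p) * a i ^ 2 * (trials I p).real S -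
              p * (1 - p) * |a i| ^ 3 * ((trials I p).real S / δ) := by
            intro i
            rw [show |a i| ^ 3 = a i ^ 2 * |a i| by rw [← sq_abs]; ring]
            ring
          simp_rw [this]
          rw [Finset.sum_sub_distrib, ← Finset.sum_mul, ← Finset.sum_mul, ← Finset.mul_sum,
            ← Finset.mul_sum, hv, ← hβ]
          ring
      _ ≤ _ := by
          refine Finset.sum_le_sum fun i _ => mul_le_mul_of_nonneg_left ?_ hpp
          rw [← hS, ← integral_const_mul]
          exact integral_mono Integrable.of_finite Integrable.of_finite fun b => hpt i b
  have hhalf : β / δ = 1 / 2 := by rw [hδ]; field_simp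
  rw [hhalf] at hlow
  linarith

lemma stein_quotient_abs (z : ℝ) {u v w : ℝ} (huv : u ≠ v) (hw : w = u ∨ w = v) :
    |(Gauss.stein z v - Gauss.stein z u) / (v - u) -
        (w * Gauss.stein z w + (if w ≤ z then 1 else 0) - Gauss.Phi z)| ≤
      |v - u| * (6 + 2 * |w|) + if |w - z| ≤ |v - u| then 4 else 0 := by
  rcases lt_or_gt_of_ne huv with h | h
  · have := Gauss.stein_quotient z h (w := w)
      (by rcases hw with rfl | rfl <;> constructor <;> linarith)
    rwa [abs_of_pos (show 0 < v - u by linarith)]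
  · have := Gauss.stein_quotient z h (w := w)
      (by rcases hw with rfl | rfl <;> constructor <;> linarith)
    rw [abs_of_neg (show v - u < 0 by linarith), neg_sub]
    rw [← neg_sub (Gauss.stein z u), ← neg_sub u v, neg_div_neg_eq]
    exact this

/-- The Berry-Esseen theorem for weighted sums of independent Bernoulli trials. -/
theorem berryEsseen {p : ℝ} (hp : 0 ≤ p) (hp1 : p ≤ 1) (a : I → ℝ)
    (hv : p * (1 - p) * ∑ i, a i ^ 2 = 1) (z : ℝ) :
    |(trials I p).real {b | wsum p a b ≤ z} - Gauss.Phi z| ≤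
      32 * (p * (1 - p) * ∑ i, |a i| ^ 3) := by
  classical
  have := isProbabilityMeasure_trials (I := I) hp hp1
  have hpp : 0 ≤ p * (1 - p) := mul_nonneg hp (by linarith)
  set β := p * (1 - p) * ∑ i, |a i| ^ 3 with hβ
  set f := Gauss.stein z
  set W := wsum p a
  -- By Stein's equation G plays the role of f'(W).
  set G : (I → Bool) → ℝ := fun b => W b * f (W b) + (if W b ≤ z then 1 else 0) - Gauss.Phi z
    with hG
  have hind : ∫ b, (if W b ≤ z then (1 : ℝ) else 0) ∂(trials I p) =
      (trials I p).real {b | W b ≤ z} := by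
    rw [← integral_indicator_one (Set.toFinite _).measurableSet]
    refine integral_congr_ae (Filter.Eventually.of_forall fun b => ?_)
    simp [Set.indicator_apply]
  have hEG : ∫ b, G b ∂(trials I p) = ∫ b, W b * f (W b) ∂(trials I p) +
      ((trials I p).real {b | W b ≤ z} - Gauss.Phi z) := by
    rw [hG, integral_sub Integrable.of_finite Integrable.of_finite,
      integral_add Integrable.of_finite Integrable.of_finite, hind]
    simp
    ring
  -- Each difference quotient in Stein's identity is replaced by G. The weights p (1 - p) a_i² sum
  -- to 1, so the total is E[W f(W)] - E[G] = Φ(z) - P(W ≤ z), up to the errors bounded here.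
  have hterm : ∀ i, |p * (1 - p) * (∫ b, a i * (f (W (Function.update b i true)) -
        f (W (Function.update b i false))) ∂(trials I p)) -
        p * (1 - p) * a i ^ 2 * ∫ b, G b ∂(trials I p)| ≤
      p * (1 - p) * a i ^ 2 * (16 * |a i| + 16 * β) := by
    intro i
    rw [mul_assoc (p * (1 - p)), ← mul_sub, abs_mul, abs_of_nonneg hpp, mul_assoc (p * (1 - p))]
    refine mul_le_mul_of_nonneg_left ?_ hpp
    rw [← integral_const_mul, ← integral_sub Integrable.of_finite Integrable.of_finite]
    have hpt : ∀ b, |a i * (f (W (Function.update b i true)) - f (W (Function.update b i false))) -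
        a i ^ 2 * G b| ≤
        a i ^ 2 * (|a i| * (6 + 2 * |W b|) + if |W b - z| ≤ |a i| then 4 else 0) := by
      intro b
      have hdiff : W (Function.update b i true) - W (Function.update b i false) = a i := by
        simp only [W, wsum_update, show ind true = 1 from rfl, show ind false = 0 from rfl]; ring
      by_cases ha : a i = 0
      · simp [ha]
      · have h := stein_quotient_abs z (u := W (Function.update b i false))
          (v := W (Function.update b i true)) (w := W b)
          (fun h => ha (by rw [← hdiff, h, sub_self])) (by
            rcases hb : b i with _ | _
            · left; rw [← hb, Function.update_eq_self]
            · right; rw [← hb, Function.update_eq_self])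
        rw [hdiff] at h
        calc _ = a i ^ 2 * |(f (W (Function.update b i true)) -
                f (W (Function.update b i false))) / a i - G b| := by
              rw [← abs_of_nonneg (sq_nonneg (a i)), ← abs_mul, abs_of_nonneg (sq_nonneg (a i))]
              congr 1
              field_simp
          _ ≤ _ := mul_le_mul_of_nonneg_left h (sq_nonneg _)
    refine (abs_integral_le_integral_abs).trans ((integral_mono Integrable.of_finite
      Integrable.of_finite hpt).trans ?_)
    rw [integral_const_mul]
    refine mul_le_mul_of_nonneg_left ?_ (sq_nonneg _)
    rw [integral_add Integrable.of_finite Integrable.of_finite, integral_const_mul,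
      integral_add Integrable.of_finite Integrable.of_finite, integral_const_mul]
    have h1 := integral_abs_wsum_le hp hp1 a hv
    -- The kink costs 4 P(|W - z| ≤ |a i|) ≤ 8 |a i| + 16 β. With the 8 |a i| from 6 + 2 E|W| ≤ 8
    -- this gives 16 |a i| + 16 β, and summation gives 32 β.
    have h2 := concentration hp hp1 a hv z (abs_nonneg (a i))
    have h3 : ∫ b, (if |W b - z| ≤ |a i| then (4 : ℝ) else 0) ∂(trials I p) =
        4 * (trials I p).real {b | |W b - z| ≤ |a i|} := by
      rw [← integral_indicator_one (Set.toFinite _).measurableSet, ← integral_const_mul]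
      refine integral_congr_ae (Filter.Eventually.of_forall fun b => ?_)
      simp [Set.indicator_apply]
    rw [h3]
    simp only [integral_const, probReal_univ, smul_eq_mul, one_mul]
    have := abs_nonneg (a i)
    have h4 : |a i| * (6 + 2 * ∫ b, |W b| ∂(trials I p)) ≤ |a i| * 8 :=
      mul_le_mul_of_nonneg_left (by linarith) this
    linarith
  have hsum := (Finset.abs_sum_le_sum_abs (fun i => p * (1 - p) * (∫ b, a i *
        (f (W (Function.update b i true)) - f (W (Function.update b i false))) ∂(trials I p)) -
        p * (1 - p) * a i ^ 2 * ∫ b, G b ∂(trials I p)) Finset.univ).trans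
      (Finset.sum_le_sum fun i _ => hterm i)
  rw [Finset.sum_sub_distrib, ← integral_wsum_mul hp hp1, ← Finset.sum_mul, ← Finset.mul_sum, hv,
    one_mul, hEG] at hsum
  have hr : ∑ i, p * (1 - p) * a i ^ 2 * (16 * |a i| + 16 * β) = 32 * β := by
    have : ∀ i, p * (1 - p) * a i ^ 2 * (16 * |a i| + 16 * β) =
        16 * (p * (1 - p) * |a i| ^ 3) + 16 * β * (p * (1 - p) * a i ^ 2) := by
      intro i
      rw [show |a i| ^ 3 = a i ^ 2 * |a i| by rw [← sq_abs]; ring]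
      ring
    simp_rw [this]
    rw [Finset.sum_add_distrib, ← Finset.mul_sum, ← Finset.mul_sum, ← Finset.mul_sum,
      ← Finset.mul_sum, hv, ← hβ]
    ring
  rw [hr, ← abs_neg] at hsum
  rwa [sub_add_cancel_left, neg_neg] at hsum

end Bern

lemma Real.rpow_three_halves {x : ℝ} (hx : 0 ≤ x) : x ^ (3 / 2 : ℝ) = x * Real.sqrt x := by
  rw [Real.sqrt_eq_rpow, show (3 / 2 : ℝ) = 1 + 1 / 2 by norm_num,
    Real.rpow_add' hx (by norm_num), Real.rpow_one]

/-! ### Expansion of the normal distribution function under rescaling -/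

namespace Gauss

lemma abs_mul_pdf_le (x : ℝ) : |x| * pdf x ≤ 3 := by
  have h0 := pow_mul_pdf_le 1 x
  have h1 := pdf_le_one x
  have h2 := pdf_pos x
  norm_num at h0
  nlinarith [sq_nonneg (|x| - 1), sq_abs x, abs_nonneg x]

lemma abs_cube_mul_pdf_le (x : ℝ) : |x| ^ 3 * pdf x ≤ 10 := by
  have h0 := pow_mul_pdf_le 1 x
  have h1 := pow_mul_pdf_le 2 x
  have h2 := pdf_pos x
  norm_num [Nat.factorial] at h0 h1
  have h3 : |x| ^ 3 ≤ x ^ 2 + |x| ^ 4 := by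
    rw [← sq_abs]
    have := abs_nonneg x
    nlinarith [mul_nonneg (sq_nonneg |x|) (sq_nonneg (|x| - 1)), sq_nonneg |x|]
  nlinarith

/-- Second order expansion of `θ ↦ Φ (z θ)` at `1`, uniformly in `z`. -/
lemma abs_Phi_mul_sub_le (z : ℝ) {θ : ℝ} (hθ : 1 / 2 ≤ θ) :
    |Phi (z * θ) - Phi z - (θ - 1) * (z * pdf z)| ≤ 40 * (θ - 1) ^ 2 := by
  have hd1 : ∀ t, HasDerivAt (fun t => Phi (z * t)) (z * pdf (z * t)) t := by
    intro t
    have := (hasDerivAt_Phi (z * t)).comp t ((hasDerivAt_id t).const_mul z)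
    exact this.congr_deriv (by simp [mul_comm])
  have hd2 : ∀ t, HasDerivAt (fun t => z * pdf (z * t)) (z * (-(z * t * pdf (z * t)) * z)) t := by
    intro t
    have := ((hasDerivAt_pdf (z * t)).comp t ((hasDerivAt_id t).const_mul z)).const_mul z
    exact this.congr_deriv (by simp)
  have hsub : ∀ t ∈ Set.uIcc 1 θ, 1 / 2 ≤ t := fun t ht => by
    have := ht.1
    rcases le_total 1 θ with h | h
    · rw [inf_eq_left.2 h] at this; linarith
    · rw [inf_eq_right.2 h] at this; linarith
  have hb : ∀ t ∈ Set.uIcc 1 θ, ‖z * (-(z * t * pdf (z * t)) * z)‖ ≤ 40 := by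
    intro t ht
    have ht2 := hsub t ht
    have h := abs_cube_mul_pdf_le (z * t)
    rw [abs_mul, abs_of_nonneg (show 0 ≤ t by linarith)] at h
    rw [Real.norm_eq_abs, show z * (-(z * t * pdf (z * t)) * z) = -(z ^ 3 * (t * pdf (z * t))) by ring,
      abs_neg, abs_mul, abs_pow, abs_of_nonneg (mul_nonneg (by linarith) (pdf_pos _).le)]
    -- Dividing the bound on |zt|³ φ(zt) by t² ≥ 1/4 makes the second derivative at most 40,
    -- uniformly in z.
    have h1 : |z| ^ 3 * (t * pdf (z * t)) * t ^ 2 ≤ 10 := by linarith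
    have h2 : 0 ≤ |z| ^ 3 * (t * pdf (z * t)) :=
      mul_nonneg (by positivity) (mul_nonneg (by linarith) (pdf_pos _).le)
    nlinarith [mul_nonneg h2 (show 0 ≤ t ^ 2 - 1 / 4 by nlinarith)]
  have hk : ∀ t ∈ Set.uIcc 1 θ, ‖z * pdf (z * t) - z * pdf z‖ ≤ 40 * |θ - 1| := by
    intro t ht
    have := Convex.norm_image_sub_le_of_norm_hasDerivWithin_le
      (fun t _ => (hd2 t).hasDerivWithinAt) hb (convex_uIcc 1 θ) Set.left_mem_uIcc ht
    simp only [mul_one] at this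
    refine this.trans ?_
    have := Set.abs_sub_left_of_mem_uIcc ht
    rw [Real.norm_eq_abs]
    linarith
  have := Convex.norm_image_sub_le_of_norm_hasDerivWithin_le
      (f := fun t => Phi (z * t) - t * (z * pdf z))
      (fun t _ => ((hd1 t).sub ((hasDerivAt_id t).mul_const (z * pdf z))).hasDerivWithinAt)
      (fun t ht => by simpa using hk t ht) (convex_uIcc 1 θ) Set.left_mem_uIcc Set.right_mem_uIcc
  simp only [mul_one, one_mul, Real.norm_eq_abs] at this
  rw [mul_assoc, ← sq, sq_abs] at this
  convert this using 2
  ring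

/-- The expansion in θ at θ = v^{-1/2}, combined with θ - 1 = -(v - 1)/2 + O((v - 1)²). The constant
is 40 + 2·3, where 3 bounds |z φ(z)|. -/
lemma abs_Phi_div_sqrt_sub_le (z : ℝ) {v : ℝ} (hv : |v - 1| ≤ 1 / 8) :
    |Phi (z / Real.sqrt v) - Phi z + (v - 1) / 2 * (z * pdf z)| ≤ 46 * (v - 1) ^ 2 := by
  obtain ⟨hv1, hv2⟩ := abs_le.1 hv
  have hv0 : 0 < v := by linarith
  set s := Real.sqrt v with hs
  have hs2 : s ^ 2 = v := Real.sq_sqrt hv0.le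
  have hs0 : 0 < s := Real.sqrt_pos.2 hv0
  have hs1 : 9 / 10 ≤ s := by nlinarith
  have hs3 : s ≤ 11 / 10 := by nlinarith
  have h1 := abs_Phi_mul_sub_le z (θ := s⁻¹) (by
    rw [le_inv_comm₀ (by norm_num) hs0]; linarith)
  rw [← div_eq_mul_inv] at h1
  have hv1 : v - 1 = (s - 1) * (s + 1) := by rw [← hs2]; ring
  have hss : (s - 1) ^ 2 * 3 ≤ (v - 1) ^ 2 := by
    rw [hv1, mul_pow]
    exact mul_le_mul_of_nonneg_left (by nlinarith) (sq_nonneg _)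
  have h2 : (s⁻¹ - 1) ^ 2 ≤ (v - 1) ^ 2 := by
    have : (s⁻¹ - 1) ^ 2 = (s - 1) ^ 2 / s ^ 2 := by field_simp; ring
    rw [this, div_le_iff₀ (by positivity)]
    nlinarith [sq_nonneg (s - 1), sq_nonneg (v - 1)]
  have h3 : |s⁻¹ - 1 + (v - 1) / 2| ≤ 2 * (v - 1) ^ 2 := by
    have : s⁻¹ - 1 + (v - 1) / 2 = (s - 1) ^ 2 * ((s + 2) / (2 * s)) := by
      rw [hv1]; field_simp; ring
    rw [this, abs_of_nonneg (by positivity)]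
    have : (s + 2) / (2 * s) ≤ 2 := by
      rw [div_le_iff₀ (by positivity)]; linarith
    nlinarith [sq_nonneg (s - 1)]
  have h4 : |z * pdf z| ≤ 3 := by
    rw [abs_mul, abs_of_pos (pdf_pos z)]; exact abs_mul_pdf_le z
  calc _ = |(Phi (z / s) - Phi z - (s⁻¹ - 1) * (z * pdf z)) +
        (s⁻¹ - 1 + (v - 1) / 2) * (z * pdf z)| := by ring_nf
    _ ≤ 40 * (s⁻¹ - 1) ^ 2 + |s⁻¹ - 1 + (v - 1) / 2| * |z * pdf z| := by
        rw [← abs_mul]; exact (abs_add_le _ _).trans (add_le_add h1 le_rfl)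
    _ ≤ 40 * (v - 1) ^ 2 + 2 * (v - 1) ^ 2 * 3 := by gcongr
    _ = _ := by ring

end Gauss

/-! ### Normal approximation conditionally on the data -/

namespace Bern

variable {I : Type*} [Fintype I]

/-- The Berry-Esseen bound for the weights (g_i - y) / (√N s), which have unit variance. Their third
moment is controlled through |g - y|³ ≤ 4 (|g|³ + 1), pT = N and 4 / s³ ≤ 6, and 192 = 32·6. -/
lemma abs_prob_sub_Phi_div_le {N T p y s A1 A3 : ℝ} (hN : 0 < N) (hT : 0 < T)
    (hTc : (Fintype.card I : ℝ) = T) (hpT : p * T = N) (hp0 : 0 ≤ p) (hp1 : p ≤ 1) (g : I → ℝ)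
    (hA1 : ∑ i, g i = T * A1) (hA3 : ∑ i, |g i| ^ 3 = T * A3) (hy1 : |y| ≤ 1) (hs1 : 9 / 10 ≤ s)
    (hs2 : p * (1 - p) * ∑ i, (g i - y) ^ 2 = N * s ^ 2) :
    |(trials I p).real {b | ∑ i, ind (b i) * (Real.sqrt N * g i - Real.sqrt N * y) ≤ 0} -
      Gauss.Phi ((Real.sqrt N * y - Real.sqrt N * A1) / s)| ≤
      192 * ((1 + A3) / Real.sqrt N) := by
  obtain ⟨q, hq⟩ : ∃ q, q = Real.sqrt N := ⟨_, rfl⟩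
  have hs0 : 0 < q := hq ▸ Real.sqrt_pos.2 hN
  have hsN : q ^ 2 = N := hq ▸ Real.sq_sqrt hN.le
  rw [← hq]
  have hsp : 0 < s := by linarith
  obtain ⟨a, ha⟩ : ∃ a : I → ℝ, a = fun i => (g i - y) / (q * s) := ⟨_, rfl⟩
  have hva : p * (1 - p) * ∑ i, a i ^ 2 = 1 := by
    simp_rw [ha, div_pow]
    rw [← Finset.sum_div, mul_pow, hsN, ← mul_div_assoc, hs2, div_self (by positivity)]
  have hβ : p * (1 - p) * ∑ i, |a i| ^ 3 ≤ 6 * ((1 + A3) / q) := by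
    have h1 : ∑ i, |g i - y| ^ 3 ≤ 4 * (T * (1 + A3)) := by
      have h2 : ∀ i, |g i - y| ^ 3 ≤ 4 * (|g i| ^ 3 + 1) := by
        intro i
        have h3 : |g i - y| ≤ |g i| + 1 := (abs_sub _ _).trans (by linarith)
        have h4 : |g i - y| ^ 3 ≤ (|g i| + 1) ^ 3 := by gcongr
        nlinarith [mul_nonneg (add_nonneg (abs_nonneg (g i)) zero_le_one)
          (sq_nonneg (|g i| - 1))]
      refine (Finset.sum_le_sum fun i _ => h2 i).trans_eq ?_
      rw [← Finset.mul_sum, Finset.sum_add_distrib, hA3]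
      simp only [Finset.sum_const, Finset.card_univ, nsmul_eq_mul, mul_one]
      rw [hTc]
      ring
    have h5 : ∑ i, |a i| ^ 3 = (∑ i, |g i - y| ^ 3) / (q * s) ^ 3 := by
      rw [Finset.sum_div]
      refine Finset.sum_congr rfl fun i _ => ?_
      rw [ha, abs_div, div_pow, abs_of_pos (show 0 < q * s by positivity)]
    have h6 : (9 / 10 : ℝ) ^ 3 ≤ s ^ 3 := by gcongr
    have h7 : 0 ≤ ∑ i, |a i| ^ 3 := Finset.sum_nonneg fun i _ => by positivity
    have hA30 : 0 ≤ A3 := by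
      refine nonneg_of_mul_nonneg_right ?_ hT
      rw [← hA3]
      exact Finset.sum_nonneg fun i _ => by positivity
    calc p * (1 - p) * ∑ i, |a i| ^ 3 ≤ p * ∑ i, |a i| ^ 3 := by
          refine mul_le_mul_of_nonneg_right ?_ h7
          nlinarith
      _ ≤ p * (4 * (T * (1 + A3)) / (q * s) ^ 3) := by rw [h5]; gcongr
      _ = 4 * (p * T) * (1 + A3) / (q * s) ^ 3 := by ring
      _ = 4 / s ^ 3 * ((1 + A3) / q) := by
          rw [hpT, ← hsN]
          field_simp
      _ ≤ 6 * ((1 + A3) / q) := by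
          gcongr
          rw [div_le_iff₀ (by positivity)]
          norm_num at h6
          linarith
  have hset : {b : I → Bool | ∑ i, ind (b i) * (q * g i - q * y) ≤ 0} =
      {b | wsum p a b ≤ (q * y - q * A1) / s} := by
    ext b
    have h1 : ∑ i, ind (b i) * (q * g i - q * y) = q * ∑ i, ind (b i) * (g i - y) := by
      rw [Finset.mul_sum]
      exact Finset.sum_congr rfl fun i _ => by ring
    have h2 : wsum p a b = (∑ i, ind (b i) * (g i - y) - N * (A1 - y)) / (q * s) := by
      have h3 : p * ∑ i, (g i - y) = N * (A1 - y) := by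
        rw [Finset.sum_sub_distrib]
        simp only [Finset.sum_const, Finset.card_univ, nsmul_eq_mul]
        rw [hTc, hA1]
        linear_combination (A1 - y) * hpT
      rw [← h3, Finset.mul_sum, ← Finset.sum_sub_distrib, Finset.sum_div, wsum]
      refine Finset.sum_congr rfl fun i _ => ?_
      rw [ha]; ring
    have h4 : (q * y - q * A1) / s = -(N * (A1 - y)) / (q * s) := by
      rw [← hsN]; field_simp; ring
    rw [Set.mem_ofPred_eq, Set.mem_ofPred_eq, h1, h2, h4,
      div_le_div_iff_of_pos_right (by positivity), ← sub_nonpos (a := _ - _)]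
    constructor
    · intro h
      have := nonpos_of_mul_nonpos_right h hs0
      linarith
    · intro h
      exact mul_nonpos_of_nonneg_of_nonpos hs0.le (by linarith)
  have := berryEsseen hp0 hp1 a hva ((q * y - q * A1) / s)
  rw [hset]
  linarith

set_option maxHeartbeats 800000 in
/-- Normal approximation for the studentized sum of the trials, given the weights. -/
theorem abs_prob_sub_Phi_le {N : ℝ} (hN : 1 ≤ N) (hT : 0 < (Fintype.card I : ℝ))
    (hp1 : N / Fintype.card I ≤ 1) (g : I → ℝ) {L R : ℝ}
    (hLR : (∑ i, g i ^ 2) / Fintype.card I = 1 + L + R) {z : ℝ} (hz : z ^ 2 ≤ Real.sqrt N) :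
    |(trials I (N / Fintype.card I)).real {b | ∑ i, ind (b i) * (Real.sqrt N * g i - z) ≤ 0} -
        Gauss.Phi z + L / 2 * (z * Gauss.pdf z)| ≤
      1000 * ((1 + (∑ i, |g i| ^ 3) / Fintype.card I) / Real.sqrt N +
        Real.sqrt N * |(∑ i, g i) / Fintype.card I| + |L| ^ (3 / 2 : ℝ) + |R| +
        N / Fintype.card I) := by
  obtain ⟨T, hTdef⟩ : ∃ T : ℝ, T = ((Fintype.card I : ℕ) : ℝ) := ⟨_, rfl⟩
  rw [← hTdef] at hT hp1 hLR ⊢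
  obtain ⟨p, hp⟩ : ∃ p, p = N / T := ⟨_, rfl⟩
  obtain ⟨A1, hA1⟩ : ∃ A1, A1 = (∑ i, g i) / T := ⟨_, rfl⟩
  obtain ⟨A3, hA3⟩ : ∃ A3, A3 = (∑ i, |g i| ^ 3) / T := ⟨_, rfl⟩
  rw [← hp] at hp1 ⊢
  rw [← hA1, ← hA3]
  have hp0 : 0 ≤ p := by rw [hp]; positivity
  have hprob := isProbabilityMeasure_trials (I := I) hp0 hp1
  have hs0 : 0 < Real.sqrt N := Real.sqrt_pos.2 (by linarith)
  have hsN : Real.sqrt N ^ 2 = N := Real.sq_sqrt (by linarith)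
  have hA30 : 0 ≤ A3 := hA3 ▸ div_nonneg (Finset.sum_nonneg fun i _ => by positivity) hT.le
  have hL0 : 0 ≤ |L| ^ (3 / 2 : ℝ) := by positivity
  have hu0 : 0 ≤ Real.sqrt N * |A1| := by positivity
  have hR0 := abs_nonneg R
  have hq0 : 0 ≤ (1 + A3) / Real.sqrt N := by positivity
  obtain ⟨F, hF0⟩ : ∃ F, F = (trials I p).real
    {b | ∑ i, ind (b i) * (Real.sqrt N * g i - z) ≤ 0} := ⟨_, rfl⟩
  rw [← hF0]
  have hzp : |z * Gauss.pdf z| ≤ 3 := by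
    rw [abs_mul, abs_of_pos (Gauss.pdf_pos z)]; exact Gauss.abs_mul_pdf_le z
  obtain ⟨B, hB⟩ : ∃ B, B = (1 + A3) / Real.sqrt N + Real.sqrt N * |A1| +
    |L| ^ (3 / 2 : ℝ) + |R| + p := ⟨_, rfl⟩
  rw [← hB]
  -- If the error B is not small the claim holds trivially, since the left side is at most 1 +
  -- 3|L|/2. Otherwise √N is large and L, R, p and √N A₁ are small, so v lies near 1 and the
  -- expansion applies.
  rcases le_or_gt (1 / 64) B with hB1 | hB1
  · have h1 : |F - Gauss.Phi z| ≤ 1 := by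
      have := Gauss.Phi_nonneg z
      have := Gauss.Phi_le_one z
      have : 0 ≤ F := hF0 ▸ measureReal_nonneg
      have : F ≤ 1 := hF0 ▸ measureReal_le_one
      rw [abs_le]; constructor <;> linarith
    have h2 : |L| ≤ 1 + |L| ^ (3 / 2 : ℝ) := by
      rcases le_total |L| 1 with h | h
      · linarith
      · have : |L| ≤ |L| ^ (3 / 2 : ℝ) := by
          conv_lhs => rw [← Real.rpow_one |L|]
          exact Real.rpow_le_rpow_of_exponent_le h (by norm_num)
        linarith
    have h3 : |L / 2 * (z * Gauss.pdf z)| ≤ |L| / 2 * 3 := by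
      rw [abs_mul, abs_div, abs_two]; gcongr
    have := abs_add_le (F - Gauss.Phi z) (L / 2 * (z * Gauss.pdf z))
    linarith
  have hsN1 : 64 ≤ Real.sqrt N := by
    have h : (1 + A3) / Real.sqrt N < 1 / 64 := by linarith
    rw [div_lt_div_iff₀ hs0 (by norm_num)] at h
    linarith
  have hLs : |L| ≤ 1 / 16 := by
    by_contra hcon
    push Not at hcon
    have h4 : 1 / 4 ≤ Real.sqrt |L| := Real.le_sqrt_of_sq_le (by norm_num; linarith)
    have h5 : |L| ^ (3 / 2 : ℝ) < 1 / 64 := by linarith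
    rw [Real.rpow_three_halves (abs_nonneg L)] at h5
    have : 1 / 16 * (1 / 4) ≤ |L| * Real.sqrt |L| :=
      mul_le_mul hcon.le h4 (by norm_num) (abs_nonneg L)
    linarith
  -- Because |L| is small, the quadratic Taylor error is dominated by |L|^{3/2}, so a moment of
  -- order 3/2 of L will be enough.
  have hL2 : L ^ 2 ≤ |L| ^ (3 / 2 : ℝ) := by
    rw [Real.rpow_three_halves (abs_nonneg L), ← sq_abs, sq]
    refine mul_le_mul_of_nonneg_left (Real.le_sqrt_of_sq_le ?_) (abs_nonneg L)
    exact pow_le_of_le_one (abs_nonneg L) (by linarith) two_ne_zero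
  obtain ⟨y, hy⟩ : ∃ y, y = z / Real.sqrt N := ⟨_, rfl⟩
  have hzy : z = y * Real.sqrt N := by rw [hy]; field_simp
  -- The restriction on z enters here: y² = z²/N ≤ 1/√N makes the y² in the conditional variance
  -- negligible.
  have hy2 : y ^ 2 * Real.sqrt N ≤ 1 := by
    rw [hzy] at hz
    have : y ^ 2 * Real.sqrt N * Real.sqrt N ≤ 1 * Real.sqrt N := by linarith
    exact le_of_mul_le_mul_right this hs0
  have hy1 : |y| ≤ 1 := by
    rw [← sq_le_one_iff_abs_le_one]
    have := mul_le_mul_of_nonneg_left hsN1 (sq_nonneg y)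
    linarith
  have hy3 : y ^ 2 ≤ 1 / Real.sqrt N := by rw [le_div_iff₀ hs0]; exact hy2
  have hy4 : 1 / Real.sqrt N ≤ (1 + A3) / Real.sqrt N := by gcongr; linarith
  obtain ⟨v', hv'⟩ : ∃ v', v' = (∑ i, (g i - y) ^ 2) / T := ⟨_, rfl⟩
  have hv'eq : v' = 1 + L + R - 2 * y * A1 + y ^ 2 := by
    have : ∑ i, (g i - y) ^ 2 = ∑ i, g i ^ 2 - 2 * y * ∑ i, g i + T * y ^ 2 := by
      have h : ∀ i, (g i - y) ^ 2 = g i ^ 2 - 2 * y * g i + y ^ 2 := fun i => by ring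
      simp_rw [h]
      rw [Finset.sum_add_distrib, Finset.sum_sub_distrib, ← Finset.mul_sum]
      simp [hTdef]
    rw [hv', this, ← hLR, hA1]
    field_simp
  have he1 : |2 * y * A1| ≤ 2 * (Real.sqrt N * |A1|) := by
    rw [abs_mul, abs_mul, abs_two]
    have h1 : |y| * |A1| ≤ Real.sqrt N * |A1| :=
      mul_le_mul_of_nonneg_right (by linarith) (abs_nonneg A1)
    linarith
  obtain ⟨v, hv⟩ : ∃ v, v = (1 - p) * v' := ⟨_, rfl⟩
  have hv'2 : v' ≤ 2 := by
    have := abs_le.1 he1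
    have := abs_le.1 hLs
    have := le_abs_self R
    rw [hv'eq]; linarith
  have hv'0 : 0 ≤ v' := hv' ▸ div_nonneg (Finset.sum_nonneg fun i _ => sq_nonneg _) hT.le
  obtain ⟨r, hr⟩ : ∃ r, r = |R| + 2 * (Real.sqrt N * |A1|) + (1 + A3) / Real.sqrt N + 2 * p := ⟨_, rfl⟩
  have hvr : |v - 1 - L| ≤ r := by
    have h1 : v - 1 - L = R + -(2 * y * A1) + y ^ 2 + -(p * v') := by
      rw [hv, one_sub_mul]; linear_combination hv'eq
    have h2 : |p * v'| ≤ 2 * p := by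
      rw [abs_of_nonneg (by positivity), mul_comm 2]
      exact mul_le_mul_of_nonneg_left hv'2 hp0
    rw [h1]
    rw [hr]
    refine (abs_add_le _ _).trans (add_le_add ((abs_add_le _ _).trans (add_le_add
      ((abs_add_le _ _).trans (add_le_add le_rfl ?_)) ?_)) ?_)
    · rwa [abs_neg]
    · rw [abs_of_nonneg (sq_nonneg y)]; linarith
    · rwa [abs_neg]
  have hrB : r ≤ 2 * B := by linarith
  have hr0 : 0 ≤ r := (abs_nonneg _).trans hvr
  have hv1 : |v - 1| ≤ 1 / 8 := by
    have : |v - 1| ≤ |v - 1 - L| + |L| := by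
      have := abs_add_le (v - 1 - L) L
      rwa [sub_add_cancel] at this
    linarith
  have hv0 : 7 / 8 ≤ v := by have := (abs_le.1 hv1).1; linarith
  obtain ⟨s, hs⟩ : ∃ s, s = Real.sqrt v := ⟨_, rfl⟩
  have hs2 : s ^ 2 = v := hs ▸ Real.sq_sqrt (by linarith)
  have hs1 : 9 / 10 ≤ s := hs ▸ Real.le_sqrt_of_sq_le (by norm_num; linarith)
  have hpT : p * T = N := by rw [hp]; field_simp
  have hF : |F - Gauss.Phi ((z - Real.sqrt N * A1) / s)| ≤ 192 * ((1 + A3) / Real.sqrt N) := by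
    have := abs_prob_sub_Phi_div_le (y := y) (s := s) (A1 := A1) (A3 := A3)
      (by linarith) hT hTdef.symm hpT hp0 hp1 g
      (by rw [hA1]; field_simp) (by rw [hA3]; field_simp) hy1 hs1
      (by
        have h1 : ∑ i, (g i - y) ^ 2 = T * v' := by rw [hv']; field_simp
        rw [h1, hs2, hv]
        linear_combination (1 - p) * v' * hpT)
    rw [mul_comm _ y, ← hzy] at this
    rw [hF0]
    exact this
  have hF2 : |Gauss.Phi ((z - Real.sqrt N * A1) / s) - Gauss.Phi (z / s)| ≤
      2 * (Real.sqrt N * |A1|) := by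
    refine (Gauss.abs_Phi_sub_le _ _).trans ?_
    rw [← sub_div, sub_sub_cancel_left, abs_div, abs_neg, abs_mul, abs_of_pos hs0,
      abs_of_pos (show 0 < s by linarith), div_le_iff₀ (by linarith)]
    have := mul_le_mul_of_nonneg_left hs1 hu0
    linarith
  have hF3 := Gauss.abs_Phi_div_sqrt_sub_le z hv1
  rw [← hs] at hF3
  have hv2 : (v - 1) ^ 2 ≤ 2 * |L| ^ (3 / 2 : ℝ) + 2 * r := by
    have h1 : (v - 1) ^ 2 ≤ 2 * L ^ 2 + 2 * (v - 1 - L) ^ 2 := by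
      have := sq_nonneg (v - 1 - 2 * L)
      linarith
    have h2 : (v - 1 - L) ^ 2 ≤ r := by
      rw [← sq_abs]
      exact (pow_le_of_le_one (abs_nonneg _) (by linarith) two_ne_zero).trans hvr
    linarith
  have hF4 : |(v - 1 - L) / 2 * (z * Gauss.pdf z)| ≤ 3 / 2 * r := by
    rw [abs_mul, abs_div, abs_two]
    calc |v - 1 - L| / 2 * |z * Gauss.pdf z| ≤ r / 2 * 3 := by gcongr
      _ = 3 / 2 * r := by ring
  -- The four pieces are the Berry-Esseen error, the shift by the conditional mean, the rescaling by
  -- s, and the replacement of v - 1 by L in the linear term.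
  have htot : F - Gauss.Phi z + L / 2 * (z * Gauss.pdf z) =
      (F - Gauss.Phi ((z - Real.sqrt N * A1) / s)) +
      (Gauss.Phi ((z - Real.sqrt N * A1) / s) - Gauss.Phi (z / s)) +
      (Gauss.Phi (z / s) - Gauss.Phi z + (v - 1) / 2 * (z * Gauss.pdf z)) +
      -((v - 1 - L) / 2 * (z * Gauss.pdf z)) := by ring
  rw [htot]
  refine ((abs_add_le _ _).trans (add_le_add ((abs_add_le _ _).trans (add_le_add
      ((abs_add_le _ _).trans (add_le_add hF hF2)) hF3)) ((abs_neg _).trans_le hF4))).trans ?_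
  linarith

end Bern

/-! ### Covariances of a symmetric kernel at overlapping arguments -/

namespace IidPi

variable {M : Type*} [MeasurableSpace M] (ν : Measure M) [IsProbabilityMeasure ν]

/-- The law of independent observations indexed by a finite type. -/
abbrev iid (ι : Type*) [Fintype ι] : Measure (ι → M) := Measure.pi fun _ => ν

variable {ι J : Type*} [Fintype ι] [Fintype J]

lemma measurable_reindex (e : ι → J) : Measurable (fun (x : J → M) i => x (e i)) :=
  measurable_pi_lambda _ fun _ => measurable_pi_apply _

lemma measurePreserving_reindex {e : ι → J} (he : Function.Injective e) :
    MeasurePreserving (fun (x : J → M) i => x (e i)) (iid ν J) (iid ν ι) := by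
  refine ⟨measurable_reindex e, ?_⟩
  have h := iIndepFun_pi (μ := fun _ : J => ν) (X := fun _ => id)
    (fun _ => aemeasurable_id)
  have h2 : iIndepFun (fun i (x : J → M) => x (e i)) (iid ν J) := h.precomp he
  rw [iIndepFun_iff_map_fun_eq_pi_map fun i => (measurable_pi_apply _).aemeasurable] at h2
  refine h2.trans ?_
  congr 1
  ext1 i
  exact (measurePreserving_eval (fun _ : J => ν) (e i)).map_eq

variable [DecidableEq ι]

/-- Keep the coordinates in `A` from `x` and take the others from `y`. -/
def mix (A : Finset ι) (x y : ι → M) : ι → M := fun k => if k ∈ A then x k else y k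

/-- `E[f(X) f(X')]`, where `X` and `X'` share exactly the coordinates in `A`. -/
def overlap (f : (ι → M) → ℝ) (A : Finset ι) : ℝ :=
  ∫ w, f (fun k => w (Sum.inl k)) * f (mix A (fun k => w (Sum.inl k)) fun k => w (Sum.inr k))
    ∂(iid ν (ι ⊕ ι))

/-- `E[f(X) | X_A]`. -/
def proj (f : (ι → M) → ℝ) (A : Finset ι) (x : ι → M) : ℝ := ∫ y, f (mix A x y) ∂(iid ν ι)

variable {ν}

lemma measurable_mix (A : Finset ι) : Measurable (fun q : (ι → M) × (ι → M) => mix A q.1 q.2) := by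
  refine measurable_pi_lambda _ fun k => ?_
  by_cases h : k ∈ A
  · simp only [mix, h, if_true]; exact (measurable_pi_apply k).comp measurable_fst
  · simp only [mix, h, if_false]; exact (measurable_pi_apply k).comp measurable_snd

lemma mix_sum (A : Finset ι) (w : ι ⊕ ι → M) :
    mix A (fun k => w (Sum.inl k)) (fun k => w (Sum.inr k)) =
      fun k => w (if k ∈ A then Sum.inl k else Sum.inr k) := by
  ext k; simp only [mix]; split_ifs <;> rfl

/-- The covariance of two reindexed copies depends only on the pattern of coincidences. -/
lemma integral_mul_reindex {f : (ι → M) → ℝ} (hf : Measurable f) {e₁ e₂ : ι → J}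
    (h₁ : Function.Injective e₁) (h₂ : Function.Injective e₂)
    (h₁₂ : ∀ k l, e₁ k = e₂ l → k = l) {A : Finset ι} (hA : ∀ k, k ∈ A ↔ e₁ k = e₂ k) :
    ∫ x, f (fun k => x (e₁ k)) * f (fun k => x (e₂ k)) ∂(iid ν J) = overlap ν f A := by
  -- Both sides are integrated over the enlarged index set J ⊕ ι. The second-copy coordinates in A
  -- are ignored by `mix`; sending them to fresh indices makes e injective, so reindexing preserves
  -- the product law.
  set e : ι ⊕ ι → J ⊕ ι := Sum.elim (fun k => Sum.inl (e₁ k))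
    (fun k => if k ∈ A then Sum.inr k else Sum.inl (e₂ k)) with he
  have hinj : Function.Injective e := by
    rintro (k | k) (l | l) h
    · simp only [he, Sum.elim_inl, Sum.inl.injEq] at h
      rw [h₁ h]
    · simp only [he, Sum.elim_inl, Sum.elim_inr] at h
      split_ifs at h with hl
      simp only [Sum.inl.injEq] at h
      have := h₁₂ _ _ h
      subst this
      exact absurd ((hA _).2 h) hl
    · simp only [he, Sum.elim_inl, Sum.elim_inr] at h
      split_ifs at h with hl
      simp only [Sum.inl.injEq] at h
      have := h₁₂ _ _ h.symm
      subst this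
      exact absurd ((hA _).2 h.symm) hl
    · simp only [he, Sum.elim_inr] at h
      split_ifs at h with hk hl hl
      · simp only [Sum.inr.injEq] at h; rw [h]
      · simp only [Sum.inl.injEq] at h; rw [h₂ h]
  have m1 := measurePreserving_reindex ν (e := (Sum.inl : J → J ⊕ ι)) Sum.inl_injective
  have m2 := measurePreserving_reindex ν hinj
  rw [overlap, ← m1.map_eq, ← m2.map_eq,
    integral_map m1.measurable.aemeasurable, integral_map m2.measurable.aemeasurable]
  · refine integral_congr_ae (Filter.Eventually.of_forall fun x => ?_)
    simp only [he, Sum.elim_inl]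
    congr 2
    ext k
    simp only [mix, Sum.elim_inr]
    by_cases hk : k ∈ A
    · rw [if_pos hk, (hA k).1 hk]
    · rw [if_neg hk, if_neg hk]
  · refine Measurable.aestronglyMeasurable (Measurable.mul (hf.comp (measurable_reindex _)) ?_)
    simp_rw [mix_sum]
    exact hf.comp (measurable_reindex _)
  · exact Measurable.aestronglyMeasurable (Measurable.mul (hf.comp (measurable_reindex _))
      (hf.comp (measurable_reindex _)))

lemma memLp_reindex {f : (ι → M) → ℝ} {q : ENNReal} (hf : MemLp f q (iid ν ι)) {e : ι → J}
    (he : Function.Injective e) : MemLp (fun x => f (fun k => x (e k))) q (iid ν J) :=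
  hf.comp_measurePreserving (measurePreserving_reindex ν he)

lemma measurePreserving_triple :
    MeasurePreserving (fun w : ι ⊕ (ι ⊕ ι) → M => ((fun k => w (Sum.inl k)),
      ((fun k => w (Sum.inr (Sum.inl k))), (fun k => w (Sum.inr (Sum.inr k))))))
      (iid ν (ι ⊕ (ι ⊕ ι))) ((iid ν ι).prod ((iid ν ι).prod (iid ν ι))) :=
  ((MeasurePreserving.id _).prod (measurePreserving_sumPiEquivProdPi (fun _ : ι ⊕ ι => ν))).comp
    (measurePreserving_sumPiEquivProdPi (fun _ : ι ⊕ (ι ⊕ ι) => ν))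

/-- Each factor is f at an injective choice of independent coordinates, hence square integrable.
This licenses Fubini for products of projections completed by two independent copies. -/
lemma integrable_triple {f : (ι → M) → ℝ} (hf : Measurable f) (hf2 : MemLp f 2 (iid ν ι))
    (A B : Finset ι) :
    Integrable (fun q : (ι → M) × ((ι → M) × (ι → M)) => f (mix A q.1 q.2.1) * f (mix B q.1 q.2.2))
      ((iid ν ι).prod ((iid ν ι).prod (iid ν ι))) := by
  have hm : ∀ A : Finset ι, ∀ s : (ι → M) × (ι → M) → (ι → M), Measurable s →
      Measurable fun q : (ι → M) × ((ι → M) × (ι → M)) => f (mix A q.1 (s q.2)) := fun A s hs =>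
    hf.comp ((measurable_mix A).comp (measurable_fst.prodMk (hs.comp measurable_snd)))
  have h : ∀ A : Finset ι, ∀ c : ι → ι ⊕ ι, Function.Injective c → MemLp
      (fun w : ι ⊕ (ι ⊕ ι) → M => f (mix A (fun k => w (Sum.inl k)) (fun k => w (Sum.inr (c k)))))
      2 (iid ν (ι ⊕ (ι ⊕ ι))) := by
    intro A c hc
    have he : ∀ w : ι ⊕ (ι ⊕ ι) → M, mix A (fun k => w (Sum.inl k)) (fun k => w (Sum.inr (c k))) =
        fun k => w (if k ∈ A then Sum.inl k else Sum.inr (c k)) := by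
      intro w; ext k; simp only [mix]; split_ifs <;> rfl
    simp_rw [he]
    refine memLp_reindex hf2 ?_
    intro k l hkl
    simp only at hkl
    split_ifs at hkl
    · exact Sum.inl_injective hkl
    · exact hc (Sum.inr_injective hkl)
  have hmeas : Measurable fun q : (ι → M) × ((ι → M) × (ι → M)) =>
      f (mix A q.1 q.2.1) * f (mix B q.1 q.2.2) := (hm A _ measurable_fst).mul (hm B _ measurable_snd)
  rw [← measurePreserving_triple.map_eq, integrable_map_measure hmeas.aestronglyMeasurable
    (measurePreserving_triple (ν := ν)).measurable.aemeasurable]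
  exact (h A Sum.inl Sum.inl_injective).integrable_mul (h B Sum.inr Sum.inr_injective)

lemma proj_mul_proj (f : (ι → M) → ℝ) (A B : Finset ι) (x : ι → M) :
    proj ν f A x * proj ν f B x =
      ∫ q, f (mix A x q.1) * f (mix B x q.2) ∂((iid ν ι).prod (iid ν ι)) :=
  (integral_prod_mul (fun y => f (mix A x y)) (fun y => f (mix B x y))).symm

lemma integrable_proj_mul {f : (ι → M) → ℝ} (hf : Measurable f) (hf2 : MemLp f 2 (iid ν ι))
    (A B : Finset ι) : Integrable (fun x => proj ν f A x * proj ν f B x) (iid ν ι) := by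
  simp_rw [proj_mul_proj]
  exact (integrable_triple hf hf2 A B).integral_prod_left

/-- Once the two projections are completed by independent copies, their arguments share exactly the
coordinates in A ∩ B. -/
lemma integral_proj_mul {f : (ι → M) → ℝ} (hf : Measurable f) (hf2 : MemLp f 2 (iid ν ι))
    (A B : Finset ι) :
    ∫ x, proj ν f A x * proj ν f B x ∂(iid ν ι) = overlap ν f (A ∩ B) := by
  simp_rw [proj_mul_proj]
  have hi := integrable_triple hf hf2 A B
  rw [← integral_prod (fun q : (ι → M) × ((ι → M) × (ι → M)) =>
    f (mix A q.1 q.2.1) * f (mix B q.1 q.2.2)) hi]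
  have hm := hi.aestronglyMeasurable
  rw [← measurePreserving_triple.map_eq] at hm ⊢
  rw [integral_map (measurePreserving_triple (ν := ν)).measurable.aemeasurable hm]
  have h := integral_mul_reindex (ν := ν) hf
    (e₁ := fun k : ι => if k ∈ A then Sum.inl k else (Sum.inr (Sum.inl k) : ι ⊕ (ι ⊕ ι)))
    (e₂ := fun k : ι => if k ∈ B then Sum.inl k else (Sum.inr (Sum.inr k) : ι ⊕ (ι ⊕ ι)))
    (A := A ∩ B) (by intro k l h; grind) (by intro k l h; grind) (by intro k l h; grind)
    (by intro k; grind)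
  rw [← h]
  refine integral_congr_ae (Filter.Eventually.of_forall fun w => ?_)
  simp only
  congr 2 <;> ext k <;> simp only [mix] <;> split_ifs <;> rfl

/-- The difference of the two sides is the second moment of proj(A ∪ B) - proj(A) - proj(B) + proj(A
∩ B), since the integral of proj(C) proj(D) depends only on C ∩ D. -/
lemma overlap_supermodular {f : (ι → M) → ℝ} (hf : Measurable f) (hf2 : MemLp f 2 (iid ν ι))
    (A B : Finset ι) :
    overlap ν f A + overlap ν f B ≤ overlap ν f (A ∪ B) + overlap ν f (A ∩ B) := by
  have h0 : 0 ≤ ∫ x, (proj ν f (A ∪ B) x - proj ν f A x - proj ν f B x + proj ν f (A ∩ B) x) ^ 2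
      ∂(iid ν ι) := integral_nonneg fun x => sq_nonneg _
  set C : Fin 4 → Finset ι := ![A ∪ B, A, B, A ∩ B] with hC
  set ε : Fin 4 → ℝ := ![1, -1, -1, 1] with hε
  have hexp : ∀ x, (proj ν f (A ∪ B) x - proj ν f A x - proj ν f B x + proj ν f (A ∩ B) x) ^ 2 =
      ∑ i, ∑ j, ε i * ε j * (proj ν f (C i) x * proj ν f (C j) x) := by
    intro x
    simp [Fin.sum_univ_four, hC, hε]
    ring
  simp_rw [hexp] at h0
  rw [integral_finsetSum _ fun i _ => integrable_finsetSum _ fun j _ =>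
    (integrable_proj_mul hf hf2 _ _).const_mul _] at h0
  have h1 : ∀ i, ∫ x, ∑ j, ε i * ε j * (proj ν f (C i) x * proj ν f (C j) x) ∂(iid ν ι) =
      ∑ j, ε i * ε j * overlap ν f (C i ∩ C j) := by
    intro i
    rw [integral_finsetSum _ fun j _ => (integrable_proj_mul hf hf2 _ _).const_mul _]
    simp_rw [integral_const_mul, integral_proj_mul hf hf2]
  simp_rw [h1] at h0
  have e1 : (A ∪ B) ∩ A = A := by grind
  have e2 : (A ∪ B) ∩ B = B := by grind
  have e3 : (A ∪ B) ∩ (A ∩ B) = A ∩ B := by grind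
  have e4 : A ∩ (A ∪ B) = A := by grind
  have e5 : B ∩ (A ∪ B) = B := by grind
  have e6 : A ∩ B ∩ (A ∪ B) = A ∩ B := by grind
  have e7 : A ∩ (A ∩ B) = A ∩ B := by grind
  have e8 : B ∩ (A ∩ B) = A ∩ B := by grind
  have e9 : A ∩ B ∩ A = A ∩ B := by grind
  have e10 : A ∩ B ∩ B = A ∩ B := by grind
  have e11 : B ∩ A = A ∩ B := by grind
  simp [Fin.sum_univ_four, hC, hε, e1, e2, e3, e4, e5, e6, e7, e8, e9, e10, e11] at h0
  linarith

lemma overlap_empty {f : (ι → M) → ℝ} :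
    overlap ν f ∅ = (∫ x, f x ∂(iid ν ι)) ^ 2 := by
  have h := (measurePreserving_sumPiEquivProdPi (fun _ : ι ⊕ ι => ν)).integral_comp'
    (g := fun q : (ι → M) × (ι → M) => f q.1 * f q.2)
  rw [integral_prod_mul f f, ← sq] at h
  rw [← h, overlap]
  rfl

lemma overlap_univ {f : (ι → M) → ℝ} (hf : Measurable f) :
    overlap ν f Finset.univ = ∫ x, f x ^ 2 ∂(iid ν ι) := by
  rw [← integral_mul_reindex hf (e₁ := id) (e₂ := id) Function.injective_id Function.injective_id
    (fun k l h => h) (by simp)]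
  simp [sq]

lemma overlap_map {f : (ι → M) → ℝ} (hf : Measurable f)
    (hs : ∀ (τ : Equiv.Perm ι) (x : ι → M), f (fun k => x (τ k)) = f x) (A : Finset ι)
    (τ : Equiv.Perm ι) : overlap ν f (A.map τ.toEmbedding) = overlap ν f A := by
  rw [overlap]
  simp_rw [mix_sum]
  rw [← integral_mul_reindex (ν := ν) hf (A := A) (J := ι ⊕ ι)
    (e₁ := fun k => Sum.inl (τ k))
    (e₂ := fun k => if k ∈ A then Sum.inl (τ k) else Sum.inr (τ k))]
  · refine integral_congr_ae (Filter.Eventually.of_forall fun w => ?_)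
    simp only
    rw [hs τ fun k => w (Sum.inl k), ← hs τ fun k => w (if k ∈ A.map τ.toEmbedding then Sum.inl k
      else Sum.inr k)]
    simp
  · intro k l h; simpa using h
  · intro k l h; grind [τ.injective.eq_iff]
  · intro k l h; grind [τ.injective.eq_iff]
  · intro k; grind

lemma overlap_eq_of_card_eq {f : (ι → M) → ℝ} (hf : Measurable f)
    (hs : ∀ (τ : Equiv.Perm ι) (x : ι → M), f (fun k => x (τ k)) = f x) {A B : Finset ι}
    (h : A.card = B.card) : overlap ν f A = overlap ν f B := by
  obtain ⟨τ, hτ⟩ : ∃ τ : Equiv.Perm ι, A.map τ.toEmbedding = B := by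
    let e : {x // x ∈ A} ≃ {x // x ∈ B} := Finset.equivOfCardEq h
    refine ⟨e.extendSubtype, Finset.eq_of_subset_of_card_le ?_ (by simp [h])⟩
    intro x hx
    simp only [Finset.mem_map_equiv] at hx
    have := e.extendSubtype_mem _ hx
    simpa using this
  rw [← hτ, overlap_map hf hs]

/-- For a convex sequence vanishing at 0 the slope u r / r is nondecreasing. -/
lemma mul_le_of_convex {m : ℕ} {u : ℕ → ℝ} (h0 : u 0 = 0)
    (hc : ∀ r, r + 2 ≤ m → 2 * u (r + 1) ≤ u (r + 2) + u r) {r : ℕ} (hr : r ≤ m) :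
    m * u r ≤ r * u m := by
  have h1 : ∀ k, k + 1 ≤ m → (k + 1) * u k ≤ k * u (k + 1) := by
    intro k
    induction k with
    | zero => intro _; simp [h0]
    | succ k ih =>
      intro hk
      have h2 := ih (by omega)
      have h3 := hc k hk
      push_cast
      have : (0 : ℝ) ≤ k + 1 := by positivity
      nlinarith
  rcases Nat.eq_zero_or_pos r with rfl | hr0
  · simp [h0]
  induction m, hr using Nat.le_induction with
  | base => exact le_rfl
  | succ k hk ih =>
    have h2 := ih (fun r hr => hc r (by omega)) (fun r hr => h1 r (by omega))
    have h3 := h1 k le_rfl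
    have hk0 : (0 : ℝ) < k := by exact_mod_cast hr0.trans_le hk
    have h4 : (k : ℝ) * ((k + 1) * u r) ≤ k * (r * u (k + 1)) := by
      have : (0 : ℝ) ≤ r := by positivity
      nlinarith
    push_cast
    exact le_of_mul_le_mul_left h4 hk0

/-- By symmetry the overlap depends only on the cardinality of A. Supermodularity for S ∪ {a} and S
∪ {b} makes it convex in that cardinality, and centring makes it vanish at 0. No Hoeffding
decomposition of f is needed. -/
lemma overlap_le {f : (ι → M) → ℝ} (hf : Measurable f) (hf2 : MemLp f 2 (iid ν ι))
    (hs : ∀ (τ : Equiv.Perm ι) (x : ι → M), f (fun k => x (τ k)) = f x)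
    (h0 : ∫ x, f x ∂(iid ν ι) = 0) (A : Finset ι) :
    Fintype.card ι * overlap ν f A ≤ A.card * ∫ x, f x ^ 2 ∂(iid ν ι) := by
  have hex : ∀ r, r ≤ Fintype.card ι → ∃ B : Finset ι, B.card = r := fun r hr => by
    obtain ⟨B, -, hB⟩ := Finset.exists_subset_card_eq (s := Finset.univ) (n := r)
      (by simpa using hr)
    exact ⟨B, hB⟩
  choose! S hS using hex
  have key := mul_le_of_convex (m := Fintype.card ι) (u := fun r => overlap ν f (S r)) ?_ ?_
    (r := A.card) (Finset.card_le_univ A)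
  · rw [overlap_eq_of_card_eq hf hs (hS _ (Finset.card_le_univ A)),
      overlap_eq_of_card_eq (A := S (Fintype.card ι)) hf hs (B := Finset.univ)
        (by rw [hS _ le_rfl]; rfl),
      overlap_univ hf] at key
    exact key
  · rw [Finset.card_eq_zero.1 (hS 0 (Nat.zero_le _)), overlap_empty, h0]
    simp
  · intro r hr
    have hB := hS r (by omega)
    obtain ⟨B', hB', hB'c⟩ := Finset.exists_subset_card_eq (s := (S r)ᶜ) (n := 2)
      (by rw [Finset.card_compl, hB]; omega)
    obtain ⟨a, b, hab, rfl⟩ := Finset.card_eq_two.1 hB'c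
    have ha : a ∉ S r := by have := hB' (Finset.mem_insert_self a {b}); simpa using this
    have hb : b ∉ S r := by have := hB' (show b ∈ {a, b} by simp); simpa using this
    have h := overlap_supermodular hf hf2 (insert a (S r)) (insert b (S r))
    have e1 : insert a (S r) ∩ insert b (S r) = S r := by grind
    have e2 : insert a (S r) ∪ insert b (S r) = insert a (insert b (S r)) := by grind
    have c1 : (insert a (S r)).card = r + 1 := by rw [Finset.card_insert_of_notMem ha, hB]
    have c2 : (insert b (S r)).card = r + 1 := by rw [Finset.card_insert_of_notMem hb, hB]
    have c3 : (insert a (insert b (S r))).card = r + 2 := by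
      rw [Finset.card_insert_of_notMem (by simp [hab, ha]), c2]
    rw [e1, e2, overlap_eq_of_card_eq hf hs (c1.trans (hS (r + 1) (by omega)).symm),
      overlap_eq_of_card_eq hf hs (c2.trans (hS (r + 1) (by omega)).symm),
      overlap_eq_of_card_eq hf hs (c3.trans (hS (r + 2) (by omega)).symm)] at h
    linarith

end IidPi

/-! ### Counting index tuples and the Hoeffding decomposition -/

namespace IncompleteU

variable {n m : ℕ}

/-- The set of entries of an increasing tuple. -/
def entries (i : Idx n m) : Finset (Fin n) := Finset.univ.map i.toEmbedding

lemma mem_entries {i : Idx n m} {a : Fin n} : a ∈ entries i ↔ ∃ k, i k = a := by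
  simp [entries]

lemma card_entries (i : Idx n m) : (entries i).card = m := by simp [entries]

lemma sum_entries (F : Finset (Fin n) → ℝ) :
    ∑ i : Idx n m, F (entries i) = ∑ s ∈ Finset.powersetCard m Finset.univ, F s := by
  refine Finset.sum_bij (fun i _ => entries i) ?_ ?_ ?_ ?_
  · intro i _
    simp [Finset.mem_powersetCard, card_entries]
  · intro i _ j _ h
    have hi := Finset.orderEmbOfFin_unique' (card_entries i) (f := i)
      (fun k => mem_entries.2 ⟨k, rfl⟩)
    have hj := Finset.orderEmbOfFin_unique' (card_entries i) (f := j)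
      (fun k => by rw [h]; exact mem_entries.2 ⟨k, rfl⟩)
    rw [hi, hj]
  · intro s hs
    have hc := (Finset.mem_powersetCard.1 hs).2
    exact ⟨s.orderEmbOfFin hc, Finset.mem_univ _, Finset.map_orderEmbOfFin_univ s hc⟩
  · intro i _; rfl

lemma card_idx : Fintype.card (Idx n m) = n.choose m := by
  have h := sum_entries (n := n) (m := m) fun _ => 1
  simp only [Finset.sum_const, nsmul_eq_mul, mul_one, Finset.card_powersetCard, Finset.card_univ,
    Fintype.card_fin] at h
  exact_mod_cast h

/-- A set t is determined by s ∩ t and t \ s, which are chosen independently inside s and its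
complement. -/
lemma card_filter_inter {s : Finset (Fin n)} (hs : s.card = m) {r : ℕ} (hr : r ≤ m) :
    ((Finset.powersetCard m Finset.univ).filter fun t => (s ∩ t).card = r).card =
      m.choose r * (n - m).choose (m - r) := by
  have h : (Finset.powersetCard r s ×ˢ Finset.powersetCard (m - r) sᶜ).card =
      m.choose r * (n - m).choose (m - r) := by
    rw [Finset.card_product, Finset.card_powersetCard, Finset.card_powersetCard,
      Finset.card_compl, hs, Fintype.card_fin]
  rw [← h]
  refine Finset.card_nbij' (fun t => (s ∩ t, t \ s)) (fun q => q.1 ∪ q.2) ?_ ?_ ?_ ?_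
  · intro t ht
    simp only [Finset.coe_filter, Finset.mem_powersetCard, Set.mem_ofPred_eq] at ht
    simp only [Finset.coe_product, Set.mem_prod, Finset.mem_coe, Finset.mem_powersetCard]
    refine ⟨⟨Finset.inter_subset_left, ht.2⟩, by intro a ha; simp at ha ⊢; exact ha.2, ?_⟩
    have := Finset.card_sdiff_add_card_inter t s
    rw [Finset.inter_comm] at this
    omega
  · intro q hq
    simp only [Finset.coe_product, Set.mem_prod, Finset.mem_coe, Finset.mem_powersetCard] at hq
    obtain ⟨⟨h1, h2⟩, h3, h4⟩ := hq
    have hd : Disjoint s q.2 := by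
      rw [Finset.disjoint_left]; intro a ha hb; have := h3 hb; simp at this; exact this ha
    simp only [Finset.coe_filter, Finset.mem_powersetCard, Set.mem_ofPred_eq]
    refine ⟨⟨Finset.subset_univ _, ?_⟩, ?_⟩
    · rw [Finset.card_union_of_disjoint (hd.mono_left h1)]; omega
    · rw [Finset.inter_union_distrib_left, Finset.disjoint_iff_inter_eq_empty.1 hd,
        Finset.union_empty, Finset.inter_eq_right.2 h1, h2]
  · intro t _
    ext a; simp; tauto
  · intro q hq
    simp only [Finset.coe_product, Set.mem_prod, Finset.mem_coe, Finset.mem_powersetCard] at hq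
    obtain ⟨⟨h1, h2⟩, h3, h4⟩ := hq
    ext a
    · have := @h1 a; have := @h3 a; simp at *; tauto
    · have := @h1 a; have := @h3 a; simp at *; tauto

/-- Averages over pairs of index sets, grouped by the size of the intersection. -/
lemma sum_card_inter (i : Idx n m) (G : ℕ → ℝ) :
    ∑ j : Idx n m, G (entries i ∩ entries j).card =
      ∑ r ∈ Finset.range (m + 1), (m.choose r : ℝ) * ((n - m).choose (m - r) : ℝ) * G r := by
  rw [sum_entries fun t => G (entries i ∩ t).card,
    ← Finset.sum_fiberwise_of_maps_to (t := Finset.range (m + 1))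
      (g := fun t => (entries i ∩ t).card)]
  · refine Finset.sum_congr rfl fun r hr => ?_
    rw [Finset.sum_congr rfl (g := fun _ => G r) fun t ht => by rw [(Finset.mem_filter.1 ht).2],
      Finset.sum_const, card_filter_inter (card_entries i) (by simpa [Nat.lt_succ_iff] using hr)]
    simp
  · intro t _
    rw [Finset.mem_range, Nat.lt_succ_iff]
    exact (Finset.card_le_card Finset.inter_subset_left).trans_eq (card_entries i)

/-- Double counting: composites of j with i are the s-tuples contained in i, and each s-tuple lies
in C(n - s, m - s) tuples of length m. -/
lemma sum_comp_idx {s : ℕ} (hsm : s ≤ m) (G : Idx n s → ℝ) :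
    ∑ i : Idx n m, ∑ j : Idx m s, G (j.trans i) =
      ((n - s).choose (m - s) : ℝ) * ∑ l : Idx n s, G l := by
  have h1 : ∀ i : Idx n m, ∑ j : Idx m s, G (j.trans i) =
      ∑ l : Idx n s, if entries l ⊆ entries i then G l else 0 := by
    intro i
    rw [← Finset.sum_filter]
    refine Finset.sum_bij (fun j _ => j.trans i) ?_ ?_ ?_ ?_
    · intro j _
      simp only [Finset.mem_filter, Finset.mem_univ, true_and]
      intro a ha
      obtain ⟨k, rfl⟩ := mem_entries.1 ha
      exact mem_entries.2 ⟨j k, rfl⟩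
    · intro j _ j' _ h
      ext k
      have := DFunLike.congr_fun h k
      exact congrArg Fin.val (i.injective this)
    · intro l hl
      simp only [Finset.mem_filter, Finset.mem_univ, true_and] at hl
      have hc : ∀ k, ∃ a, i a = l k := fun k => mem_entries.1 (hl (mem_entries.2 ⟨k, rfl⟩))
      choose c hc using hc
      refine ⟨OrderEmbedding.ofStrictMono c ?_, Finset.mem_univ _, ?_⟩
      · intro a b hab
        rw [← i.lt_iff_lt, hc, hc]
        exact l.lt_iff_lt.2 hab
      · ext k
        exact congrArg Fin.val (hc k)
    · intro j _; rfl
  simp_rw [h1]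
  rw [Finset.sum_comm, Finset.mul_sum]
  refine Finset.sum_congr rfl fun l _ => ?_
  rw [sum_entries fun t => if entries l ⊆ t then G l else 0, ← Finset.sum_filter,
    Finset.sum_const, nsmul_eq_mul]
  congr 2
  have := Finset.card_filter_powersetCard_subset (entries l) Finset.univ m (Finset.subset_univ _)
    (by rw [card_entries]; exact hsm)
  rw [card_entries, Finset.card_univ, Fintype.card_fin] at this
  convert this

variable {M : Type*} [MeasurableSpace M] (ν : Measure M) [IsProbabilityMeasure ν]

lemma condMean_self (t : (Fin m → M) → ℝ) (x : Fin m → M) : condMean ν t m x = t x := by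
  simp [condMean, mean]

lemma idx_self (j : Idx m m) : j = RelEmbedding.refl _ := by
  have hc : (Finset.univ : Finset (Fin m)).card = m := by simp
  rw [Finset.orderEmbOfFin_unique' hc (f := j) fun k => Finset.mem_univ _]
  exact (Finset.orderEmbOfFin_unique' hc fun k => Finset.mem_univ _).symm

/-- The defining recursion at r = m, solved for `PsiTilde`; no variable is left to integrate there.
The identity is algebraic and holds at every point. -/
lemma sq_sub_eq_sum_hoeffdingKernel (h : (Fin m → M) → ℝ) (hm : 1 ≤ m) (x : Fin m → M) :
    h x ^ 2 - sigmaSq ν h =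
      ∑ s ∈ Finset.Icc 1 m, ∑ j : Idx m s, hoeffdingKernel ν h s (fun k => x (j k)) := by
  have h1 : hoeffdingKernel ν h m x = (h x ^ 2 - sigmaSq ν h) -
      ∑ s : Fin m, if 1 ≤ (s : ℕ) then
        ∑ j : Idx m s, hoeffdingKernel ν h (s : ℕ) (fun k => x (j k)) else 0 := by
    rw [hoeffdingKernel, PsiTilde, condMean_self]
  have h2 := Fin.sum_univ_eq_sum_range (fun s => if 1 ≤ s then
        ∑ j : Idx m s, hoeffdingKernel ν h s (fun k => x (j k)) else 0) m
  rw [h2] at h1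
  have h3 : ∑ j : Idx m m, hoeffdingKernel ν h m (fun k => x (j k)) = hoeffdingKernel ν h m x := by
    have : ∀ j : Idx m m, hoeffdingKernel ν h m (fun k => x (j k)) = hoeffdingKernel ν h m x := by
      intro j; rw [idx_self j]; rfl
    rw [Finset.sum_congr rfl fun j _ => this j, Finset.sum_const, Finset.card_univ, card_idx]
    simp
  have h4 : Finset.Icc 1 m = insert m ((Finset.range m).filter fun s => 1 ≤ s) := by
    ext a; simp; omega
  rw [h4, Finset.sum_insert (by simp), h3, Finset.sum_filter]
  linarith

lemma hoeffdingKernel_one (h : (Fin m → M) → ℝ) (x : Fin 1 → M) :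
    hoeffdingKernel ν h 1 x = Psi1 ν h (x 0) - sigmaSq ν h := by
  have : x = fun _ => x 0 := funext fun k => by rw [Subsingleton.elim k 0]
  rw [hoeffdingKernel, PsiTilde, Psi1, ← this]
  simp

lemma sum_idx_one (F : Fin n → ℝ) : ∑ l : Idx n 1, F (l 0) = ∑ i, F i := by
  refine Finset.sum_bij (fun l _ => l 0) (fun _ _ => Finset.mem_univ _) ?_ ?_ fun _ _ => rfl
  · intro l _ l' _ h
    ext k
    rw [Subsingleton.elim k 0, h]
  · intro i _
    exact ⟨OrderEmbedding.ofStrictMono (fun _ => i) fun a b hab => by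
      exact absurd hab (by rw [Subsingleton.elim a b]; exact lt_irrefl _), Finset.mem_univ _, rfl⟩

/-- The Hoeffding decomposition of the U-statistic with kernel `h²`. -/
lemma average_sq_eq (h : (Fin m → M) → ℝ) (hm : 1 ≤ m) (hmn : m ≤ n) (hσ : sigmaSq ν h ≠ 0)
    (x : Fin n → M) :
    (∑ i : Idx n m, h (fun k => x (i k)) ^ 2 / sigmaSq ν h) / (n.choose m : ℝ) =
      1 + (m : ℝ) / n * (∑ i, (Psi1 ν h (x i) - sigmaSq ν h) / sigmaSq ν h) +
        remainder ν h x := by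
  have hc : (n.choose m : ℝ) ≠ 0 := by exact_mod_cast (Nat.choose_pos hmn).ne'
  have h1 : ∑ i : Idx n m, (h (fun k => x (i k)) ^ 2 - sigmaSq ν h) =
      ∑ s ∈ Finset.Icc 1 m, ((n - s).choose (m - s) : ℝ) *
        ∑ l : Idx n s, hoeffdingKernel ν h s (fun k => x (l k)) := by
    simp_rw [sq_sub_eq_sum_hoeffdingKernel ν h hm]
    rw [Finset.sum_comm]
    refine Finset.sum_congr rfl fun s hs => ?_
    exact sum_comp_idx (Finset.mem_Icc.1 hs).2
      (fun l : Idx n s => hoeffdingKernel ν h s (fun k => x (l k)))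
  have h2 : ∑ i : Idx n m, (h (fun k => x (i k)) ^ 2 - sigmaSq ν h) =
      ∑ i : Idx n m, h (fun k => x (i k)) ^ 2 - (n.choose m : ℝ) * sigmaSq ν h := by
    rw [Finset.sum_sub_distrib, Finset.sum_const, Finset.card_univ, card_idx, nsmul_eq_mul]
  -- Subset-of-a-subset identity C(n, m) C(m, s) = C(n, s) C(n - s, m - s).
  have h3 : ∀ s ∈ Finset.Icc 1 m, ((n - s).choose (m - s) : ℝ) / (n.choose m : ℝ) =
      (m.choose s : ℝ) * ((n.choose s : ℝ))⁻¹ := by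
    intro s hs
    have hs' := Finset.mem_Icc.1 hs
    have hcs : (n.choose s : ℝ) ≠ 0 := by exact_mod_cast (Nat.choose_pos (hs'.2.trans hmn)).ne'
    have := Nat.choose_mul (n := n) hs'.2
    have h4 : (n.choose m : ℝ) * m.choose s = n.choose s * (n - s).choose (m - s) := by
      exact_mod_cast this
    field_simp
    linarith
  have h5 : (∑ i : Idx n m, h (fun k => x (i k)) ^ 2 / sigmaSq ν h) / (n.choose m : ℝ) =
      1 + ∑ s ∈ Finset.Icc 1 m, (m.choose s : ℝ) * ((n.choose s : ℝ))⁻¹ *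
        ∑ l : Idx n s, hoeffdingKernel ν h s (fun k => x (l k)) / sigmaSq ν h := by
    have e1 : ∑ s ∈ Finset.Icc 1 m, (m.choose s : ℝ) * ((n.choose s : ℝ))⁻¹ *
        ∑ l : Idx n s, hoeffdingKernel ν h s (fun k => x (l k)) / sigmaSq ν h =
        (∑ i : Idx n m, (h (fun k => x (i k)) ^ 2 - sigmaSq ν h)) /
          ((n.choose m : ℝ) * sigmaSq ν h) := by
      rw [h1, Finset.sum_div]
      refine Finset.sum_congr rfl fun s hs => ?_
      rw [← h3 s hs, ← Finset.sum_div]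
      field_simp
    rw [e1, h2, ← Finset.sum_div]
    field_simp
    ring
  rw [h5, remainder, add_assoc]
  congr 1
  have h6 : Finset.Icc 1 m = insert 1 (Finset.Icc 2 m) := by ext a; simp; omega
  rw [h6, Finset.sum_insert (by simp)]
  congr 1
  simp_rw [hoeffdingKernel_one]
  rw [sum_idx_one fun i => (Psi1 ν h (x i) - sigmaSq ν h) / sigmaSq ν h]
  simp [div_eq_mul_inv]

/-- Absorption identity. It turns the covariance factor r/m into the binomial coefficient appearing
in `Kconst`. -/
lemma choose_mul_div {r : ℕ} (hr : 1 ≤ r) (hm : 1 ≤ m) :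
    (m.choose r : ℝ) * ((r : ℝ) / m) = (m - 1).choose (r - 1) := by
  obtain ⟨r, rfl⟩ := Nat.exists_eq_add_of_le' hr
  obtain ⟨m, rfl⟩ := Nat.exists_eq_add_of_le' hm
  have := Nat.add_one_mul_choose_eq m r
  have h : ((m : ℝ) + 1) * m.choose r = (m + 1).choose (r + 1) * (r + 1) := by exact_mod_cast this
  simp only [Nat.add_sub_cancel]
  push_cast
  field_simp
  linarith

/-- Vandermonde's identity sums the products to C(n - 1, m - 1). -/
lemma Kconst_one (hm : 1 ≤ m) (hmn : m ≤ n) : Kconst n m 1 = (m : ℝ) / n := by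
  have hc : (n.choose m : ℝ) ≠ 0 := by exact_mod_cast (Nat.choose_pos hmn).ne'
  have h1 : ∑ r ∈ Finset.Icc 1 m, (m - 1).choose (r - 1) * (n - m).choose (m - r) =
      (n - 1).choose (m - 1) := by
    rw [show n - 1 = (m - 1) + (n - m) by omega, Nat.add_choose_eq,
      Finset.Nat.sum_antidiagonal_eq_sum_range_succ
        (fun a b => (m - 1).choose a * (n - m).choose b)]
    refine Finset.sum_bij (fun r _ => r - 1) ?_ ?_ ?_ ?_
    · intro r hr; simp at hr ⊢; omega
    · intro r hr r' hr' h; simp at hr hr' h; omega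
    · intro r hr; exact ⟨r + 1, by simp at hr ⊢; omega, by simp⟩
    · intro r hr
      simp at hr
      rw [show m - 1 - (r - 1) = m - r by omega]
  have h2 := choose_mul_div (m := n) (r := m) hm (hm.trans hmn)
  rw [Kconst]
  have h3 : ∑ r ∈ Finset.Icc 1 m, ((m - 1).choose (r - 1) : ℝ) * ((n - m).choose (m - r) : ℝ) =
      (n - 1).choose (m - 1) := by exact_mod_cast h1
  rw [h3, ← h2]
  field_simp

/-- The term r = m is 1. This is what allows the sampling probability to be absorbed into N
`Kconst`. -/
lemma one_le_choose_mul_Kconst {d : ℕ} (hd : d ≤ m) (hmn : m ≤ n) :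
    1 ≤ (n.choose m : ℝ) * Kconst n m d := by
  have hc : (n.choose m : ℝ) ≠ 0 := by exact_mod_cast (Nat.choose_pos hmn).ne'
  rw [Kconst, mul_inv_cancel_left₀ hc]
  refine le_trans ?_ (Finset.single_le_sum (f := fun r => ((m - 1).choose (r - 1) : ℝ) *
    ((n - m).choose (m - r) : ℝ)) (fun r _ => by positivity) (Finset.mem_Icc.2 ⟨hd, le_rfl⟩))
  simp

end IncompleteU

/-! ### Variance of U-statistics and the rank of the kernel -/

namespace IncompleteU

open IidPi

variable {n m : ℕ} {M : Type*} [MeasurableSpace M] {ν : Measure M} [IsProbabilityMeasure ν]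

/-- The covariance of two summands of a U-statistic is an overlap integral. -/
lemma integral_mul_idx {f : (Fin m → M) → ℝ} (hf : Measurable f)
    (hs : ∀ (τ : Equiv.Perm (Fin m)) (x : Fin m → M), f (fun k => x (τ k)) = f x) (i j : Idx n m) :
    ∃ A : Finset (Fin m), A.card = (entries i ∩ entries j).card ∧
      ∫ x, f (fun k => x (i k)) * f (fun k => x (j k)) ∂(iid ν (Fin n)) = overlap ν f A := by
  classical
  set A : Finset (Fin m) := Finset.univ.filter fun k => i k ∈ entries j with hA
  -- By symmetry the arguments of the second summand may be permuted so that common entries occupy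
  -- the same positions. The permutation τ comes from extending k ↦ i k on A to a bijection onto the
  -- entries of j.
  obtain ⟨g, hg⟩ := Finset.exists_equiv_extend_of_card_eq (t := entries j) (α := Fin m)
    (by rw [card_entries, Fintype.card_fin]) (s := A) (f := i)
    (by intro a ha; obtain ⟨k, hk, rfl⟩ := Finset.mem_image.1 ha; exact (Finset.mem_filter.1 hk).2)
    i.injective.injOn
  have hbij : Function.Bijective (fun k : Fin m => (⟨j k, mem_entries.2 ⟨k, rfl⟩⟩ : entries j)) := by
    refine ⟨fun a b hab => j.injective (congrArg Subtype.val hab), fun a => ?_⟩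
    obtain ⟨k, hk⟩ := mem_entries.1 a.2
    exact ⟨k, Subtype.ext hk⟩
  set je := Equiv.ofBijective _ hbij
  set τ : Equiv.Perm (Fin m) := g.trans je.symm
  have hτ : ∀ k, j (τ k) = g k := fun k => congrArg Subtype.val (je.apply_symm_apply (g k))
  refine ⟨A, ?_, ?_⟩
  · have : A.map i.toEmbedding = entries i ∩ entries j := by
      ext a
      simp only [Finset.mem_map, Finset.mem_inter, hA, Finset.mem_filter, Finset.mem_univ, true_and]
      constructor
      · rintro ⟨k, hk, rfl⟩; exact ⟨mem_entries.2 ⟨k, rfl⟩, hk⟩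
      · rintro ⟨h1, h2⟩
        obtain ⟨k, rfl⟩ := mem_entries.1 h1
        exact ⟨k, h2, rfl⟩
    rw [← this, Finset.card_map]
  · rw [← integral_mul_reindex (ν := ν) hf (e₁ := i) (e₂ := fun k => j (τ k)) i.injective
      (j.injective.comp τ.injective)]
    · refine integral_congr_ae (Filter.Eventually.of_forall fun x => ?_)
      simp only
      rw [hs τ fun k => x (j k)]
    · intro k l hkl
      rw [hτ] at hkl
      have hk : k ∈ A := by simp [hA, hkl]
      rw [← hg k hk] at hkl
      exact g.injective (Subtype.ext hkl)
    · intro k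
      rw [hτ]
      refine ⟨fun hk => (hg k hk).symm, fun hk => ?_⟩
      simp [hA, hk]

/-- The variance of a U-statistic whose kernel has vanishing covariances below order `d`. -/
lemma integral_average_sq_le {f : (Fin m → M) → ℝ} (hf : Measurable f)
    (hf2 : MemLp f 2 (iid ν (Fin m)))
    (hs : ∀ (τ : Equiv.Perm (Fin m)) (x : Fin m → M), f (fun k => x (τ k)) = f x)
    (h0 : ∫ x, f x ∂(iid ν (Fin m)) = 0) (hm : 1 ≤ m) (hmn : m ≤ n) {d : ℕ} (hd : 1 ≤ d)
    (hdeg : ∀ A : Finset (Fin m), A.card < d → overlap ν f A = 0) :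
    ∫ x, ((∑ i : Idx n m, f (fun k => x (i k))) / (n.choose m : ℝ)) ^ 2 ∂(iid ν (Fin n)) ≤
      Kconst n m d * ∫ x, f x ^ 2 ∂(iid ν (Fin m)) := by
  have hc : (0 : ℝ) < n.choose m := by exact_mod_cast Nat.choose_pos hmn
  have hm0 : (0 : ℝ) < m := by exact_mod_cast hm
  have hF0 : 0 ≤ ∫ x, f x ^ 2 ∂(iid ν (Fin m)) := integral_nonneg fun x => sq_nonneg _
  set σ2 := ∫ x, f x ^ 2 ∂(iid ν (Fin m))
  have hpair : ∀ i j : Idx n m,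
      ∫ x, f (fun k => x (i k)) * f (fun k => x (j k)) ∂(iid ν (Fin n)) ≤
        if d ≤ (entries i ∩ entries j).card then
          ((entries i ∩ entries j).card : ℝ) / m * σ2 else 0 := by
    intro i j
    obtain ⟨A, hA, h⟩ := integral_mul_idx (ν := ν) hf hs i j
    rw [h, ← hA]
    split_ifs with hdA
    · have := overlap_le hf hf2 hs h0 A
      rw [Fintype.card_fin] at this
      rw [div_mul_eq_mul_div, le_div_iff₀ hm0]
      linarith
    · exact (hdeg A (not_le.1 hdA)).le
  have hint : ∀ i j : Idx n m, Integrable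
      (fun x => f (fun k => x (i k)) * f (fun k => x (j k))) (iid ν (Fin n)) := fun i j =>
    (memLp_reindex hf2 i.injective).integrable_mul (memLp_reindex hf2 j.injective)
  have hsq : ∀ x : Fin n → M, ((∑ i : Idx n m, f (fun k => x (i k))) / (n.choose m : ℝ)) ^ 2 =
      (∑ i : Idx n m, ∑ j : Idx n m, f (fun k => x (i k)) * f (fun k => x (j k))) /
        (n.choose m : ℝ) ^ 2 := by
    intro x
    rw [div_pow, sq (∑ i : Idx n m, _), Finset.sum_mul_sum]
  simp_rw [hsq]
  rw [integral_div, integral_finsetSum _ fun i _ => integrable_finsetSum _ fun j _ => hint i j]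
  have hrow : ∀ i : Idx n m, ∫ x, ∑ j : Idx n m, f (fun k => x (i k)) * f (fun k => x (j k))
      ∂(iid ν (Fin n)) ≤ (n.choose m : ℝ) * Kconst n m d * σ2 := by
    intro i
    rw [integral_finsetSum _ fun j _ => hint i j]
    refine (Finset.sum_le_sum fun j _ => hpair i j).trans_eq ?_
    rw [sum_card_inter i fun r => if d ≤ r then (r : ℝ) / m * σ2 else 0]
    rw [Kconst, mul_inv_cancel_left₀ hc.ne', Finset.sum_mul]
    have hI : Finset.Icc d m = (Finset.range (m + 1)).filter fun r => d ≤ r := by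
      ext a; simp; omega
    rw [hI, Finset.sum_filter]
    refine Finset.sum_congr rfl fun r _ => ?_
    split_ifs with hr
    · rw [← choose_mul_div (hd.trans hr) hm]; ring
    · simp
  rw [div_le_iff₀ (by positivity)]
  refine (Finset.sum_le_sum fun i _ => hrow i).trans_eq ?_
  rw [Finset.sum_const, Finset.card_univ, card_idx, nsmul_eq_mul]
  ring

lemma condMean_eq_proj (h : (Fin m → M) → ℝ) {r : ℕ} (hr : r ≤ m) (x : Fin m → M) :
    condMean ν h r (fun k => x (Fin.castLE hr k)) =
      proj ν h (Finset.univ.filter fun k : Fin m => (k : ℕ) < r) x := by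
  rw [condMean, mean, proj]
  congr 1
  ext y
  congr 1
  ext k
  simp [mix]

lemma measurable_condMean {h : (Fin m → M) → ℝ} (hh : Measurable h) (r : ℕ) :
    Measurable (condMean ν h r) := by
  refine (StronglyMeasurable.integral_prod_right' (f := fun q : (Fin r → M) × (Fin m → M) =>
    h (fun i => if hi : (i : ℕ) < r then q.1 ⟨i, hi⟩ else q.2 i)) ?_).measurable
  refine (hh.comp (measurable_pi_lambda _ fun i => ?_)).stronglyMeasurable
  by_cases hi : (i : ℕ) < r
  · simp only [hi, dite_true]; exact (measurable_pi_apply _).comp measurable_fst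
  · simp only [hi, dite_false]; exact (measurable_pi_apply _).comp measurable_snd

lemma integral_condMean_comp {h : (Fin m → M) → ℝ} (hh : Measurable h) {r : ℕ} (hr : r ≤ m)
    {F : ℝ → ℝ} (hF : Measurable F) :
    ∫ x, F (condMean ν h r x) ∂(prodLaw ν r) =
      ∫ x, F (proj ν h (Finset.univ.filter fun k : Fin m => (k : ℕ) < r) x) ∂(iid ν (Fin m)) := by
  have hmp := measurePreserving_reindex ν (Fin.castLE_injective hr)
  have e : prodLaw ν r = _ := hmp.map_eq.symm
  have hFm : Measurable fun x => F (condMean ν h r x) := hF.comp (measurable_condMean hh r)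
  rw [e, integral_map hmp.measurable.aemeasurable hFm.aestronglyMeasurable]
  simp_rw [condMean_eq_proj]

/-- Mixing the coordinates of two independent samples again produces a sample with the same law. -/
lemma integral_proj {f : (Fin m → M) → ℝ} (hf : Measurable f) (hf2 : MemLp f 2 (iid ν (Fin m)))
    (A : Finset (Fin m)) : ∫ x, proj ν f A x ∂(iid ν (Fin m)) = ∫ x, f x ∂(iid ν (Fin m)) := by
  have hmp : MeasurePreserving (fun q : (Fin m → M) × (Fin m → M) => mix A q.1 q.2)
      ((iid ν (Fin m)).prod (iid ν (Fin m))) (iid ν (Fin m)) := by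
    have h1 := (measurePreserving_sumPiEquivProdPi (fun _ : Fin m ⊕ Fin m => ν)).symm
    have h2 := (measurePreserving_reindex ν (e := fun k : Fin m => if k ∈ A then
      (Sum.inl k : Fin m ⊕ Fin m) else Sum.inr k) (by intro k l h; grind)).comp h1
    convert h2 using 1
    ext q k
    simp only [mix, Function.comp]
    split_ifs <;> rfl
  have hi : Integrable (fun q : (Fin m → M) × (Fin m → M) => f (mix A q.1 q.2))
      ((iid ν (Fin m)).prod (iid ν (Fin m))) :=
    hmp.integrable_comp_of_integrable (hf2.integrable (by norm_num))
  simp_rw [proj]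
  rw [← integral_prod (fun q : (Fin m → M) × (Fin m → M) => f (mix A q.1 q.2)) hi,
    ← hmp.map_eq, integral_map hmp.measurable.aemeasurable hf.aestronglyMeasurable, hmp.map_eq]

/-- The set of admissible orders contains m, because h_m = h, so the infimum is attained. -/
lemma rank_mem {h : (Fin m → M) → ℝ} (hm : 1 ≤ m) (hσ : 0 < sigmaSq ν h) :
    1 ≤ rank ν h ∧ rank ν h ≤ m := by
  have hne : {r : ℕ | 1 ≤ r ∧ r ≤ m ∧ 0 < variance (condMean ν h r) (prodLaw ν r)}.Nonempty := by
    refine ⟨m, hm, le_rfl, ?_⟩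
    have : condMean ν h m = h := funext (condMean_self ν h)
    rw [this]
    exact hσ
  have := Nat.sInf_mem hne
  exact ⟨this.1, this.2.1⟩

/-- Below the rank of the kernel all covariances vanish. -/
lemma overlap_eq_zero_of_card_lt_rank {h : (Fin m → M) → ℝ} (hh : Measurable h)
    (hh2 : MemLp h 2 (iid ν (Fin m)))
    (hs : ∀ (τ : Equiv.Perm (Fin m)) (x : Fin m → M), h (fun k => x (τ k)) = h x)
    (h0 : ∫ x, h x ∂(iid ν (Fin m)) = 0) (hm : 1 ≤ m) (hσ : 0 < sigmaSq ν h)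
    (A : Finset (Fin m)) (hA : A.card < rank ν h) : overlap ν h A = 0 := by
  rcases Nat.eq_zero_or_pos A.card with hc | hc
  · rw [Finset.card_eq_zero.1 hc, overlap_empty, h0]; simp
  have hr : A.card ≤ m := hA.le.trans (rank_mem hm hσ).2
  have hnot : A.card ∉ {r : ℕ | 1 ≤ r ∧ r ≤ m ∧ 0 < variance (condMean ν h r) (prodLaw ν r)} :=
    Nat.notMem_of_lt_sInf hA
  have hvar : variance (condMean ν h A.card) (prodLaw ν A.card) = 0 := by
    refine le_antisymm ?_ (variance_nonneg _ _)
    by_contra hcon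
    exact hnot ⟨hc, hr, not_le.1 hcon⟩
  have hmean : ∫ x, condMean ν h A.card x ∂(prodLaw ν A.card) = 0 := by
    have := integral_condMean_comp (ν := ν) hh hr (F := id) measurable_id
    simp only [id] at this
    rw [this, integral_proj hh hh2, h0]
  -- The vanishing variance of the centred conditional mean is the overlap on the first `A.card`
  -- coordinates; symmetry then transfers it to A.
  rw [variance_of_integral_eq_zero (measurable_condMean hh _).aemeasurable hmean,
    integral_condMean_comp hh hr (F := fun t => t ^ 2) (by fun_prop)] at hvar
  simp_rw [sq] at hvar
  rw [integral_proj_mul hh hh2, Finset.inter_self] at hvar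
  rw [← hvar]
  refine overlap_eq_of_card_eq hh hs ?_
  have : (Finset.univ.filter fun k : Fin m => (k : ℕ) < A.card) =
      Finset.univ.map (Fin.castLEEmb hr) := by
    ext k
    simp only [Finset.mem_filter, Finset.mem_univ, true_and, Finset.mem_map, Fin.castLEEmb_apply]
    exact ⟨fun hk => ⟨⟨k, hk⟩, rfl⟩, fun ⟨a, ha⟩ => by rw [← ha]; exact a.2⟩
  rw [this]
  simp

end IncompleteU

/-! ### Moments of order 3/2 of sums of independent variables -/

/-- The expansion behind the von Bahr-Esseen inequality. -/
lemma abs_add_rpow_three_halves_le_of_nonneg {a : ℝ} (ha : 0 ≤ a) (b : ℝ) :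
    |a + b| * Real.sqrt |a + b| ≤ a * Real.sqrt a + 3 / 2 * Real.sqrt a * b +
      3 * (|b| * Real.sqrt |b|) := by
  obtain ⟨s, hs⟩ : ∃ s, s = Real.sqrt a := ⟨_, rfl⟩
  obtain ⟨u, hu⟩ : ∃ u, u = Real.sqrt |a + b| := ⟨_, rfl⟩
  obtain ⟨v, hv⟩ : ∃ v, v = Real.sqrt |b| := ⟨_, rfl⟩
  have hs2 : s ^ 2 = a := hs ▸ Real.sq_sqrt ha
  have hu2 : u ^ 2 = |a + b| := hu ▸ Real.sq_sqrt (abs_nonneg _)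
  have hv2 : v ^ 2 = |b| := hv ▸ Real.sq_sqrt (abs_nonneg _)
  have hs0 : 0 ≤ s := hs ▸ Real.sqrt_nonneg _
  have hu0 : 0 ≤ u := hu ▸ Real.sqrt_nonneg _
  have hv0 : 0 ≤ v := hv ▸ Real.sqrt_nonneg _
  rw [← hs, ← hu, ← hv, ← hu2, ← hv2, ← hs2]
  -- In the square roots the claim is polynomial. For a + b ≥ 0 the Taylor remainder is (u - s)² (u
  -- + s/2), and |u - s| ≤ v bounds it by v³.
  rcases le_or_gt 0 (a + b) with hab | hab
  · rw [abs_of_nonneg hab] at hu2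
    have hb : b = u ^ 2 - s ^ 2 := by linarith
    have h1 : v ^ 2 = |u - s| * (u + s) := by
      rw [hv2, hb, show u ^ 2 - s ^ 2 = (u - s) * (u + s) by ring, abs_mul,
        abs_of_nonneg (show 0 ≤ u + s by linarith)]
    have h2 : |u - s| ≤ v := by
      rw [← abs_of_nonneg hv0, ← sq_le_sq, ← sq_abs, h1, sq]
      refine mul_le_mul_of_nonneg_left ?_ (abs_nonneg _)
      rw [abs_le]; constructor <;> linarith
    have h3 : (u - s) ^ 2 * (u + s) ≤ v ^ 2 * v := by
      rw [h1, ← sq_abs]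
      have := abs_nonneg (u - s)
      have h4 : |u - s| * ((u + s) * |u - s|) ≤ |u - s| * ((u + s) * v) := by gcongr
      linarith
    rw [hb]
    have h5 : 0 ≤ v ^ 2 * v := by positivity
    have h6 : 0 ≤ (u - s) ^ 2 * s := by positivity
    linarith
  · rw [abs_of_neg hab] at hu2
    have hb : b = -v ^ 2 := by
      rw [hv2, abs_of_neg (by linarith), neg_neg]
    have h1 : u ^ 2 = v ^ 2 - s ^ 2 := by linarith
    have h2 : u ≤ v := by
      rw [← abs_of_nonneg hu0, ← abs_of_nonneg hv0, ← sq_le_sq]; linarith [sq_nonneg s]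
    have h3 : s ≤ v := by
      rw [← abs_of_nonneg hs0, ← abs_of_nonneg hv0, ← sq_le_sq]; linarith [sq_nonneg u]
    have h4 : u ^ 2 * u ≤ v ^ 2 * v := by gcongr
    have h5 : s * v ^ 2 ≤ v * v ^ 2 := by gcongr
    have h6 : 0 ≤ s ^ 2 * s := by positivity
    have h7 : 0 ≤ v * v ^ 2 := by positivity
    rw [hb]
    linarith

lemma abs_add_rpow_three_halves_le (a b : ℝ) :
    |a + b| ^ (3 / 2 : ℝ) ≤ |a| ^ (3 / 2 : ℝ) +
      3 / 2 * ((SignType.sign a : ℝ) * Real.sqrt |a|) * b + 3 * |b| ^ (3 / 2 : ℝ) := by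
  rw [Real.rpow_three_halves (abs_nonneg _), Real.rpow_three_halves (abs_nonneg _),
    Real.rpow_three_halves (abs_nonneg _)]
  rcases lt_trichotomy a 0 with ha | ha | ha
  · have h := abs_add_rpow_three_halves_le_of_nonneg (neg_nonneg.2 ha.le) (-b)
    rw [← neg_add, abs_neg, abs_neg] at h
    rw [abs_of_neg ha, sign_neg ha, SignType.coe_neg, SignType.coe_one]
    linarith
  · subst ha
    simp
    nlinarith [mul_nonneg (abs_nonneg b) (Real.sqrt_nonneg |b|)]
  · have h := abs_add_rpow_three_halves_le_of_nonneg ha.le b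
    rw [abs_of_pos ha, sign_pos ha, SignType.coe_one]
    linarith

/-- The von Bahr-Esseen inequality of order `3 / 2`. -/
theorem integral_abs_sum_rpow_three_halves_le {Ω ι : Type*} [MeasurableSpace Ω] {P : Measure Ω}
    [IsProbabilityMeasure P] {Y : ι → Ω → ℝ} (hY : ∀ i, Measurable (Y i)) (hind : iIndepFun Y P)
    (hint : ∀ i, Integrable (fun ω => |Y i ω| ^ (3 / 2 : ℝ)) P) (h0 : ∀ i, ∫ ω, Y i ω ∂P = 0)
    (s : Finset ι) :
    Integrable (fun ω => |∑ i ∈ s, Y i ω| ^ (3 / 2 : ℝ)) P ∧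
      ∫ ω, |∑ i ∈ s, Y i ω| ^ (3 / 2 : ℝ) ∂P ≤ 3 * ∑ i ∈ s, ∫ ω, |Y i ω| ^ (3 / 2 : ℝ) ∂P := by
  classical
  have hle : ∀ t : ℝ, |t| ≤ 1 + |t| ^ (3 / 2 : ℝ) := by
    intro t
    have h1 : 0 ≤ |t| ^ (3 / 2 : ℝ) := by positivity
    rcases le_total |t| 1 with h | h
    · linarith
    · have : |t| ≤ |t| ^ (3 / 2 : ℝ) := by
        conv_lhs => rw [← Real.rpow_one |t|]
        exact Real.rpow_le_rpow_of_exponent_le h (by norm_num)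
      linarith
  have hYint : ∀ i, Integrable (Y i) P := fun i =>
    ((integrable_const 1).add (hint i)).mono' (hY i).aestronglyMeasurable
      (Filter.Eventually.of_forall fun ω => hle _)
  induction s using Finset.induction_on with
  | empty => simp
  | insert i s hi ih =>
    obtain ⟨ih1, ih2⟩ := ih
    set S : Ω → ℝ := fun ω => ∑ j ∈ s, Y j ω with hS
    have hSm : Measurable S := Finset.measurable_sum _ fun j _ => hY j
    set φ : ℝ → ℝ := fun t => (SignType.sign t : ℝ) * Real.sqrt |t| with hφ
    have hφm : Measurable φ := by
      have h1 : Measurable fun t : ℝ => ((SignType.sign t : SignType) : ℝ) := by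
        have : (fun t : ℝ => ((SignType.sign t : SignType) : ℝ)) =
            fun t => if 0 < t then 1 else if t < 0 then -1 else 0 := by
          ext t
          simp only [sign_apply]
          split_ifs <;> simp
        rw [this]
        exact Measurable.ite measurableSet_Ioi measurable_const
          (Measurable.ite measurableSet_Iio measurable_const measurable_const)
      exact h1.mul (by fun_prop)
    have hφle : ∀ t, |φ t| ≤ 2 + |t| ^ (3 / 2 : ℝ) := by
      intro t
      have h1 : |φ t| ≤ Real.sqrt |t| := by
        rw [hφ]
        simp only
        rw [abs_mul, abs_of_nonneg (Real.sqrt_nonneg _)]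
        refine mul_le_of_le_one_left (Real.sqrt_nonneg _) ?_
        rcases lt_trichotomy t 0 with h | h | h <;> simp [h, sign_neg, sign_pos]
      have h2 : Real.sqrt |t| ≤ 1 + |t| := by
        rw [Real.sqrt_le_left (by positivity)]; nlinarith [abs_nonneg t]
      linarith [hle t]
    have hφint : Integrable (fun ω => φ (S ω)) P :=
      ((integrable_const 2).add ih1).mono' (hφm.comp hSm).aestronglyMeasurable
        (Filter.Eventually.of_forall fun ω => hφle _)
    have hindep : IndepFun (fun ω => φ (S ω)) (Y i) P := by
      have := (hind.indepFun_finsetSum_of_notMem hY hi)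
      have h2 : (∑ j ∈ s, Y j) = S := by ext ω; simp [hS]
      rw [h2] at this
      exact this.comp hφm measurable_id
    have hprod : Integrable (fun ω => φ (S ω) * Y i ω) P := hindep.integrable_mul hφint (hYint i)
    -- Independence and centring remove the linear term, so each new summand adds at most 3
    -- E|Y_i|^{3/2}.
    have hprod0 : ∫ ω, φ (S ω) * Y i ω ∂P = 0 := by
      have := hindep.integral_mul_eq_mul_integral hφint.aestronglyMeasurable
        (hYint i).aestronglyMeasurable
      rw [h0 i, mul_zero] at this
      exact this
    have hpt : ∀ ω, |∑ j ∈ insert i s, Y j ω| ^ (3 / 2 : ℝ) ≤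
        |S ω| ^ (3 / 2 : ℝ) + 3 / 2 * (φ (S ω) * Y i ω) + 3 * |Y i ω| ^ (3 / 2 : ℝ) := by
      intro ω
      rw [Finset.sum_insert hi, add_comm]
      refine (abs_add_rpow_three_halves_le _ _).trans_eq ?_
      simp only [hφ, hS]
      ring
    have hR : Integrable (fun ω => |S ω| ^ (3 / 2 : ℝ) + 3 / 2 * (φ (S ω) * Y i ω) +
        3 * |Y i ω| ^ (3 / 2 : ℝ)) P :=
      (ih1.add (hprod.const_mul _)).add ((hint i).const_mul _)
    have hL : Integrable (fun ω => |∑ j ∈ insert i s, Y j ω| ^ (3 / 2 : ℝ)) P := by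
      refine hR.mono' ?_ (Filter.Eventually.of_forall fun ω => ?_)
      · have : Measurable fun ω => ∑ j ∈ insert i s, Y j ω :=
          Finset.measurable_sum _ fun j _ => hY j
        exact (by fun_prop : Measurable _).aestronglyMeasurable
      · rw [Real.norm_eq_abs, abs_of_nonneg (by positivity)]
        exact hpt ω
    refine ⟨hL, (integral_mono hL hR hpt).trans ?_⟩
    have hab : Integrable (fun ω => |S ω| ^ (3 / 2 : ℝ) + 3 / 2 * (φ (S ω) * Y i ω)) P :=
      ih1.add (hprod.const_mul _)
    rw [integral_add hab ((hint i).const_mul _),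
      integral_add ih1 (hprod.const_mul _), integral_const_mul, integral_const_mul, hprod0,
      Finset.sum_insert hi]
    linarith

lemma abs_le_one_add_rpow_three_halves (t : ℝ) : |t| ≤ 1 + |t| ^ (3 / 2 : ℝ) := by
  have h1 : 0 ≤ |t| ^ (3 / 2 : ℝ) := by positivity
  rcases le_total |t| 1 with h | h
  · linarith
  · have : |t| ≤ |t| ^ (3 / 2 : ℝ) := by
      conv_lhs => rw [← Real.rpow_one |t|]
      exact Real.rpow_le_rpow_of_exponent_le h (by norm_num)
    linarith

lemma integrable_of_rpow_three_halves {α : Type*} [MeasurableSpace α] {μ : Measure α}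
    [IsProbabilityMeasure μ] {f : α → ℝ} (hf : AEStronglyMeasurable f μ)
    (hi : Integrable (fun x => |f x| ^ (3 / 2 : ℝ)) μ) : Integrable f μ :=
  ((integrable_const 1).add hi).mono' hf
    (Filter.Eventually.of_forall fun _ => abs_le_one_add_rpow_three_halves _)

lemma rpow_three_halves_integral_le {α : Type*} [MeasurableSpace α] {μ : Measure α}
    [IsProbabilityMeasure μ] {f : α → ℝ} (h0 : ∀ x, 0 ≤ f x) (hf : Integrable f μ)
    (hi : Integrable (fun x => f x ^ (3 / 2 : ℝ)) μ) :
    (∫ x, f x ∂μ) ^ (3 / 2 : ℝ) ≤ ∫ x, f x ^ (3 / 2 : ℝ) ∂μ := by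
  have hc : ConvexOn ℝ (Set.Ici 0) fun t : ℝ => t ^ (3 / 2 : ℝ) := convexOn_rpow (by norm_num)
  refine hc.map_integral_le ?_ isClosed_Ici (Filter.Eventually.of_forall h0) hf hi
  exact (Real.continuous_rpow_const (by norm_num)).continuousOn

lemma Real.sq_rpow_three_halves (t : ℝ) : (t ^ 2) ^ (3 / 2 : ℝ) = |t| ^ 3 := by
  rw [Real.rpow_three_halves (sq_nonneg t), Real.sqrt_sq_eq_abs, ← sq_abs]
  ring

/-! ### The linear term of the Hoeffding decomposition -/

namespace IncompleteU

open IidPi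

variable {n m : ℕ} {M : Type*} [MeasurableSpace M] {ν : Measure M} [IsProbabilityMeasure ν]

lemma memLp_two_of_cube {h : (Fin m → M) → ℝ} (hh : Measurable h)
    (h3 : Integrable (fun x => |h x| ^ 3) (prodLaw ν m)) : MemLp h 2 (prodLaw ν m) := by
  rw [memLp_two_iff_integrable_sq hh.aestronglyMeasurable]
  refine ((integrable_const 1).add h3).mono' (hh.pow_const 2).aestronglyMeasurable
    (Filter.Eventually.of_forall fun x => ?_)
  simp only [Pi.add_apply]
  rw [Real.norm_eq_abs, abs_of_nonneg (sq_nonneg _), ← sq_abs]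
  have := abs_nonneg (h x)
  nlinarith [mul_nonneg this (sq_nonneg (|h x| - 1)), sq_nonneg (|h x| - 1)]

lemma integral_sq_eq_sigmaSq {h : (Fin m → M) → ℝ} (hh : Measurable h) (h0 : mean ν h = 0) :
    ∫ x, h x ^ 2 ∂(prodLaw ν m) = sigmaSq ν h :=
  (variance_of_integral_eq_zero hh.aemeasurable h0).symm

lemma Psi1_eq (h : (Fin m → M) → ℝ) (hm : 0 < m) (x : M) :
    Psi1 ν h x = ∫ y, h (Function.update y ⟨0, hm⟩ x) ^ 2 ∂(prodLaw ν m) := by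
  rw [Psi1, condMean, mean]
  congr 1
  ext y
  congr 2
  ext i
  by_cases hi : i = ⟨0, hm⟩
  · subst hi; simp
  · have : ¬ (i : ℕ) < 1 := fun h => hi (Fin.ext (by simp; omega))
    rw [dif_neg this, Function.update_of_ne hi]

lemma Psi1_nonneg (h : (Fin m → M) → ℝ) (x : M) : 0 ≤ Psi1 ν h x :=
  integral_nonneg fun _ => sq_nonneg _

lemma measurable_Psi1 {h : (Fin m → M) → ℝ} (hh : Measurable h) : Measurable (Psi1 ν h) :=
  (measurable_condMean (hh.pow_const 2) 1).comp
    (measurable_pi_lambda (fun (x : M) (_ : Fin 1) => x) fun _ => measurable_id)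

lemma integral_Psi1 {h : (Fin m → M) → ℝ} (hh : Measurable h) (hm : 0 < m)
    (h3 : Integrable (fun x => |h x| ^ 3) (prodLaw ν m)) :
    ∫ x, Psi1 ν h x ∂ν = ∫ y, h y ^ 2 ∂(prodLaw ν m) := by
  have hmp := Bern.measurePreserving_update (I := Fin m) ν ⟨0, hm⟩
  have hi : Integrable (fun y => h y ^ 2) (prodLaw ν m) := (memLp_two_of_cube hh h3).integrable_sq
  have hi2 := hmp.integrable_comp_of_integrable hi
  simp_rw [Psi1_eq h hm]
  rw [← integral_prod_symm (fun q : (Fin m → M) × M => h (Function.update q.1 ⟨0, hm⟩ q.2) ^ 2) hi2]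
  conv_rhs => rw [show prodLaw ν m = _ from hmp.map_eq.symm]
  rw [integral_map hmp.measurable.aemeasurable (hh.pow_const 2).aestronglyMeasurable]

/-- Jensen's inequality in the other coordinates bounds Ψ₁(x)^{3/2} by the conditional mean of |h|³,
which is integrable by Fubini. -/
lemma integrable_Psi1_rpow {h : (Fin m → M) → ℝ} (hh : Measurable h) (hm : 0 < m)
    (h3 : Integrable (fun x => |h x| ^ 3) (prodLaw ν m)) :
    Integrable (fun x => Psi1 ν h x ^ (3 / 2 : ℝ)) ν := by
  have hmp := Bern.measurePreserving_update (I := Fin m) ν ⟨0, hm⟩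
  have hi : Integrable (fun y => h y ^ 2) (prodLaw ν m) := (memLp_two_of_cube hh h3).integrable_sq
  have hi2 := hmp.integrable_comp_of_integrable hi
  have hi3 := hmp.integrable_comp_of_integrable h3
  refine hi3.integral_prod_right.mono' ((measurable_Psi1 hh).pow_const _).aestronglyMeasurable ?_
  filter_upwards [hi2.prod_left_ae, hi3.prod_left_ae] with x hx2 hx3
  rw [Real.norm_eq_abs, abs_of_nonneg (Real.rpow_nonneg (Psi1_nonneg h x) _), Psi1_eq h hm]
  refine (rpow_three_halves_integral_le (fun _ => sq_nonneg _) hx2 ?_).trans_eq ?_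
  · exact hx3.congr (Filter.Eventually.of_forall fun y => (Real.sq_rpow_three_halves _).symm)
  · exact integral_congr_ae (Filter.Eventually.of_forall fun y => Real.sq_rpow_three_halves _)

/-- The linear term in the Hoeffding decomposition of `U_{h²} / σ²`. -/
def linearTerm (ν : Measure M) (h : (Fin m → M) → ℝ) (x : Fin n → M) : ℝ :=
  (m : ℝ) / n * (∑ i, (Psi1 ν h (x i) - sigmaSq ν h) / sigmaSq ν h)

lemma abs_sub_rpow_le {a b : ℝ} (ha : 0 ≤ a) (hb : 0 ≤ b) :
    |a - b| ^ (3 / 2 : ℝ) ≤ a ^ (3 / 2 : ℝ) + b ^ (3 / 2 : ℝ) := by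
  have h1 : 0 ≤ a ^ (3 / 2 : ℝ) := by positivity
  have h2 : 0 ≤ b ^ (3 / 2 : ℝ) := by positivity
  rcases le_total b a with h | h
  · have : |a - b| ^ (3 / 2 : ℝ) ≤ a ^ (3 / 2 : ℝ) :=
      Real.rpow_le_rpow (abs_nonneg _) (by rw [abs_of_nonneg (by linarith)]; linarith) (by norm_num)
    linarith
  · have : |a - b| ^ (3 / 2 : ℝ) ≤ b ^ (3 / 2 : ℝ) :=
      Real.rpow_le_rpow (abs_nonneg _) (by rw [abs_of_nonpos (by linarith)]; linarith) (by norm_num)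
    linarith

lemma sigma_pos {h : (Fin m → M) → ℝ} (hσ : 0 < sigmaSq ν h) : 0 < sigma ν h :=
  Real.sqrt_pos.2 hσ

lemma sigma_sq {h : (Fin m → M) → ℝ} (hσ : 0 < sigmaSq ν h) : sigma ν h ^ 2 = sigmaSq ν h :=
  Real.sq_sqrt hσ.le

lemma measurable_linearTerm {h : (Fin m → M) → ℝ} (hh : Measurable h) :
    Measurable (linearTerm ν h : (Fin n → M) → ℝ) :=
  (Finset.measurable_sum _ fun i _ => (((measurable_Psi1 hh).comp
    (measurable_pi_apply i)).sub_const _).div_const _).const_mul _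

/-- The von Bahr-Esseen inequality for n centred i.i.d. summands, with (m/n)^{3/2} n = m^{3/2}/√n.
The constant is 3·2: centring costs a factor 2, because (σ²)^{3/2} ≤ E[Ψ₁^{3/2}] by Jensen. -/
lemma linearTerm_bound {h : (Fin m → M) → ℝ} (hh : Measurable h) (hm : 0 < m) (hn : 0 < n)
    (h3 : Integrable (fun x => |h x| ^ 3) (prodLaw ν m)) (h0 : mean ν h = 0)
    (hσ : 0 < sigmaSq ν h) :
    Integrable (fun x : Fin n → M => |linearTerm ν h x| ^ (3 / 2 : ℝ)) (iid ν (Fin n)) ∧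
      ∫ x : Fin n → M, linearTerm ν h x ∂(iid ν (Fin n)) = 0 ∧
      ∫ x : Fin n → M, |linearTerm ν h x| ^ (3 / 2 : ℝ) ∂(iid ν (Fin n)) ≤
        6 * ((m : ℝ) ^ (3 / 2 : ℝ) * (∫ x, Psi1 ν h x ^ (3 / 2 : ℝ) ∂ν) /
          (Real.sqrt n * sigma ν h ^ 3)) := by
  have hΨm := measurable_Psi1 (ν := ν) hh
  have hΨi := integrable_Psi1_rpow (ν := ν) hh hm h3
  have hΨ0 := Psi1_nonneg (ν := ν) h
  have hΨ1 : Integrable (Psi1 ν h) ν := by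
    refine integrable_of_rpow_three_halves hΨm.aestronglyMeasurable ?_
    simp_rw [abs_of_nonneg (hΨ0 _)]
    exact hΨi
  have hΨE : ∫ x, Psi1 ν h x ∂ν = sigmaSq ν h := by
    rw [integral_Psi1 hh hm h3, integral_sq_eq_sigmaSq hh h0]
  have hjen := rpow_three_halves_integral_le hΨ0 hΨ1 hΨi
  rw [hΨE] at hjen
  set v := sigmaSq ν h
  set y : M → ℝ := fun x => (Psi1 ν h x - v) / v with hy
  have hym : Measurable y := (hΨm.sub_const _).div_const _
  have hyle : ∀ x, |y x| ^ (3 / 2 : ℝ) ≤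
      (Psi1 ν h x ^ (3 / 2 : ℝ) + v ^ (3 / 2 : ℝ)) / v ^ (3 / 2 : ℝ) := by
    intro x
    rw [hy, abs_div, abs_of_pos hσ, Real.div_rpow (abs_nonneg _) hσ.le]
    gcongr
    exact abs_sub_rpow_le (hΨ0 x) hσ.le
  have hbi : Integrable (fun x => (Psi1 ν h x ^ (3 / 2 : ℝ) + v ^ (3 / 2 : ℝ)) /
      v ^ (3 / 2 : ℝ)) ν := (hΨi.add (integrable_const _)).div_const _
  have hyi : Integrable (fun x => |y x| ^ (3 / 2 : ℝ)) ν := by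
    refine hbi.mono' (by fun_prop : Measurable _).aestronglyMeasurable
      (Filter.Eventually.of_forall fun x => ?_)
    rw [Real.norm_eq_abs, abs_of_nonneg (by positivity)]
    exact hyle x
  have hyE : ∫ x, |y x| ^ (3 / 2 : ℝ) ∂ν ≤
      2 * ((∫ x, Psi1 ν h x ^ (3 / 2 : ℝ) ∂ν) / v ^ (3 / 2 : ℝ)) := by
    refine (integral_mono hyi hbi hyle).trans ?_
    rw [integral_div, integral_add hΨi (integrable_const _)]
    simp only [integral_const, probReal_univ, smul_eq_mul, one_mul]
    rw [← mul_div_assoc]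
    gcongr
    linarith
  have hy0 : ∫ x, y x ∂ν = 0 := by
    rw [hy, integral_div, integral_sub hΨ1 (integrable_const _), hΨE]
    simp
  have hmp : ∀ i : Fin n, MeasurePreserving (fun x : Fin n → M => x i) (iid ν (Fin n)) ν :=
    fun i => measurePreserving_eval (fun _ : Fin n => ν) i
  have hind : iIndepFun (fun (i : Fin n) (x : Fin n → M) => y (x i)) (iid ν (Fin n)) :=
    iIndepFun_pi (μ := fun _ : Fin n => ν) (X := fun _ => y) fun _ => hym.aemeasurable
  have hcomp : ∀ {F : M → ℝ} (_ : Measurable F) (i : Fin n),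
      ∫ x : Fin n → M, F (x i) ∂(iid ν (Fin n)) = ∫ t, F t ∂ν := by
    intro F hF i
    conv_rhs => rw [← (hmp i).map_eq]
    rw [integral_map (hmp i).measurable.aemeasurable hF.aestronglyMeasurable]
  have hy32 : Measurable fun t => |y t| ^ (3 / 2 : ℝ) := by fun_prop
  obtain ⟨hS1, hS2⟩ := integral_abs_sum_rpow_three_halves_le
    (Y := fun (i : Fin n) (x : Fin n → M) => y (x i)) (P := iid ν (Fin n))
    (fun i => hym.comp (measurable_pi_apply i)) hind
    (fun i => (hmp i).integrable_comp_of_integrable hyi)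
    (fun i => by rw [hcomp hym i, hy0]) Finset.univ
  simp_rw [hcomp hy32] at hS2
  rw [Finset.sum_const, Finset.card_univ, Fintype.card_fin, nsmul_eq_mul] at hS2
  have hmn : (0 : ℝ) ≤ (m : ℝ) / n := by positivity
  have hL : ∀ x : Fin n → M, |linearTerm ν h x| ^ (3 / 2 : ℝ) =
      ((m : ℝ) / n) ^ (3 / 2 : ℝ) * |∑ i, y (x i)| ^ (3 / 2 : ℝ) := by
    intro x
    rw [linearTerm, abs_mul, Real.mul_rpow (abs_nonneg _) (abs_nonneg _), abs_of_nonneg hmn]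
  refine ⟨?_, ?_, ?_⟩
  · simp_rw [hL]; exact hS1.const_mul _
  · show ∫ x : Fin n → M, (m : ℝ) / n * ∑ i, y (x i) ∂(iid ν (Fin n)) = 0
    have hyint := integrable_of_rpow_three_halves hym.aestronglyMeasurable hyi
    have hyint2 : ∀ i, Integrable (fun x : Fin n → M => y (x i)) (iid ν (Fin n)) := fun i =>
      (hmp i).integrable_comp_of_integrable hyint
    rw [integral_const_mul, integral_finsetSum _ fun i _ => hyint2 i]
    simp_rw [hcomp hym, hy0]
    simp
  · simp_rw [hL]
    rw [integral_const_mul]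
    have hn0 : (0 : ℝ) < n := by exact_mod_cast hn
    have hv : v ^ (3 / 2 : ℝ) = sigma ν h ^ 3 := by
      rw [show v = sigma ν h ^ 2 from (sigma_sq hσ).symm, Real.sq_rpow_three_halves,
        abs_of_pos (sigma_pos hσ)]
    rw [hv] at hyE
    have hnn : (n : ℝ) ^ (3 / 2 : ℝ) = n * Real.sqrt n := Real.rpow_three_halves hn0.le
    have := sigma_pos hσ
    have hsn : 0 < Real.sqrt n := Real.sqrt_pos.2 hn0
    calc ((m : ℝ) / n) ^ (3 / 2 : ℝ) * ∫ x : Fin n → M, |∑ i, y (x i)| ^ (3 / 2 : ℝ) ∂(iid ν (Fin n))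
        ≤ ((m : ℝ) / n) ^ (3 / 2 : ℝ) * (3 * (n * (2 *
          ((∫ x, Psi1 ν h x ^ (3 / 2 : ℝ) ∂ν) / sigma ν h ^ 3)))) := by
          gcongr
          exact hS2.trans (by gcongr)
      _ = _ := by
          rw [Real.div_rpow (by positivity) hn0.le, hnn]
          field_simp
          ring

end IncompleteU

/-! ### The law of the samplers and the empty sample -/

namespace Bern

lemma measurable_ind : Measurable ind := Measurable.of_discrete

/-- The law of a real random variable with Bernoulli masses at `0` and `1`. -/
lemma map_eq_map_ind {Ω : Type*} [MeasurableSpace Ω] {P : Measure Ω} [IsProbabilityMeasure P]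
    {Z : Ω → ℝ} (hZ : Measurable Z) {p : ℝ} (hp : 0 ≤ p) (hp1 : p ≤ 1)
    (h1 : P.real {ω | Z ω = 1} = p) (h0 : P.real {ω | Z ω = 0} = 1 - p) :
    P.map Z = (law p).map ind := by
  have hρ : IsProbabilityMeasure (P.map Z) := Measure.isProbabilityMeasure_map hZ.aemeasurable
  have e1 : P.map Z {1} = ENNReal.ofReal p := by
    rw [Measure.map_apply hZ (measurableSet_singleton 1), ← h1, ofReal_measureReal]; rfl
  have e0 : P.map Z {0} = ENNReal.ofReal (1 - p) := by
    rw [Measure.map_apply hZ (measurableSet_singleton 0), ← h0, ofReal_measureReal]; rfl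
  have hd : Disjoint ({1} : Set ℝ) {0} := by simp
  have hall : P.map Z ({1} ∪ {0}) = 1 := by
    rw [measure_union hd (measurableSet_singleton 0), e1, e0, ← ENNReal.ofReal_add hp (by linarith)]
    simp
  have hae : ∀ᵐ t ∂(P.map Z), t ∈ ({1} ∪ {0} : Set ℝ) :=
    (mem_ae_iff_prob_eq_one ((measurableSet_singleton 1).union (measurableSet_singleton 0))).2 hall
  rw [← Measure.restrict_eq_self_of_ae_mem hae, Measure.restrict_union hd (measurableSet_singleton 0),
    Measure.restrict_singleton, Measure.restrict_singleton, e1, e0, law,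
    Measure.map_add _ _ measurable_ind, Measure.map_smul, Measure.map_smul,
    Measure.map_dirac' measurable_ind, Measure.map_dirac' measurable_ind]
  rfl

/-- With T trials the probability is (1 - N/T)^T ≤ e^{-N}, which is far below what is needed. -/
lemma prob_no_success_le {I : Type*} [Fintype I] {N : ℝ} (hN : 1 ≤ N)
    (hT : 0 < (Fintype.card I : ℝ)) (hp1 : N / Fintype.card I ≤ 1) :
    (trials I (N / Fintype.card I)).real {b | ∑ i, ind (b i) = 0} ≤ 1 / Real.sqrt N := by
  have hp0 : 0 ≤ N / (Fintype.card I : ℝ) := by positivity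
  have := isProbabilityMeasure_law hp0 hp1
  have := isProbabilityMeasure_trials (I := I) hp0 hp1
  have hsub : {b : I → Bool | ∑ i, ind (b i) = 0} ⊆ {fun _ => false} := by
    intro b hb
    have hb : ∑ i, ind (b i) = 0 := hb
    rw [Finset.sum_eq_zero_iff_of_nonneg fun i _ => by unfold ind; split_ifs <;> simp] at hb
    ext i
    have := hb i (Finset.mem_univ i)
    cases h : b i
    · rfl
    · simp [ind, h] at this
  have h1 : (trials I (N / Fintype.card I)).real {fun _ => false} =
      (1 - N / Fintype.card I) ^ (Fintype.card I) := by
    have hl : law (N / Fintype.card I) {false} = ENNReal.ofReal (1 - N / Fintype.card I) := by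
      simp [law]
    rw [Measure.real, Measure.pi_singleton]
    simp only [hl, Finset.prod_const, Finset.card_univ, ENNReal.toReal_pow]
    rw [ENNReal.toReal_ofReal (by linarith)]
  have h2 : (1 - N / (Fintype.card I : ℝ)) ^ (Fintype.card I) ≤ Real.exp (-N) := by
    have h3 : 1 - N / (Fintype.card I : ℝ) ≤ Real.exp (-(N / Fintype.card I)) := by
      have := Real.add_one_le_exp (-(N / (Fintype.card I : ℝ)))
      linarith
    refine (pow_le_pow_left₀ (by linarith) h3 _).trans_eq ?_
    rw [← Real.exp_nat_mul]
    congr 1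
    field_simp
  have h4 : Real.exp (-N) ≤ 1 / Real.sqrt N := by
    have hs : 0 < Real.sqrt N := Real.sqrt_pos.2 (by linarith)
    rw [Real.exp_neg, ← one_div]
    refine one_div_le_one_div_of_le hs ?_
    have h5 := Real.add_one_le_exp N
    have h6 : Real.sqrt N ≤ N + 1 := by
      rw [Real.sqrt_le_left (by linarith)]; nlinarith
    linarith
  calc _ ≤ (trials I (N / Fintype.card I)).real {fun _ => false} := measureReal_mono hsub
    _ ≤ _ := by rw [h1]; exact h2.trans h4

end Bern

/-! ### From the incomplete U-statistic to the conditional Bernoulli sum -/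

namespace IncompleteU

open IidPi Bern

variable {n m : ℕ} {M : Type*} [MeasurableSpace M] {ν : Measure M} [IsProbabilityMeasure ν]
  {Ω : Type*} [MeasurableSpace Ω] {P : Measure Ω} [IsProbabilityMeasure P]

lemma map_data {X : Fin n → Ω → M} (hX : ∀ i, Measurable (X i)) (hXν : ∀ i, P.map (X i) = ν)
    (hXi : iIndepFun X P) : P.map (fun ω i => X i ω) = iid ν (Fin n) := by
  rw [iIndepFun.map_fun_eq_pi_map (fun i => (hX i).aemeasurable) hXi]
  simp_rw [hXν]

/-- The joint law of the data and the samplers. -/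
lemma map_data_samplers {X : Fin n → Ω → M} {Z : Idx n m → Ω → ℝ} {p : ℝ} (hp : 0 ≤ p)
    (hp1 : p ≤ 1) (hX : ∀ i, Measurable (X i)) (hXν : ∀ i, P.map (X i) = ν) (hXi : iIndepFun X P)
    (hZ : ∀ i, Measurable (Z i)) (hZ1 : ∀ i, P.real {ω | Z i ω = 1} = p)
    (hZ0 : ∀ i, P.real {ω | Z i ω = 0} = 1 - p) (hZi : iIndepFun Z P)
    (hXZ : IndepFun (fun ω i => X i ω) (fun ω i => Z i ω) P) :
    P.map (fun ω => ((fun i => X i ω), (fun i => Z i ω))) =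
      (iid ν (Fin n)).prod ((trials (Idx n m) p).map fun b i => ind (b i)) := by
  have := isProbabilityMeasure_law hp hp1
  have : IsProbabilityMeasure ((law p).map ind) :=
    Measure.isProbabilityMeasure_map measurable_ind.aemeasurable
  rw [(indepFun_iff_map_prod_eq_prod_map_map (measurable_pi_lambda _ hX).aemeasurable
    (measurable_pi_lambda _ hZ).aemeasurable).1 hXZ, map_data hX hXν hXi,
    iIndepFun.map_fun_eq_pi_map (fun i => (hZ i).aemeasurable) hZi]
  congr 1
  rw [Measure.pi_map_pi (μ := fun _ : Idx n m => law p) (f := fun _ => ind)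
    fun _ => measurable_ind.aemeasurable]
  congr 1
  ext1 i
  exact map_eq_map_ind (hZ i) hp hp1 (hZ1 i) (hZ0 i)

/-- The event that the studentized statistic is at most `z`, in terms of data and samplers. -/
def tailEvent (n N : ℕ) (σ : ℝ) (h : (Fin m → M) → ℝ) (z : ℝ) :
    Set ((Fin n → M) × (Idx n m → ℝ)) :=
  {q | Real.sqrt N * ((∑ i, q.2 i * h (fun k => q.1 (i k))) / ∑ i, q.2 i) / σ ≤ z}

lemma measurableSet_tailEvent (N : ℕ) (σ : ℝ) {h : (Fin m → M) → ℝ} (hh : Measurable h) (z : ℝ) :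
    MeasurableSet (tailEvent n N σ h z) := by
  have h2 : ∀ i : Idx n m, Measurable fun q : (Fin n → M) × (Idx n m → ℝ) => q.2 i := fun i =>
    (measurable_pi_apply i).comp measurable_snd
  have h3 : ∀ i : Idx n m, Measurable fun q : (Fin n → M) × (Idx n m → ℝ) =>
      h (fun k => q.1 (i k)) := fun i =>
    hh.comp ((measurable_reindex (i : Fin m → Fin n)).comp measurable_fst)
  exact measurableSet_le ((((Finset.measurable_sum _ fun i _ => (h2 i).mul (h3 i)).div
    (Finset.measurable_sum _ fun i _ => h2 i)).const_mul _).div_const _) measurable_const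

/-- Multiplying by a positive random sample size makes the event linear in the samplers. The two
events can differ only when no tuple is sampled. -/
lemma abs_prob_tailEvent_sub_le {N : ℕ} (hN : 1 ≤ N) (hmn : m ≤ n) (hNn : N ≤ n.choose m) (σ : ℝ)
    (h : (Fin m → M) → ℝ) (z : ℝ) (x : Fin n → M) :
    |(trials (Idx n m) (sampProb n m N)).real
        {b | ((x, fun i => ind (b i)) : (Fin n → M) × (Idx n m → ℝ)) ∈ tailEvent n N σ h z} -
      (trials (Idx n m) (sampProb n m N)).real
        {b | ∑ i, ind (b i) * (Real.sqrt N * (h (fun k => x (i k)) / σ) - z) ≤ 0}| ≤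
      1 / Real.sqrt N := by
  have hc : (0 : ℝ) < n.choose m := by exact_mod_cast Nat.choose_pos hmn
  have hN1 : (1 : ℝ) ≤ N := by exact_mod_cast hN
  have hp1 : (N : ℝ) / n.choose m ≤ 1 := by
    rw [div_le_one hc]; exact_mod_cast hNn
  have hno := prob_no_success_le (I := Idx n m) hN1 (by rw [card_idx]; exact hc)
    (by rw [card_idx]; exact hp1)
  rw [card_idx] at hno
  have hprob := isProbabilityMeasure_trials (I := Idx n m)
    (p := sampProb n m N) (by unfold sampProb; positivity) hp1
  refine (abs_measureReal_sub_le_measureReal_symmDiff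
    (Set.toFinite _).measurableSet.nullMeasurableSet
    (Set.toFinite _).measurableSet.nullMeasurableSet).trans ((measureReal_mono ?_).trans hno)
  intro b hb
  by_contra hcon
  have hnn : 0 ≤ ∑ i, ind (b i) := Finset.sum_nonneg fun i _ => by unfold ind; split_ifs <;> simp
  have hpos : 0 < ∑ i, ind (b i) := lt_of_le_of_ne hnn fun h => hcon h.symm
  have hiff : Real.sqrt N * ((∑ i, ind (b i) * h (fun k => x (i k))) / ∑ i, ind (b i)) / σ ≤ z ↔
      ∑ i, ind (b i) * (Real.sqrt N * (h (fun k => x (i k)) / σ) - z) ≤ 0 := by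
    have e : ∑ i, ind (b i) * (Real.sqrt N * (h (fun k => x (i k)) / σ) - z) =
        Real.sqrt N * (∑ i, ind (b i) * h (fun k => x (i k))) / σ - z * ∑ i, ind (b i) := by
      rw [Finset.mul_sum, Finset.sum_div, Finset.mul_sum, ← Finset.sum_sub_distrib]
      exact Finset.sum_congr rfl fun i _ => by ring
    rw [e, sub_nonpos, ← mul_div_assoc, div_right_comm, div_le_iff₀ hpos]
  rcases hb with ⟨h1, h2⟩ | ⟨h1, h2⟩
  · exact h2 (hiff.1 h1)
  · exact h2 (hiff.2 h1)

/-- The deterministic error terms besides those of the Hoeffding decomposition. -/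
def baseError (ν : Measure M) (h : (Fin m → M) → ℝ) (n N : ℕ) : ℝ :=
  2 * (mean ν (fun x => |h x| ^ 3) / sigma ν h ^ 3) / Real.sqrt N +
    2 * Real.sqrt ((N : ℝ) * Kconst n m (rank ν h))

/-- Integration of t³ ≥ (3/2) σ t² - σ³/2 at t = |h|; the difference is (t + σ/2)(t - σ)². It lets
every bare 1/√N be absorbed into the third moment term. -/
lemma one_le_mean_cube {h : (Fin m → M) → ℝ} (hh : Measurable h)
    (h3 : Integrable (fun x => |h x| ^ 3) (prodLaw ν m)) (h0 : mean ν h = 0)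
    (hσ : 0 < sigmaSq ν h) : 1 ≤ mean ν (fun x => |h x| ^ 3) / sigma ν h ^ 3 := by
  have hs := sigma_pos hσ
  have h2 : Integrable (fun x => h x ^ 2) (prodLaw ν m) := (memLp_two_of_cube hh h3).integrable_sq
  have hpt : ∀ x, 3 / 2 * sigma ν h * h x ^ 2 - 1 / 2 * sigma ν h ^ 3 ≤ |h x| ^ 3 := by
    intro x
    rw [← sq_abs]
    have := abs_nonneg (h x)
    nlinarith [mul_nonneg (show 0 ≤ |h x| + 1 / 2 * sigma ν h by linarith)
      (sq_nonneg (|h x| - sigma ν h))]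
  have := integral_mono ((h2.const_mul (3 / 2 * sigma ν h)).sub (integrable_const _)) h3 hpt
  simp only [Pi.sub_apply] at this
  rw [integral_sub (h2.const_mul _) (integrable_const _), integral_const_mul,
    integral_sq_eq_sigmaSq hh h0, ← sigma_sq hσ] at this
  simp only [integral_const, probReal_univ, smul_eq_mul, one_mul] at this
  rw [one_le_div (by positivity), mean]
  linarith

lemma integral_abs_le_sqrt {α : Type*} [MeasurableSpace α] {μ : Measure α}
    [IsProbabilityMeasure μ] {f : α → ℝ} (hf : MemLp f 2 μ) :
    ∫ x, |f x| ∂μ ≤ Real.sqrt (∫ x, f x ^ 2 ∂μ) := by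
  refine Real.le_sqrt_of_sq_le ?_
  have h := variance_nonneg (fun x => |f x|) μ
  have hf' : MemLp (fun x => |f x|) 2 μ := hf.norm
  rw [variance_eq_sub hf'] at h
  simp only [Pi.pow_apply, sq_abs] at h
  linarith

lemma memLp_average {f : (Fin m → M) → ℝ} {q : ENNReal} (hf : MemLp f q (prodLaw ν m)) (c : ℝ) :
    MemLp (fun x : Fin n → M => (∑ i : Idx n m, f (fun k => x (i k))) / c) q (iid ν (Fin n)) := by
  have h1 : MemLp (fun x : Fin n → M => ∑ i : Idx n m, f (fun k => x (i k))) q (iid ν (Fin n)) :=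
    memLp_finsetSum _ fun i _ => memLp_reindex hf i.injective
  simpa [div_eq_inv_mul] using h1.const_mul c⁻¹

lemma integral_average {f : (Fin m → M) → ℝ} (hf : Integrable f (prodLaw ν m)) (hmn : m ≤ n) :
    ∫ x : Fin n → M, (∑ i : Idx n m, f (fun k => x (i k))) / (n.choose m : ℝ) ∂(iid ν (Fin n)) =
      ∫ x, f x ∂(prodLaw ν m) := by
  have hc : (0 : ℝ) < n.choose m := by exact_mod_cast Nat.choose_pos hmn
  have hi : ∀ i : Idx n m, Integrable (fun x : Fin n → M => f (fun k => x (i k)))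
      (iid ν (Fin n)) := fun i =>
    (measurePreserving_reindex ν i.injective).integrable_comp_of_integrable hf
  rw [integral_div, integral_finsetSum _ fun i _ => hi i]
  have : ∀ i : Idx n m, ∫ x : Fin n → M, f (fun k => x (i k)) ∂(iid ν (Fin n)) =
      ∫ x, f x ∂(prodLaw ν m) := by
    intro i
    have hmp := measurePreserving_reindex ν i.injective
    have e : prodLaw ν m = _ := hmp.map_eq.symm
    have hfm := hf.aestronglyMeasurable
    rw [e] at hfm
    rw [e, integral_map hmp.measurable.aemeasurable hfm]
  simp_rw [this]
  rw [Finset.sum_const, Finset.card_univ, card_idx, nsmul_eq_mul]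
  field_simp

end IncompleteU

/-! ### Integrating out the data -/

namespace IncompleteU

open IidPi Bern

variable {n m : ℕ} {M : Type*} [MeasurableSpace M] {ν : Measure M} [IsProbabilityMeasure ν]
  {Ω : Type*} [MeasurableSpace Ω] {P : Measure Ω} [IsProbabilityMeasure P]

/-- Cauchy-Schwarz and the variance bound for the complete U-statistic, with covariances vanishing
below the rank. -/
lemma integral_abs_average_le {h : (Fin m → M) → ℝ} (hh : Measurable h)
    (hs : ∀ (τ : Equiv.Perm (Fin m)) (x : Fin m → M), h (fun k => x (τ k)) = h x)
    (h3 : Integrable (fun x => |h x| ^ 3) (prodLaw ν m)) (h0 : mean ν h = 0)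
    (hσ : 0 < sigmaSq ν h) (hm : 1 ≤ m) (hmn : m ≤ n) :
    ∫ x : Fin n → M, |(∑ i : Idx n m, h (fun k => x (i k)) / sigma ν h) / (n.choose m : ℝ)|
      ∂(iid ν (Fin n)) ≤ Real.sqrt (Kconst n m (rank ν h)) := by
  have hh2 := memLp_two_of_cube hh h3
  have hg2 : MemLp (fun x => h x / sigma ν h) 2 (prodLaw ν m) := by
    simpa [div_eq_inv_mul] using hh2.const_mul (sigma ν h)⁻¹
  refine (integral_abs_le_sqrt (memLp_average hg2 _)).trans (Real.sqrt_le_sqrt ?_)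
  have hb := integral_average_sq_le (n := n) hh hh2 hs h0 hm hmn (rank_mem hm hσ).1
    (overlap_eq_zero_of_card_lt_rank hh hh2 hs h0 hm hσ)
  have e : ∀ x : Fin n → M,
      ((∑ i : Idx n m, h (fun k => x (i k)) / sigma ν h) / (n.choose m : ℝ)) ^ 2 =
      ((∑ i : Idx n m, h (fun k => x (i k))) / (n.choose m : ℝ)) ^ 2 / sigmaSq ν h := by
    intro x
    rw [← sigma_sq hσ, ← div_pow, ← Finset.sum_div, div_right_comm]
  simp_rw [e]
  rw [integral_div, div_le_iff₀ hσ]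
  rwa [integral_sq_eq_sigmaSq hh h0] at hb

/-- The normal approximation at moderate levels `z`, given a decomposition of `U_{h²} / σ²` with a
centred first term. -/
lemma abs_cdf_sub_Phi_le {N : ℕ} {h : (Fin m → M) → ℝ} {X : Fin n → Ω → M}
    {Z : Idx n m → Ω → ℝ} (hm : 1 ≤ m) (hmn : m ≤ n) (hN : 1 ≤ N) (hNn : N ≤ n.choose m)
    (hh : Measurable h)
    (hs : ∀ (τ : Equiv.Perm (Fin m)) (x : Fin m → M), h (fun k => x (τ k)) = h x)
    (hX : ∀ i, Measurable (X i)) (hXν : ∀ i, P.map (X i) = ν) (hXi : iIndepFun X P)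
    (hZ : ∀ i, Measurable (Z i)) (hZ1 : ∀ i, P.real {ω | Z i ω = 1} = sampProb n m N)
    (hZ0 : ∀ i, P.real {ω | Z i ω = 0} = 1 - sampProb n m N) (hZi : iIndepFun Z P)
    (hXZ : IndepFun (fun ω i => X i ω) (fun ω i => Z i ω) P)
    (h3 : Integrable (fun x => |h x| ^ 3) (prodLaw ν m)) (h0 : mean ν h = 0)
    (hσ : 0 < sigmaSq ν h) {L R : (Fin n → M) → ℝ} (hL : Integrable L (iid ν (Fin n)))
    (hL0 : ∫ x, L x ∂(iid ν (Fin n)) = 0)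
    (hL32 : Integrable (fun x => |L x| ^ (3 / 2 : ℝ)) (iid ν (Fin n)))
    (hR : Integrable R (iid ν (Fin n)))
    (hLR : ∀ x, (∑ i : Idx n m, h (fun k => x (i k)) ^ 2 / sigmaSq ν h) / (n.choose m : ℝ) =
      1 + L x + R x) {z : ℝ} (hz : z ^ 2 ≤ Real.sqrt N) :
    |P.real {ω | Real.sqrt N * incompleteU h X Z ω / sigma ν h ≤ z} - Gauss.Phi z| ≤
      1001 * (baseError ν h n N + ∫ x, |L x| ^ (3 / 2 : ℝ) ∂(iid ν (Fin n)) +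
        ∫ x, |R x| ∂(iid ν (Fin n))) := by
  have hc : (0 : ℝ) < n.choose m := by exact_mod_cast Nat.choose_pos hmn
  have hN1 : (1 : ℝ) ≤ N := by exact_mod_cast hN
  have hp0 : 0 ≤ sampProb n m N := by unfold sampProb; positivity
  have hp1 : sampProb n m N ≤ 1 := by
    unfold sampProb; rw [div_le_one hc]; exact_mod_cast hNn
  have hprob := isProbabilityMeasure_trials (I := Idx n m) hp0 hp1
  have hsig := sigma_pos hσ
  have hsN : 0 < Real.sqrt N := Real.sqrt_pos.2 (by linarith)
  set μ := iid ν (Fin n) with hμ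
  set Q := trials (Idx n m) (sampProb n m N) with hQ
  have hvm : Measurable fun (b : Idx n m → Bool) i => ind (b i) := Measurable.of_discrete
  have hQ' : IsProbabilityMeasure (Q.map fun b i => ind (b i)) :=
    Measure.isProbabilityMeasure_map hvm.aemeasurable
  set E := tailEvent n N (sigma ν h) h z
  have hE : MeasurableSet E := measurableSet_tailEvent N (sigma ν h) hh z
  -- The conditional probability of the event given the data x; its integral is the unconditional
  -- probability.
  set G : (Fin n → M) → ℝ := fun x =>
    Q.real {b | ((x, fun i => ind (b i)) : (Fin n → M) × (Idx n m → ℝ)) ∈ E} with hG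
  have hGeq : ∀ x, ((Q.map fun b i => ind (b i)) (Prod.mk x ⁻¹' E)).toReal = G x := by
    intro x
    rw [Measure.map_apply hvm (measurable_prodMk_left hE)]
    rfl
  have hGm : Measurable G := by
    have : G = fun x => ((Q.map fun b i => ind (b i)) (Prod.mk x ⁻¹' E)).toReal :=
      funext fun x => (hGeq x).symm
    rw [this]
    exact (measurable_measure_prodMk_left hE).ennreal_toReal
  have hPE : P.real {ω | Real.sqrt N * incompleteU h X Z ω / sigma ν h ≤ z} = ∫ x, G x ∂μ := by
    have hm : Measurable fun ω => ((fun i => X i ω), (fun i => Z i ω)) :=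
      (measurable_pi_lambda _ hX).prodMk (measurable_pi_lambda _ hZ)
    have e1 : P {ω | Real.sqrt N * incompleteU h X Z ω / sigma ν h ≤ z} =
        P.map (fun ω => ((fun i => X i ω), (fun i => Z i ω))) E := by
      rw [Measure.map_apply hm hE]; rfl
    rw [Measure.real, e1, map_data_samplers hp0 hp1 hX hXν hXi hZ hZ1 hZ0 hZi hXZ,
      Measure.prod_apply hE]
    simp_rw [← hGeq]
    rw [integral_toReal (measurable_measure_prodMk_left hE).aemeasurable
      (Filter.Eventually.of_forall fun x => measure_lt_top _ _)]
  have hG1 : ∀ x, |G x| ≤ 1 := fun x => by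
    rw [abs_of_nonneg measureReal_nonneg]; exact measureReal_le_one
  have hGi : Integrable G μ :=
    (integrable_const (1 : ℝ)).mono' hGm.aestronglyMeasurable (Filter.Eventually.of_forall hG1)
  -- the pointwise bound
  set c := z * Gauss.pdf z
  set A1 : (Fin n → M) → ℝ := fun x =>
    (∑ i : Idx n m, h (fun k => x (i k)) / sigma ν h) / (n.choose m : ℝ) with hA1
  set A3 : (Fin n → M) → ℝ := fun x =>
    (∑ i : Idx n m, |h (fun k => x (i k)) / sigma ν h| ^ 3) / (n.choose m : ℝ) with hA3
  have tri : ∀ {a b d e s t : ℝ}, |a - b| ≤ s → |b - d + e| ≤ t → |a - d + e| ≤ s + t := by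
    intro a b d e s t hs ht
    have := abs_add_le (a - b) (b - d + e)
    rw [show a - b + (b - d + e) = a - d + e by ring] at this
    linarith
  have hpt : ∀ x, |G x - Gauss.Phi z + L x / 2 * c| ≤ 1 / Real.sqrt N +
      1000 * ((1 + A3 x) / Real.sqrt N + Real.sqrt N * |A1 x| + |L x| ^ (3 / 2 : ℝ) + |R x| +
        sampProb n m N) := by
    intro x
    have h1 := abs_prob_tailEvent_sub_le hN hmn hNn (sigma ν h) h z x
    have h2 := abs_prob_sub_Phi_le (I := Idx n m) hN1 (by rw [card_idx]; exact hc)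
      (by rw [card_idx]; exact hp1) (fun i => h (fun k => x (i k)) / sigma ν h)
      (L := L x) (R := R x) (by
        rw [card_idx, ← hLR]
        simp_rw [div_pow, sigma_sq hσ]) hz
    rw [card_idx] at h2
    exact tri h1 h2
  -- integrability of the bound
  have hh2 := memLp_two_of_cube hh h3
  have hg3 : Integrable (fun x => |h x / sigma ν h| ^ 3) (prodLaw ν m) := by
    have : ∀ x, |h x / sigma ν h| ^ 3 = |h x| ^ 3 / sigma ν h ^ 3 := fun x => by
      rw [abs_div, abs_of_pos hsig, div_pow]
    simp_rw [this]
    exact h3.div_const _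
  have hA3i : Integrable A3 μ :=
    memLp_one_iff_integrable.1 (memLp_average (memLp_one_iff_integrable.2 hg3) _)
  have hA3E : ∫ x, A3 x ∂μ = mean ν (fun x => |h x| ^ 3) / sigma ν h ^ 3 := by
    rw [hA3, integral_average hg3 hmn, mean, ← integral_div]
    refine integral_congr_ae (Filter.Eventually.of_forall fun x => ?_)
    simp only
    rw [abs_div, abs_of_pos hsig, div_pow]
  have hg2 : MemLp (fun x => h x / sigma ν h) 2 (prodLaw ν m) := by
    simpa [div_eq_inv_mul] using hh2.const_mul (sigma ν h)⁻¹
  have hA1i : Integrable (fun x => |A1 x|) μ :=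
    ((memLp_average hg2 _).integrable (by norm_num)).abs
  have hA1E := integral_abs_average_le (n := n) hh hs h3 h0 hσ hm hmn
  have i1 : Integrable (fun x => (1 + A3 x) / Real.sqrt N) μ :=
    ((integrable_const 1).add hA3i).div_const _
  have i2 : Integrable (fun x => (1 + A3 x) / Real.sqrt N + Real.sqrt N * |A1 x|) μ :=
    i1.add (hA1i.const_mul _)
  have i3 : Integrable (fun x => (1 + A3 x) / Real.sqrt N + Real.sqrt N * |A1 x| +
      |L x| ^ (3 / 2 : ℝ)) μ := i2.add hL32
  have i4 : Integrable (fun x => (1 + A3 x) / Real.sqrt N + Real.sqrt N * |A1 x| +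
      |L x| ^ (3 / 2 : ℝ) + |R x|) μ := i3.add hR.abs
  have i5 : Integrable (fun x => (1 + A3 x) / Real.sqrt N + Real.sqrt N * |A1 x| +
      |L x| ^ (3 / 2 : ℝ) + |R x| + sampProb n m N) μ := i4.add (integrable_const _)
  have iG : Integrable (fun x => G x - Gauss.Phi z) μ := hGi.sub (integrable_const _)
  have iL : Integrable (fun x => L x / 2 * c) μ := (hL.div_const 2).mul_const c
  -- The first order effect of L vanishes because L is centred. The correction is therefore kept
  -- inside the absolute value until after integration.
  have hmain : ∫ x, (G x - Gauss.Phi z + L x / 2 * c) ∂μ = ∫ x, G x ∂μ - Gauss.Phi z := by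
    rw [integral_add iG iL, integral_sub hGi (integrable_const _), integral_mul_const,
      integral_div, hL0]
    simp
  have hbound := (abs_integral_le_integral_abs (f := fun x => G x - Gauss.Phi z + L x / 2 * c)
    (μ := μ)).trans (integral_mono (iG.add iL).abs
      ((integrable_const (1 / Real.sqrt N)).add (i5.const_mul 1000)) hpt)
  simp only [Pi.add_apply] at hbound
  have hA3' : ∫ x, (1 + A3 x) / Real.sqrt N ∂μ =
      (1 + mean ν (fun x => |h x| ^ 3) / sigma ν h ^ 3) / Real.sqrt N := by
    rw [integral_div, integral_add (integrable_const _) hA3i, hA3E]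
    simp
  rw [hmain, integral_add (integrable_const _) (i5.const_mul 1000), integral_const_mul,
    integral_add i4 (integrable_const _), integral_add i3 hR.abs, integral_add i2 hL32,
    integral_add i1 (hA1i.const_mul _), integral_const_mul, hA3'] at hbound
  simp only [integral_const, probReal_univ, smul_eq_mul, one_mul] at hbound
  rw [hPE]
  refine hbound.trans ?_
  -- comparison with the error terms
  set ρ := mean ν (fun x => |h x| ^ 3) / sigma ν h ^ 3 with hρ
  have hρ1 : 1 ≤ ρ := one_le_mean_cube hh h3 h0 hσ
  set K := Kconst n m (rank ν h) with hK
  have hKT : 1 ≤ (n.choose m : ℝ) * K := one_le_choose_mul_Kconst (rank_mem hm hσ).2 hmn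
  have hpK : sampProb n m N ≤ N * K := by
    unfold sampProb
    rw [div_le_iff₀ hc]
    have : (N : ℝ) * 1 ≤ N * ((n.choose m : ℝ) * K) := by gcongr
    linarith
  -- Since p ≤ 1, p² ≤ p ≤ N K.
  have hpsq : sampProb n m N ≤ Real.sqrt (N * K) := by
    refine Real.le_sqrt_of_sq_le (le_trans ?_ hpK)
    exact pow_le_of_le_one hp0 hp1 two_ne_zero
  have hA1' : Real.sqrt N * ∫ x, |A1 x| ∂μ ≤ Real.sqrt (N * K) := by
    rw [Real.sqrt_mul (by positivity)]
    exact mul_le_mul_of_nonneg_left hA1E hsN.le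
  have e1 : (1 + ρ) / Real.sqrt N ≤ 2 * ρ / Real.sqrt N := by gcongr; linarith
  have e2 : 1 / Real.sqrt N ≤ 2 * ρ / Real.sqrt N := by gcongr; linarith
  have e3 : 0 ≤ ∫ x, |L x| ^ (3 / 2 : ℝ) ∂μ := integral_nonneg fun x => by positivity
  have e4 : 0 ≤ ∫ x, |R x| ∂μ := integral_nonneg fun x => abs_nonneg _
  have e5 : 0 ≤ Real.sqrt (N * K) := Real.sqrt_nonneg _
  have e6 : baseError ν h n N = 2 * ρ / Real.sqrt N + 2 * Real.sqrt (N * K) := rfl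
  rw [e6]
  linarith

/-- A bound at moderate levels extends to all levels by monotonicity. -/
lemma kolmogorovDist_le {Y : Ω → ℝ} {N B : ℝ} (hN : 1 ≤ N)
    (hB : ∀ z : ℝ, z ^ 2 ≤ Real.sqrt N → |P.real {ω | Y ω ≤ z} - Gauss.Phi z| ≤ B) :
    kolmogorovDist P Y ≤ B + 1 / Real.sqrt N := by
  have hs : 0 < Real.sqrt N := Real.sqrt_pos.2 (by linarith)
  -- The edge N^{1/4} of the moderate range, where the tail bound 1/w² is 1/√N.
  set w := Real.sqrt (Real.sqrt N) with hw
  have hw2 : w ^ 2 = Real.sqrt N := Real.sq_sqrt hs.le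
  have hw0 : 0 < w := Real.sqrt_pos.2 hs
  have htail := Gauss.Phi_neg_le hw0
  rw [hw2] at htail
  have htail' : 1 - Gauss.Phi w ≤ 1 / Real.sqrt N := by rwa [Gauss.Phi_neg] at htail
  have hmono : ∀ {s t : ℝ}, s ≤ t → P.real {ω | Y ω ≤ s} ≤ P.real {ω | Y ω ≤ t} := fun hst =>
    measureReal_mono fun ω hω => le_trans (show Y ω ≤ _ from hω) hst
  have h1 := abs_le.1 (hB w hw2.le)
  have h2 := abs_le.1 (hB (-w) (by rw [neg_sq]; exact hw2.le))
  have hB0 : 0 ≤ B := (abs_nonneg _).trans (hB w hw2.le)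
  refine ciSup_le fun z => ?_
  show |P.real {ω | Y ω ≤ z} - Gauss.Phi z| ≤ _
  have p1 : P.real {ω | Y ω ≤ z} ≤ 1 := measureReal_le_one
  have p0 : 0 ≤ P.real {ω | Y ω ≤ z} := measureReal_nonneg
  have q1 := Gauss.Phi_le_one z
  have q0 := Gauss.Phi_nonneg z
  have r0 : 0 ≤ 1 / Real.sqrt N := by positivity
  rcases le_or_gt (z ^ 2) (Real.sqrt N) with hz | hz
  · linarith [hB z hz]
  · rw [← hw2, sq_lt_sq, abs_of_pos hw0, lt_abs] at hz
    rcases hz with hz | hz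
    · have a1 := hmono hz.le
      have a2 := Gauss.Phi_mono hz.le
      rw [abs_le]; constructor <;> linarith
    · have hz' : z ≤ -w := by linarith
      have a1 := hmono hz'
      have a2 := Gauss.Phi_mono hz'
      rw [abs_le]; constructor <;> linarith

/-- Uses 1 - 2p + 2p² ≥ 1/2 and 1 - p ≤ 1; the exponential in `B1` is positive and is simply
dropped. -/
lemma baseError_le {N : ℕ} {h : (Fin m → M) → ℝ} (hmn : m ≤ n) (hN : 1 ≤ N)
    (hNn : N < n.choose m) (hσ : 0 < sigmaSq ν h) :
    baseError ν h n N ≤ 4 * (B1 ν h n N +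
      Real.sqrt ((N : ℝ) * Kconst n m (rank ν h)) / Real.sqrt (1 - sampProb n m N)) := by
  have hc : (0 : ℝ) < n.choose m := by exact_mod_cast Nat.choose_pos hmn
  have hN0 : (0 : ℝ) < N := by exact_mod_cast hN
  have hp0 : 0 ≤ sampProb n m N := by unfold sampProb; positivity
  have hp1 : sampProb n m N < 1 := by
    unfold sampProb; rw [div_lt_one hc]; exact_mod_cast hNn
  set p := sampProb n m N
  have hsig := sigma_pos hσ
  have hβ : 0 ≤ mean ν (fun x => |h x| ^ 3) := integral_nonneg fun x => by positivity
  have h1 : Real.sqrt (N * (1 - p)) ≤ Real.sqrt N := Real.sqrt_le_sqrt (by nlinarith)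
  have h1' : 0 < Real.sqrt (N * (1 - p)) := Real.sqrt_pos.2 (mul_pos hN0 (by linarith))
  have h2 : Real.sqrt (1 - p) ≤ 1 := Real.sqrt_le_one.2 (by linarith)
  have h2' : 0 < Real.sqrt (1 - p) := Real.sqrt_pos.2 (by linarith)
  have h3 : mean ν (fun x => |h x| ^ 3) / sigma ν h ^ 3 / Real.sqrt N ≤ 2 * B1 ν h n N := by
    have e : mean ν (fun x => |h x| ^ 3) * (1 / 2) / (Real.sqrt N * sigma ν h ^ 3) ≤
        mean ν (fun x => |h x| ^ 3) * (1 - 2 * p + 2 * p ^ 2) /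
          (Real.sqrt (N * (1 - p)) * sigma ν h ^ 3) := by
      have hq : 1 / 2 ≤ 1 - 2 * p + 2 * p ^ 2 := by
        linear_combination 1 / 2 * sq_nonneg (2 * p - 1)
      gcongr
    have e2 := Real.exp_pos (-((n : ℝ) * sigma ν h ^ 6) /
      (24 * (m : ℝ) * mean ν (fun x => |h x| ^ 3) ^ 2))
    have e3 : mean ν (fun x => |h x| ^ 3) / sigma ν h ^ 3 / Real.sqrt N =
        2 * (mean ν (fun x => |h x| ^ 3) * (1 / 2) / (Real.sqrt N * sigma ν h ^ 3)) := by
      field_simp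
    rw [e3, B1]
    linarith
  have h4 : Real.sqrt ((N : ℝ) * Kconst n m (rank ν h)) ≤
      Real.sqrt ((N : ℝ) * Kconst n m (rank ν h)) / Real.sqrt (1 - p) := by
    rw [le_div_iff₀ h2']
    exact mul_le_of_le_one_right (Real.sqrt_nonneg _) h2
  have h5 : 0 ≤ Real.sqrt ((N : ℝ) * Kconst n m (rank ν h)) / Real.sqrt (1 - p) := by positivity
  rw [baseError, mul_div_assoc]
  linarith

end IncompleteU

/-! ### The degenerate remainder and the fourth moment case -/

namespace IncompleteU

open IidPi Bern

variable {n m : ℕ} {M : Type*} [MeasurableSpace M] {ν : Measure M} [IsProbabilityMeasure ν]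
  {Ω : Type*} [MeasurableSpace Ω] {P : Measure Ω} [IsProbabilityMeasure P]

lemma measurable_average {f : (Fin m → M) → ℝ} (hf : Measurable f) (c : ℝ) :
    Measurable fun x : Fin n → M => (∑ i : Idx n m, f (fun k => x (i k))) / c := by
  have : ∀ i : Idx n m, Measurable fun x : Fin n → M => f (fun k => x (i k)) := fun i =>
    hf.comp (measurable_reindex (i : Fin m → Fin n))
  fun_prop

/-- Expressed this way, the remainder inherits measurability and its 3/2 moment from U_{h²} and the
linear term, without any study of the higher kernels. -/
lemma remainder_eq (h : (Fin m → M) → ℝ) (hm : 1 ≤ m) (hmn : m ≤ n) (hσ : 0 < sigmaSq ν h) :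
    (remainder ν h : (Fin n → M) → ℝ) = fun x =>
      (∑ i : Idx n m, h (fun k => x (i k)) ^ 2 / sigmaSq ν h) / (n.choose m : ℝ) - 1 -
        linearTerm ν h x := by
  ext x
  have := average_sq_eq ν h hm hmn hσ.ne' x
  rw [linearTerm]
  linarith

lemma memLp_three_halves_iff {α : Type*} [MeasurableSpace α] {μ : Measure α} {f : α → ℝ}
    (hf : AEStronglyMeasurable f μ) :
    MemLp f (ENNReal.ofReal (3 / 2)) μ ↔ Integrable (fun x => |f x| ^ (3 / 2 : ℝ)) μ := by
  rw [← integrable_norm_rpow_iff hf (by norm_num) (by norm_num),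
    ENNReal.toReal_ofReal (by norm_num)]
  rfl

lemma integrable_remainder_rpow {h : (Fin m → M) → ℝ} (hh : Measurable h) (hm : 1 ≤ m)
    (hmn : m ≤ n) (h3 : Integrable (fun x => |h x| ^ 3) (prodLaw ν m)) (h0 : mean ν h = 0)
    (hσ : 0 < sigmaSq ν h) :
    Measurable (remainder ν h : (Fin n → M) → ℝ) ∧
      Integrable (fun x : Fin n → M => |remainder ν h x| ^ (3 / 2 : ℝ)) (iid ν (Fin n)) := by
  have hgm : Measurable fun x => h x ^ 2 / sigmaSq ν h := (hh.pow_const 2).div_const _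
  have hg : MemLp (fun x => h x ^ 2 / sigmaSq ν h) (ENNReal.ofReal (3 / 2)) (prodLaw ν m) := by
    rw [memLp_three_halves_iff hgm.aestronglyMeasurable]
    have : ∀ x, |h x ^ 2 / sigmaSq ν h| ^ (3 / 2 : ℝ) =
        |h x| ^ 3 / sigmaSq ν h ^ (3 / 2 : ℝ) := fun x => by
      rw [abs_of_nonneg (by positivity), Real.div_rpow (sq_nonneg _) hσ.le,
        Real.sq_rpow_three_halves]
    simp_rw [this]
    exact h3.div_const _
  have hL := (memLp_three_halves_iff
    (measurable_linearTerm (n := n) (ν := ν) hh).aestronglyMeasurable).2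
    (linearTerm_bound hh hm (hm.trans hmn) h3 h0 hσ).1
  have hRm : Measurable (remainder ν h : (Fin n → M) → ℝ) := by
    rw [remainder_eq h hm hmn hσ]
    exact ((measurable_average hgm _).sub_const _).sub (measurable_linearTerm hh)
  refine ⟨hRm, ?_⟩
  rw [← memLp_three_halves_iff hRm.aestronglyMeasurable, remainder_eq h hm hmn hσ]
  exact ((memLp_average hg _).sub (memLp_const 1)).sub hL

lemma integral_abs_remainder_le {h : (Fin m → M) → ℝ} (hh : Measurable h) (hm : 1 ≤ m)
    (hmn : m ≤ n) (h3 : Integrable (fun x => |h x| ^ 3) (prodLaw ν m)) (h0 : mean ν h = 0)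
    (hσ : 0 < sigmaSq ν h) {X : Fin n → Ω → M} (hX : ∀ i, Measurable (X i))
    (hXν : ∀ i, P.map (X i) = ν) (hXi : iIndepFun X P) :
    ∫ x : Fin n → M, |remainder ν h x| ∂(iid ν (Fin n)) ≤
      normLq P (3 / 2) (fun ω => remainder ν h (fun i => X i ω)) := by
  obtain ⟨hRm, hR⟩ := integrable_remainder_rpow (n := n) hh hm hmn h3 h0 hσ
  have hRi := integrable_of_rpow_three_halves hRm.aestronglyMeasurable hR
  have hJ := rpow_three_halves_integral_le (fun x => abs_nonneg (remainder ν h x)) hRi.abs hR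
  have hI0 : 0 ≤ ∫ x : Fin n → M, |remainder ν h x| ∂(iid ν (Fin n)) :=
    integral_nonneg fun x => abs_nonneg _
  have e : ∫ ω, |remainder ν h (fun i => X i ω)| ^ (3 / 2 : ℝ) ∂P =
      ∫ x : Fin n → M, |remainder ν h x| ^ (3 / 2 : ℝ) ∂(iid ν (Fin n)) := by
    rw [← map_data hX hXν hXi, integral_map (measurable_pi_lambda _ hX).aemeasurable]
    exact (hRm.abs.pow_const _).aestronglyMeasurable
  rw [normLq, e]
  calc _ = ((∫ x : Fin n → M, |remainder ν h x| ∂(iid ν (Fin n))) ^ (3 / 2 : ℝ)) ^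
        (1 / (3 / 2) : ℝ) := by
        rw [← Real.rpow_mul hI0]; norm_num
    _ ≤ _ := Real.rpow_le_rpow (by positivity) hJ (by norm_num)

/-- The fluctuation of `U_{h²} / σ²` under a fourth moment. -/
lemma integral_abs_average_sq_sub_one_le {h : (Fin m → M) → ℝ} (hh : Measurable h)
    (hs : ∀ (τ : Equiv.Perm (Fin m)) (x : Fin m → M), h (fun k => x (τ k)) = h x)
    (h3 : Integrable (fun x => |h x| ^ 3) (prodLaw ν m))
    (h4 : Integrable (fun x => h x ^ 4) (prodLaw ν m)) (h0 : mean ν h = 0)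
    (hσ : 0 < sigmaSq ν h) (hm : 1 ≤ m) (hmn : m ≤ n) :
    Integrable (fun x : Fin n → M =>
      (∑ i : Idx n m, h (fun k => x (i k)) ^ 2 / sigmaSq ν h) / (n.choose m : ℝ) - 1)
      (iid ν (Fin n)) ∧
    ∫ x : Fin n → M, |(∑ i : Idx n m, h (fun k => x (i k)) ^ 2 / sigmaSq ν h) /
      (n.choose m : ℝ) - 1| ∂(iid ν (Fin n)) ≤
      Real.sqrt ((m : ℝ) * mean ν (fun x => (h x ^ 2 - sigmaSq ν h) ^ 2)) /
        (Real.sqrt n * sigmaSq ν h) := by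
  have hc : (0 : ℝ) < n.choose m := by exact_mod_cast Nat.choose_pos hmn
  have hn : (0 : ℝ) < n := by exact_mod_cast hm.trans hmn
  set f : (Fin m → M) → ℝ := fun x => h x ^ 2 / sigmaSq ν h - 1 with hf
  have hfm : Measurable f := ((hh.pow_const 2).div_const _).sub_const _
  have h2 : MemLp (fun x => h x ^ 2) 2 (prodLaw ν m) := by
    rw [memLp_two_iff_integrable_sq (hh.pow_const 2).aestronglyMeasurable]
    simpa only [← pow_mul] using h4
  have hf2 : MemLp f 2 (prodLaw ν m) := by
    have : MemLp (fun x => h x ^ 2 / sigmaSq ν h) 2 (prodLaw ν m) := by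
      simpa [div_eq_inv_mul] using h2.const_mul (sigmaSq ν h)⁻¹
    exact this.sub (memLp_const 1)
  have hf0 : ∫ x, f x ∂(prodLaw ν m) = 0 := by
    rw [hf, integral_sub ((memLp_two_of_cube hh h3).integrable_sq.div_const _)
      (integrable_const _), integral_div, integral_sq_eq_sigmaSq hh h0]
    simp [hσ.ne']
  have hav : ∀ x : Fin n → M, (∑ i : Idx n m, h (fun k => x (i k)) ^ 2 / sigmaSq ν h) /
      (n.choose m : ℝ) - 1 = (∑ i : Idx n m, f (fun k => x (i k))) / (n.choose m : ℝ) := by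
    intro x
    rw [hf]
    simp only [Finset.sum_sub_distrib, Finset.sum_const, Finset.card_univ, card_idx, nsmul_eq_mul,
      mul_one, sub_div, div_self hc.ne']
  simp_rw [hav]
  have hmem := memLp_average (n := n) hf2 (n.choose m : ℝ)
  refine ⟨hmem.integrable (by norm_num), (integral_abs_le_sqrt hmem).trans ?_⟩
  -- For h²/σ² - 1 only centring is available, so the variance bound is taken with d = 1.
  have hb := integral_average_sq_le (n := n) hfm hf2 (fun τ x => by simp only [hf, hs τ x]) hf0 hm
    hmn le_rfl fun A hA => by
      rw [Finset.card_eq_zero.1 (Nat.lt_one_iff.1 hA), overlap_empty]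
      exact (sq_eq_zero_iff.2 hf0)
  rw [Kconst_one hm hmn] at hb
  have e : ∫ x, f x ^ 2 ∂(iid ν (Fin m)) =
      mean ν (fun x => (h x ^ 2 - sigmaSq ν h) ^ 2) / sigmaSq ν h ^ 2 := by
    rw [mean, ← integral_div]
    refine integral_congr_ae (Filter.Eventually.of_forall fun x => ?_)
    simp only [hf]
    field_simp
  rw [e] at hb
  refine (Real.sqrt_le_sqrt hb).trans_eq ?_
  rw [show (m : ℝ) / n * (mean ν (fun x => (h x ^ 2 - sigmaSq ν h) ^ 2) / sigmaSq ν h ^ 2) =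
    (m : ℝ) * mean ν (fun x => (h x ^ 2 - sigmaSq ν h) ^ 2) / (n * sigmaSq ν h ^ 2) by field_simp,
    Real.sqrt_div' _ (by positivity), Real.sqrt_mul (by positivity) (sigmaSq ν h ^ 2),
    Real.sqrt_sq hσ.le]

lemma one_div_sqrt_le_baseError {N : ℕ} {h : (Fin m → M) → ℝ} (hh : Measurable h)
    (h3 : Integrable (fun x => |h x| ^ 3) (prodLaw ν m)) (h0 : mean ν h = 0)
    (hσ : 0 < sigmaSq ν h) : 1 / Real.sqrt N ≤ baseError ν h n N := by
  have h1 := one_le_mean_cube hh h3 h0 hσ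
  have h2 : 1 / Real.sqrt N ≤
      2 * (mean ν (fun x => |h x| ^ 3) / sigma ν h ^ 3) / Real.sqrt N := by
    gcongr; linarith
  have h3 := Real.sqrt_nonneg ((N : ℝ) * Kconst n m (rank ν h))
  rw [baseError]
  linarith

end IncompleteU

end

/-! ### The two bounds -/

theorem theorem3 :
    ∃ C : ℝ, 0 < C ∧
      ∀ (M : Type*) [MeasurableSpace M] (Ω : Type*) [MeasurableSpace Ω]
        (P : Measure Ω) [IsProbabilityMeasure P] (ν : Measure M) [IsProbabilityMeasure ν]
        (m n N : ℕ) (h : (Fin m → M) → ℝ) (X : Fin n → Ω → M)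
        (Z : IncompleteU.Idx n m → Ω → ℝ),
        2 ≤ m → 2 * m < n → 0 < N → N < n.choose m →
        -- the kernel is measurable and symmetric
        Measurable h → (∀ (τ : Equiv.Perm (Fin m)) (x : Fin m → M), h (fun k => x (τ k)) = h x) →
        -- the data are i.i.d. with law `ν`
        (∀ i, Measurable (X i)) → (∀ i, P.map (X i) = ν) → iIndepFun X P →
        -- the samplers are i.i.d. Bernoulli with success probability `p`
        (∀ i, Measurable (Z i)) →
        (∀ i, P.real {ω | Z i ω = 1} = IncompleteU.sampProb n m N) →
        (∀ i, P.real {ω | Z i ω = 0} = 1 - IncompleteU.sampProb n m N) →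
        iIndepFun Z P →
        -- the samplers are independent of the data
        IndepFun (fun ω i => X i ω) (fun ω i => Z i ω) P →
        -- moment assumptions
        Integrable (fun x => |h x| ^ 3) (IncompleteU.prodLaw ν m) →
        IncompleteU.mean ν h = 0 → 0 < IncompleteU.sigmaSq ν h →
        (IncompleteU.kolmogorovDist P
            (fun ω => Real.sqrt N * IncompleteU.incompleteU h X Z ω / IncompleteU.sigma ν h) ≤
          C * (IncompleteU.B1 ν h n N +
            Real.sqrt ((N : ℝ) * IncompleteU.Kconst n m (IncompleteU.rank ν h)) /
              Real.sqrt (1 - IncompleteU.sampProb n m N) +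
            (m : ℝ) ^ (3 / 2 : ℝ) * (∫ x, IncompleteU.Psi1 ν h x ^ (3 / 2 : ℝ) ∂ν) /
              (Real.sqrt n * IncompleteU.sigma ν h ^ 3) +
            IncompleteU.normLq P (3 / 2)
              (fun ω => IncompleteU.remainder ν h (fun i => X i ω)))) ∧
        (Integrable (fun x => h x ^ 4) (IncompleteU.prodLaw ν m) →
          IncompleteU.kolmogorovDist P
            (fun ω => Real.sqrt N * IncompleteU.incompleteU h X Z ω / IncompleteU.sigma ν h) ≤
          C * (IncompleteU.B1 ν h n N +
            Real.sqrt ((N : ℝ) * IncompleteU.Kconst n m (IncompleteU.rank ν h)) /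
              Real.sqrt (1 - IncompleteU.sampProb n m N) +
            Real.sqrt ((m : ℝ) *
                IncompleteU.mean ν (fun x => (h x ^ 2 - IncompleteU.sigmaSq ν h) ^ 2)) /
              (Real.sqrt n * IncompleteU.sigmaSq ν h))) := by

  open IncompleteU in
  -- A generous constant: `baseError` enters with factor 1002 and costs 4 more, and the linear term
  -- enters with factor 1001·6.
  refine ⟨30000, by norm_num, ?_⟩
  intro M _ Ω _ P _ ν _ m n N h X Z hm2 hmn2 hN hNn hh hs hX hXν hXi hZ hZ1 hZ0 hZi hXZ h3 h0 hσ
  have hm : 1 ≤ m := by omega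
  have hmn : m ≤ n := by omega
  have hN1 : (1 : ℝ) ≤ N := by exact_mod_cast hN
  have hbase := baseError_le hmn hN hNn hσ
  have hpos : 0 ≤ 1 / Real.sqrt (N : ℝ) := by positivity
  have hsqrt := one_div_sqrt_le_baseError (n := n) (N := N) hh h3 h0 hσ
  refine ⟨?_, fun h4 => ?_⟩
  · obtain ⟨hL32, hL0, hLb⟩ := linearTerm_bound (n := n) hh hm (hm.trans hmn) h3 h0 hσ
    obtain ⟨hRm, hR32⟩ := integrable_remainder_rpow (n := n) hh hm hmn h3 h0 hσ
    have hRb := integral_abs_remainder_le hh hm hmn h3 h0 hσ hX hXν hXi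
    have hk := kolmogorovDist_le hN1 fun z hz =>
      abs_cdf_sub_Phi_le hm hmn hN hNn.le hh hs hX hXν hXi hZ hZ1 hZ0 hZi hXZ h3 h0 hσ
        (integrable_of_rpow_three_halves (measurable_linearTerm hh).aestronglyMeasurable hL32)
        hL0 hL32 (integrable_of_rpow_three_halves hRm.aestronglyMeasurable hR32)
        (average_sq_eq ν h hm hmn hσ.ne') hz
    have p1 := (integral_nonneg fun x : Fin n → M =>
      Real.rpow_nonneg (abs_nonneg (linearTerm ν h x)) (3 / 2)).trans hLb
    have p2 := (integral_nonneg fun x : Fin n → M => abs_nonneg (remainder ν h x)).trans hRb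
    linarith
  · obtain ⟨hRi, hRb⟩ := integral_abs_average_sq_sub_one_le (n := n) hh hs h3 h4 h0 hσ hm hmn
    have hk := kolmogorovDist_le hN1 fun z hz =>
      -- No linear term is separated: the whole fluctuation of U_{h²} / σ² goes into R, whose first
      -- absolute moment is controlled by its variance.
      abs_cdf_sub_Phi_le (L := fun _ => 0) hm hmn hN hNn.le hh hs hX hXν hXi hZ hZ1 hZ0 hZi hXZ h3
        h0 hσ (integrable_zero _ _ _) (by simp) (by simp) hRi (fun x => by ring) hz
    have e : ∫ _ : Fin n → M, |(0 : ℝ)| ^ (3 / 2 : ℝ) ∂(IidPi.iid ν (Fin n)) = 0 := by simp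
    rw [e] at hk
    have p2 := (integral_nonneg fun x : Fin n → M => abs_nonneg _).trans hRb
    linarith
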